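/- Let $M_N$ denote the space of $N\times N$ complex matrices with the operator norm on $\ell_2^N$. For operator spaces $E,F$ and a linear map $u:E\to F$ let $u_N=\mathrm{Id}\otimes u: M_N(E)\to M_N(F)$, and let $$d_N(E,F)=\inf\{\|u_N\|\,\|(u^{-1})_N\| \ :\ u:E\to F \text{ a linear isomorphism}\}$$ (with $d_N(E,F)=\infty$ if $E$ and $F$ are not isomorphic). For a finite-dimensional operator space $E$ and $C>0$ let $k_E(N,C)$ be the least integer $k$ such that the direct sum $M_N\oplus\cdots\oplus M_N$ of $k$ copies of $M_N$ (with the maximum norm) contains a linear subspace $F$ with $d_N(E,F)\le C$ (and $k_E(N,C)=\infty$ if there is no such $k$). Consider the following $n$-dimensional operator spaces. (a) $OH_n$: the space $\ell_2^n$ with orthonormal basis $(e_j)$ and $\|\sum_j x_j\otimes e_j\|_{M_m(OH_n)}=\|\sum_j x_j\otimes\overline{x_j}\|^{1/2}$ for all $m\ge 1$ and $x_1,\dots,x_n\in M_m$. (b) $\max(\ell_1^n)$: the space $\ell_1^n$ with its maximal operator space structure. (c) $R_n+C_n$: the quotient of the operator space direct sum $R_n\oplus_1 C_n$ of the row space $R_n=M_{1,n}$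 and the column space $C_n=M_{n,1}$ by the map $(a,b)\mapsto a+b$, where $R_n$ and $C_n$ are both identified with $\mathbb C^n$ in the canonical way. Theorem. There are numbers $C_1>1$, $b>0$ and an integer $n_0>1$ such that for all $n\ge n_0$, all $N\ge 1$ and each of the three spaces $E=OH_n$, $E=\max(\ell_1^n)$, $E=R_n+C_n$ we have $$k_E(N,C_1)\ \ge\ \exp(b\,nN^2).$$ -/

import Mathlib

noncomputable section

namespace MatricialMultiplicity

open scoped Matrix.Norms.L2Operator Kronecker

section NormLemmas

variable {p q r s : Type*} [Fintype p] [Fintype q] [Fintype r] [Fintype s]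
  [DecidableEq q] [DecidableEq s]

theorem sum_norm_mulVec_sq_le (A : Matrix p q ℂ) (v : q → ℂ) :
    ∑ i, ‖(A.mulVec v) i‖ ^ 2 ≤ ‖A‖ ^ 2 * ∑ j, ‖v j‖ ^ 2 := by
  have h := A.l2_opNorm_mulVec (WithLp.toLp 2 v)
  have h2 := pow_le_pow_left₀ (norm_nonneg _) h 2
  rw [mul_pow, EuclideanSpace.norm_sq_eq, EuclideanSpace.norm_sq_eq] at h2
  simpa using h2

theorem opNorm_le_of_sq {A : Matrix p q ℂ} {c : ℝ} (hc : 0 ≤ c)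
    (h : ∀ v : q → ℂ, ∑ i, ‖(A.mulVec v) i‖ ^ 2 ≤ c ^ 2 * ∑ j, ‖v j‖ ^ 2) : ‖A‖ ≤ c := by
  rw [Matrix.l2_opNorm_def]
  refine ContinuousLinearMap.opNorm_le_bound _ hc fun v => ?_
  refine (sq_le_sq₀ (norm_nonneg _) (by positivity)).mp ?_
  rw [mul_pow, EuclideanSpace.norm_sq_eq, EuclideanSpace.norm_sq_eq]
  simpa using h v.ofLp

theorem norm_submatrix_equiv_le (A : Matrix p q ℂ) (e : r ≃ p) (f : s ≃ q) :
    ‖A.submatrix e f‖ ≤ ‖A‖ := by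
  refine opNorm_le_of_sq (norm_nonneg _) fun v => ?_
  have h := sum_norm_mulVec_sq_le A (v ∘ f.symm)
  rw [← e.sum_comp, ← f.sum_comp (fun j => ‖(v ∘ f.symm) j‖ ^ 2)] at h
  simpa [Matrix.submatrix_mulVec_equiv] using h

theorem norm_fromBlocks_diag_le (A : Matrix p q ℂ) (D : Matrix r s ℂ) :
    ‖Matrix.fromBlocks A 0 0 D‖ ≤ max ‖A‖ ‖D‖ := by
  have h0 : 0 ≤ max ‖A‖ ‖D‖ := le_max_of_le_left (norm_nonneg _)
  refine opNorm_le_of_sq h0 fun v => ?_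
  have hA := sum_norm_mulVec_sq_le A (v ∘ Sum.inl)
  have hD := sum_norm_mulVec_sq_le D (v ∘ Sum.inr)
  rw [Matrix.fromBlocks_mulVec, Fintype.sum_sum_type, Fintype.sum_sum_type, mul_add]
  have hA2 : ‖A‖ ^ 2 ≤ (max ‖A‖ ‖D‖) ^ 2 := by gcongr; exact le_max_left _ _
  have hD2 : ‖D‖ ^ 2 ≤ (max ‖A‖ ‖D‖) ^ 2 := by gcongr; exact le_max_right _ _
  have hA3 := hA.trans (mul_le_mul_of_nonneg_right hA2
    (Finset.sum_nonneg fun j _ => sq_nonneg ‖(v ∘ Sum.inl) j‖))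
  have hD3 := hD.trans (mul_le_mul_of_nonneg_right hD2
    (Finset.sum_nonneg fun j _ => sq_nonneg ‖(v ∘ Sum.inr) j‖))
  simpa using add_le_add hA3 hD3

theorem norm_kronecker_one_le (A : Matrix p q ℂ) :
    ‖A ⊗ₖ (1 : Matrix s s ℂ)‖ ≤ ‖A‖ := by
  refine opNorm_le_of_sq (norm_nonneg _) fun v => ?_
  have h : ∀ i t, ((A ⊗ₖ (1 : Matrix s s ℂ)).mulVec v) (i, t) =
      (A.mulVec fun j => v (j, t)) i := by
    intro i t
    simp [Matrix.mulVec, dotProduct, Fintype.sum_prod_type, Matrix.one_apply]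
  rw [Fintype.sum_prod_type_right, Fintype.sum_prod_type_right, Finset.mul_sum]
  refine Finset.sum_le_sum fun t _ => ?_
  simp only [h]
  exact sum_norm_mulVec_sq_le A fun j => v (j, t)

end NormLemmas

/-- The product `α x β`, with entries `∑ α i a • x a b • β b j`, of a matrix `x` over `E` with
scalar matrices. -/
def scalarMul {E : Type*} [AddCommGroup E] [Module ℂ E] {k m : ℕ}
    (α : Matrix (Fin k) (Fin m) ℂ) (x : Matrix (Fin m) (Fin m) E)
    (β : Matrix (Fin m) (Fin k) ℂ) : Matrix (Fin k) (Fin k) E :=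
  Matrix.of fun i j => ∑ a, ∑ b, (α i a * β b j) • x a b

/-- The block diagonal matrix `x ⊕ y`. -/
def blockSum {E : Type*} [Zero E] {m k : ℕ} (x : Matrix (Fin m) (Fin m) E)
    (y : Matrix (Fin k) (Fin k) E) : Matrix (Fin (m + k)) (Fin (m + k)) E :=
  Matrix.reindex finSumFinEquiv finSumFinEquiv (Matrix.fromBlocks x 0 0 y)

/-- A sequence of seminorms on the spaces `M_m(E)` that satisfies Ruan's axioms. (The inequality
opposite to `blockSum_le` follows from `scalarMul_le`.) -/
structure MatrixSeminorm (E : Type*) [AddCommGroup E] [Module ℂ E] where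
  norm : (m : ℕ) → Matrix (Fin m) (Fin m) E → ℝ
  add_le : ∀ (m : ℕ) (x y : Matrix (Fin m) (Fin m) E), norm m (x + y) ≤ norm m x + norm m y
  smul_eq : ∀ (m : ℕ) (c : ℂ) (x : Matrix (Fin m) (Fin m) E), norm m (c • x) = ‖c‖ * norm m x
  blockSum_le : ∀ (m k : ℕ) (x : Matrix (Fin m) (Fin m) E) (y : Matrix (Fin k) (Fin k) E),
    norm (m + k) (blockSum x y) ≤ max (norm m x) (norm k y)
  scalarMul_le : ∀ (k m : ℕ) (α : Matrix (Fin k) (Fin m) ℂ) (x : Matrix (Fin m) (Fin m) E)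
    (β : Matrix (Fin m) (Fin k) ℂ), norm k (scalarMul α x β) ≤ ‖α‖ * norm m x * ‖β‖

/-- An operator space structure on a complex vector space `E`: norms on all the spaces `M_m(E)`
that satisfy Ruan's axioms. By Ruan's theorem these are the matrix norms that come from linear
embeddings of `E` into some `B(H)`. -/
structure OperatorSpace (E : Type*) [AddCommGroup E] [Module ℂ E] extends MatrixSeminorm E where
  eq_zero_of_norm : ∀ (m : ℕ) (x : Matrix (Fin m) (Fin m) E), norm m x = 0 → x = 0

section Constructions

variable {E F : Type*} [AddCommGroup E] [Module ℂ E] [AddCommGroup F] [Module ℂ F]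

theorem MatrixSeminorm.norm_zero (S : MatrixSeminorm E) (m : ℕ) : S.norm m 0 = 0 := by
  simpa using S.smul_eq m 0 0

theorem MatrixSeminorm.norm_nonneg (S : MatrixSeminorm E) (m : ℕ)
    (x : Matrix (Fin m) (Fin m) E) : 0 ≤ S.norm m x := by
  have h := S.add_le m x ((-1 : ℂ) • x)
  have h0 : x + (-1 : ℂ) • x = 0 := by simp
  rw [S.smul_eq, h0, S.norm_zero] at h
  simp at h
  linarith

/-- The map `u_m = Id ⊗ u : M_m(E) → M_m(F)`. -/
def amplify (u : E →ₗ[ℂ] F) (m : ℕ) (x : Matrix (Fin m) (Fin m) E) : Matrix (Fin m) (Fin m) F :=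
  x.map u

theorem amplify_add (u : E →ₗ[ℂ] F) (m : ℕ) (x y : Matrix (Fin m) (Fin m) E) :
    amplify u m (x + y) = amplify u m x + amplify u m y := by
  ext; simp [amplify]

theorem amplify_smul (u : E →ₗ[ℂ] F) (m : ℕ) (c : ℂ) (x : Matrix (Fin m) (Fin m) E) :
    amplify u m (c • x) = c • amplify u m x := by
  ext; simp [amplify]

theorem amplify_blockSum (u : E →ₗ[ℂ] F) (m k : ℕ) (x : Matrix (Fin m) (Fin m) E)
    (y : Matrix (Fin k) (Fin k) E) :
    amplify u (m + k) (blockSum x y) = blockSum (amplify u m x) (amplify u k y) := by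
  ext i j
  obtain ⟨i, rfl⟩ := finSumFinEquiv.surjective i
  obtain ⟨j, rfl⟩ := finSumFinEquiv.surjective j
  rcases i with i | i <;> rcases j with j | j <;> simp [amplify, blockSum]

theorem amplify_scalarMul (u : E →ₗ[ℂ] F) (k m : ℕ) (α : Matrix (Fin k) (Fin m) ℂ)
    (x : Matrix (Fin m) (Fin m) E) (β : Matrix (Fin m) (Fin k) ℂ) :
    amplify u k (scalarMul α x β) = scalarMul α (amplify u m x) β := by
  ext i j; simp [amplify, scalarMul]

/-- The matrix seminorms on `E` induced by a linear map from `E` to `F`. -/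
def MatrixSeminorm.pullback (S : MatrixSeminorm F) (u : E →ₗ[ℂ] F) : MatrixSeminorm E where
  norm m x := S.norm m (amplify u m x)
  add_le m x y := by rw [amplify_add]; exact S.add_le _ _ _
  smul_eq m c x := by rw [amplify_smul]; exact S.smul_eq _ _ _
  blockSum_le m k x y := by rw [amplify_blockSum]; exact S.blockSum_le _ _ _ _
  scalarMul_le k m α x β := by rw [amplify_scalarMul]; exact S.scalarMul_le _ _ _ _ _

/-- The operator space structure on `E` induced by an injective linear map from `E` to `F`. -/
def OperatorSpace.pullback (S : OperatorSpace F) (u : E →ₗ[ℂ] F) (hu : Function.Injective u) :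
    OperatorSpace E where
  toMatrixSeminorm := S.toMatrixSeminorm.pullback u
  eq_zero_of_norm m x hx := by
    have h := S.eq_zero_of_norm m _ hx
    ext i j
    have hij := congrFun (congrFun h i) j
    simp only [amplify, Matrix.map_apply, Matrix.zero_apply] at hij
    exact (map_eq_zero_iff u hu).mp hij

/-- The operator space structure of a linear subspace. -/
def OperatorSpace.restrict (S : OperatorSpace E) (V : Submodule ℂ E) : OperatorSpace V :=
  S.pullback V.subtype V.injective_subtype

/-- The supremum of a pointwise bounded family of matrix seminorms. -/
def MatrixSeminorm.sup {ι : Type*} (S : ι → MatrixSeminorm E)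
    (hS : ∀ m x, BddAbove (Set.range fun i => (S i).norm m x)) : MatrixSeminorm E where
  norm m x := ⨆ i, (S i).norm m x
  add_le m x y := by
    refine Real.iSup_le (fun i => ((S i).add_le m x y).trans
      (add_le_add (le_ciSup (hS m x) i) (le_ciSup (hS m y) i))) ?_
    exact add_nonneg (Real.iSup_nonneg fun i => (S i).norm_nonneg m x)
      (Real.iSup_nonneg fun i => (S i).norm_nonneg m y)
  smul_eq m c x := by
    rw [Real.mul_iSup_of_nonneg (_root_.norm_nonneg c)]
    exact iSup_congr fun i => (S i).smul_eq m c x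
  blockSum_le m k x y := by
    refine Real.iSup_le (fun i => ((S i).blockSum_le m k x y).trans
      (max_le_max (le_ciSup (hS m x) i) (le_ciSup (hS k y) i))) ?_
    exact le_max_of_le_left (Real.iSup_nonneg fun i => (S i).norm_nonneg m x)
  scalarMul_le k m α x β := by
    refine Real.iSup_le (fun i => ((S i).scalarMul_le k m α x β).trans ?_) ?_
    · have := le_ciSup (hS m x) i
      gcongr
    · have : 0 ≤ ⨆ i, (S i).norm m x := Real.iSup_nonneg fun i => (S i).norm_nonneg m x
      positivity

theorem MatrixSeminorm.le_sup {ι : Type*} (S : ι → MatrixSeminorm E)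
    (hS : ∀ m x, BddAbove (Set.range fun i => (S i).norm m x)) (i : ι) (m : ℕ)
    (x : Matrix (Fin m) (Fin m) E) : (S i).norm m x ≤ (MatrixSeminorm.sup S hS).norm m x :=
  le_ciSup (hS m x) i

/-- The quotient matrix seminorms on `F` given by a surjective linear map from `E` onto `F`:
`‖y‖` is the infimum of the norms of the liftings of `y`. -/
def MatrixSeminorm.quotient (S : MatrixSeminorm E) (u : E →ₗ[ℂ] F)
    (hu : Function.Surjective u) : MatrixSeminorm F :=
  have hne : ∀ m (y : Matrix (Fin m) (Fin m) F), Nonempty {x // amplify u m x = y} := by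
    intro m y
    choose g hg using hu
    exact ⟨y.map g, by ext; simp [amplify, hg]⟩
  have hbdd : ∀ m (y : Matrix (Fin m) (Fin m) F),
      BddBelow (Set.range fun x : {x // amplify u m x = y} => S.norm m x) := by
    intro m y
    exact ⟨0, by rintro _ ⟨x, rfl⟩; exact S.norm_nonneg m x⟩
  have hapx : ∀ m (y : Matrix (Fin m) (Fin m) F) (ε : ℝ), 0 < ε → ∃ x, amplify u m x = y ∧
      S.norm m x < (⨅ x : {x // amplify u m x = y}, S.norm m x) + ε := by
    intro m y ε hε
    have := hne m y
    obtain ⟨x, hx⟩ := exists_lt_of_ciInf_lt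
      (lt_add_of_pos_right (⨅ x : {x // amplify u m x = y}, S.norm m x) hε)
    exact ⟨x, x.2, hx⟩
  have hle : ∀ m (y : Matrix (Fin m) (Fin m) F) x, amplify u m x = y →
      (⨅ x : {x // amplify u m x = y}, S.norm m x) ≤ S.norm m x := by
    intro m y x hx
    exact ciInf_le (hbdd m y) ⟨x, hx⟩
  have hsmul : ∀ m (c : ℂ) (y : Matrix (Fin m) (Fin m) F),
      (⨅ x : {x // amplify u m x = c • y}, S.norm m x) ≤
        ‖c‖ * ⨅ x : {x // amplify u m x = y}, S.norm m x := by
    intro m c y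
    have := hne m y
    rw [Real.mul_iInf_of_nonneg (_root_.norm_nonneg c)]
    refine le_ciInf fun x => (hle m _ (c • x.1) (by rw [amplify_smul, x.2])).trans ?_
    rw [S.smul_eq]
  { norm := fun m y => ⨅ x : {x // amplify u m x = y}, S.norm m x
    add_le := by
      intro m y y'
      refine le_of_forall_pos_le_add fun ε hε => ?_
      obtain ⟨x, hx, hx'⟩ := hapx m y (ε / 2) (by linarith)
      obtain ⟨z, hz, hz'⟩ := hapx m y' (ε / 2) (by linarith)
      have h1 := hle m (y + y') (x + z) (by rw [amplify_add, hx, hz])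
      have h2 := S.add_le m x z
      linarith
    smul_eq := by
      intro m c y
      refine le_antisymm (hsmul m c y) ?_
      by_cases hc : c = 0
      · subst hc
        simp only [_root_.norm_zero, zero_mul]
        exact Real.iInf_nonneg fun x => S.norm_nonneg m _
      · have h := hsmul m c⁻¹ (c • y)
        rw [smul_smul, inv_mul_cancel₀ hc, one_smul, norm_inv] at h
        have hc' : 0 < ‖c‖ := norm_pos_iff.mpr hc
        calc _ ≤ ‖c‖ * (‖c‖⁻¹ * ⨅ x : {x // amplify u m x = c • y}, S.norm m x) := by gcongr
          _ = _ := by field_simp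
    blockSum_le := by
      intro m k y y'
      refine le_of_forall_pos_le_add fun ε hε => ?_
      obtain ⟨x, hx, hx'⟩ := hapx m y ε hε
      obtain ⟨z, hz, hz'⟩ := hapx k y' ε hε
      refine (hle _ _ (blockSum x z) (by rw [amplify_blockSum, hx, hz])).trans
        ((S.blockSum_le m k x z).trans ?_)
      rw [← max_add_add_right]
      exact max_le_max hx'.le hz'.le
    scalarMul_le := by
      intro k m α y β
      have := hne m y
      rw [mul_right_comm, Real.mul_iInf_of_nonneg (by positivity)]
      refine le_ciInf fun x => (hle k _ (scalarMul α x.1 β) (by rw [amplify_scalarMul, x.2])).trans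
        ((S.scalarMul_le k m α x.1 β).trans_eq (by ring)) }

end Constructions

/-- The operator space `M_{p,q} = B(ℓ₂^q, ℓ₂^p)`: a matrix in `M_m(M_{p,q})` is normed as an
`mp × mq` matrix. -/
def matrixSpace (p q : Type*) [Fintype p] [Fintype q] [DecidableEq q] :
    OperatorSpace (Matrix p q ℂ) where
  norm m x := ‖Matrix.comp (Fin m) (Fin m) p q ℂ x‖
  add_le m x y := norm_add_le (Matrix.comp (Fin m) (Fin m) p q ℂ x) (Matrix.comp _ _ _ _ _ y)
  smul_eq m c x := norm_smul c (Matrix.comp (Fin m) (Fin m) p q ℂ x)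
  blockSum_le m k x y := by
    refine le_trans (le_trans (le_of_eq ?_) (norm_submatrix_equiv_le
      (Matrix.fromBlocks (Matrix.comp (Fin m) (Fin m) p q ℂ x) 0 0
        (Matrix.comp (Fin k) (Fin k) p q ℂ y))
      ((finSumFinEquiv.symm.prodCongr (Equiv.refl p)).trans (Equiv.sumProdDistrib _ _ _))
      ((finSumFinEquiv.symm.prodCongr (Equiv.refl q)).trans (Equiv.sumProdDistrib _ _ _))))
      (norm_fromBlocks_diag_le _ _)
    congr 1
    ext ⟨i, a⟩ ⟨j, b⟩
    obtain ⟨i, rfl⟩ := finSumFinEquiv.surjective i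
    obtain ⟨j, rfl⟩ := finSumFinEquiv.surjective j
    rcases i with i | i <;> rcases j with j | j <;> simp [blockSum]
  scalarMul_le k m α x β := by
    classical
    have h : Matrix.comp (Fin k) (Fin k) p q ℂ (scalarMul α x β) =
        (α ⊗ₖ (1 : Matrix p p ℂ)) * Matrix.comp (Fin m) (Fin m) p q ℂ x *
          (β ⊗ₖ (1 : Matrix q q ℂ)) := by
      ext ⟨i, a⟩ ⟨j, b⟩
      simp [scalarMul, Matrix.mul_apply, Fintype.sum_prod_type, Matrix.one_apply, Matrix.sum_apply,
        Finset.sum_mul]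
      rw [Finset.sum_comm]
      refine Finset.sum_congr rfl fun c _ => Finset.sum_congr rfl fun d _ => by ring
    rw [h]
    refine (Matrix.l2_opNorm_mul _ _).trans ?_
    refine mul_le_mul ((Matrix.l2_opNorm_mul _ _).trans ?_) (norm_kronecker_one_le _)
      (norm_nonneg _) (by positivity)
    gcongr
    exact norm_kronecker_one_le _
  eq_zero_of_norm m x hx := by
    have h := norm_eq_zero.mp hx
    ext i j a b
    exact congrFun (congrFun h (i, a)) (j, b)

section OperatorNorms

variable {E F : Type*} [AddCommGroup E] [Module ℂ E] [AddCommGroup F] [Module ℂ F]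

/-- The norm `‖u_N‖` of `u_N : M_N(E) → M_N(F)`, with values in `[0, ∞]`. -/
def amplifyNorm (S : OperatorSpace E) (T : OperatorSpace F) (u : E →ₗ[ℂ] F) (N : ℕ) : ENNReal :=
  ⨆ (x : Matrix (Fin N) (Fin N) E) (_ : S.norm N x ≤ 1), ENNReal.ofReal (T.norm N (amplify u N x))

/-- The distance `d_N(E, F)`, which is `∞` if `E` and `F` are not isomorphic. -/
def matrixDist (S : OperatorSpace E) (T : OperatorSpace F) (N : ℕ) : ENNReal :=
  ⨅ u : E ≃ₗ[ℂ] F, amplifyNorm S T u.toLinearMap N * amplifyNorm T S u.symm.toLinearMap N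

/-- `u` is completely contractive. -/
def IsCompleteContraction (S : OperatorSpace E) (T : OperatorSpace F) (u : E →ₗ[ℂ] F) : Prop :=
  ∀ (m : ℕ) (x : Matrix (Fin m) (Fin m) E), T.norm m (amplify u m x) ≤ S.norm m x

/-- The direct sum `M_N ⊕ ⋯ ⊕ M_N` of `k` copies of `M_N`, with
`‖x‖ = max_i ‖x_i‖` in `M_m(M_N ⊕ ⋯ ⊕ M_N)`. -/
def directSum (k N : ℕ) : OperatorSpace (Fin k → Matrix (Fin N) (Fin N) ℂ) where
  toMatrixSeminorm := MatrixSeminorm.sup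
    (fun i : Fin k => (matrixSpace (Fin N) (Fin N)).toMatrixSeminorm.pullback (LinearMap.proj i))
    (fun _ _ => Set.finite_range _ |>.bddAbove)
  eq_zero_of_norm m x hx := by
    refine Matrix.ext fun a b => funext fun i => ?_
    have hle := (MatrixSeminorm.le_sup (fun i : Fin k =>
      (matrixSpace (Fin N) (Fin N)).toMatrixSeminorm.pullback (LinearMap.proj i))
      (fun _ _ => Set.finite_range _ |>.bddAbove) i m x).trans hx.le
    have h := (matrixSpace (Fin N) (Fin N)).eq_zero_of_norm m _
      (le_antisymm hle (MatrixSeminorm.norm_nonneg _ _ _))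
    exact congrFun (congrFun h a) b

/-- The number `k_E(N, C)`: the least `k` such that some linear subspace `V` of the direct sum of
`k` copies of `M_N` satisfies `d_N(E, V) ≤ C` (and `∞` if there is no such `k`). -/
def multiplicity (S : OperatorSpace E) (N : ℕ) (C : ℝ) : ℕ∞ :=
  ⨅ (k : ℕ) (_ : ∃ V : Submodule ℂ (Fin k → Matrix (Fin N) (Fin N) ℂ),
    matrixDist S ((directSum k N).restrict V) N ≤ ENNReal.ofReal C), (k : ℕ∞)

end OperatorNorms

section Maximal

theorem norm_single_le {m k : ℕ} (i : Fin m) (j : Fin k) :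
    ‖(Matrix.single i j 1 : Matrix (Fin m) (Fin k) ℂ)‖ ≤ 1 := by
  refine opNorm_le_of_sq zero_le_one fun v => ?_
  have h : ∀ a, ((Matrix.single i j 1 : Matrix (Fin m) (Fin k) ℂ).mulVec v) a =
      if a = i then v j else 0 := by
    intro a
    by_cases ha : a = i
    · subst ha; simp [Matrix.mulVec, dotProduct, Matrix.single_apply]
    · simp [Matrix.mulVec, dotProduct, ha, Ne.symm ha]
  simp only [h]
  rw [Finset.sum_eq_single i (by intro b _ hb; simp [hb]) (by simp)]
  simpa using Finset.single_le_sum (f := fun j => ‖v j‖ ^ 2) (fun _ _ => sq_nonneg _)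
    (Finset.mem_univ j)

theorem MatrixSeminorm.norm_le_sum {E : Type*} [AddCommGroup E] [Module ℂ E]
    (S : MatrixSeminorm E) (m : ℕ) (x : Matrix (Fin m) (Fin m) E) :
    S.norm m x ≤ ∑ i, ∑ j, S.norm 1 (fun _ _ => x i j) := by
  have hx : x = ∑ i, ∑ j, scalarMul (Matrix.single i 0 1) (fun _ _ : Fin 1 => x i j)
      (Matrix.single 0 j 1) := by
    ext a b
    simp [scalarMul, Matrix.sum_apply, Matrix.single_apply, ite_and]
  have hs : ∀ (s : Finset (Fin m)) (f : Fin m → Matrix (Fin m) (Fin m) E),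
      S.norm m (∑ i ∈ s, f i) ≤ ∑ i ∈ s, S.norm m (f i) := fun s f =>
    Finset.le_sum_of_subadditive (S.norm m) (S.norm_zero m).le (S.add_le m) s f
  conv_lhs => rw [hx]
  refine (hs _ _).trans (Finset.sum_le_sum fun i _ => (hs _ _).trans
    (Finset.sum_le_sum fun j _ => (S.scalarMul_le _ _ _ _ _).trans ?_))
  have h0 := S.norm_nonneg 1 (fun _ _ => x i j)
  calc _ ≤ 1 * S.norm 1 (fun _ _ => x i j) * 1 := by
        gcongr <;> exact norm_single_le _ _
    _ = _ := by ring

theorem matrixSpace_norm_one {p q : Type*} [Fintype p] [Fintype q] [DecidableEq q]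
    (A : Matrix p q ℂ) : (matrixSpace p q).norm 1 (fun _ _ => A) = ‖A‖ := by
  refine le_antisymm ?_ ?_
  · exact norm_submatrix_equiv_le A (Equiv.uniqueProd p (Fin 1)) (Equiv.uniqueProd q (Fin 1))
  · exact norm_submatrix_equiv_le (Matrix.comp (Fin 1) (Fin 1) p q ℂ fun _ _ => A)
      (Equiv.uniqueProd p (Fin 1)).symm (Equiv.uniqueProd q (Fin 1)).symm

/-- The maximal operator space structure of a normed space `E`: `‖x‖` is the supremum of
`‖u_m(x)‖` over all linear contractions `u : E → M_k = B(ℓ₂^k)` and all `k`. (Contractions into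
`B(H)` for infinite-dimensional `H` give the same supremum, since the norm of an operator matrix is
the supremum of the norms of its compressions to finite-dimensional subspaces of `H`.) -/
def maximalSpace (E : Type*) [NormedAddCommGroup E] [NormedSpace ℂ E] : OperatorSpace E :=
  have hbdd : ∀ m x, BddAbove (Set.range fun i : (k : ℕ) ×
      {u : E →ₗ[ℂ] Matrix (Fin k) (Fin k) ℂ // ∀ e, ‖u e‖ ≤ ‖e‖} =>
        ((matrixSpace (Fin i.1) (Fin i.1)).toMatrixSeminorm.pullback i.2.1).norm m x) := by
    intro m x
    refine ⟨∑ i, ∑ j, ‖x i j‖, ?_⟩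
    rintro _ ⟨⟨k, u, hu⟩, rfl⟩
    refine (MatrixSeminorm.norm_le_sum _ m _).trans
      (Finset.sum_le_sum fun i _ => Finset.sum_le_sum fun j _ => ?_)
    refine le_trans (le_of_eq ?_) (hu (x i j))
    exact matrixSpace_norm_one _
  { toMatrixSeminorm := MatrixSeminorm.sup _ hbdd
    eq_zero_of_norm := by
      intro m x hx
      ext a b
      change x a b = 0
      by_contra hab
      obtain ⟨f, hf, hfx⟩ := exists_dual_vector ℂ (x a b) (norm_ne_zero_iff.mpr hab)
      let u : E →ₗ[ℂ] Matrix (Fin 1) (Fin 1) ℂ :=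
        { toFun := fun e => Matrix.diagonal fun _ => f e
          map_add' := fun e e' => by ext i j; simp [Subsingleton.elim i j]
          map_smul' := fun c e => by ext i j; simp [Subsingleton.elim i j] }
      have hu : ∀ e, ‖u e‖ ≤ ‖e‖ := by
        intro e
        have h1 : u e = Matrix.diagonal fun _ => f e := rfl
        rw [h1, Matrix.l2_opNorm_diagonal]
        refine (pi_norm_le_iff_of_nonneg (norm_nonneg e)).mpr fun _ => ?_
        simpa [hf] using f.le_opNorm e
      have hle : (matrixSpace (Fin 1) (Fin 1)).norm m (amplify u m x) ≤ 0 :=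
        (le_ciSup (hbdd m x) ⟨1, u, hu⟩).trans hx.le
      have h := (matrixSpace (Fin 1) (Fin 1)).eq_zero_of_norm m _
        (le_antisymm hle (MatrixSeminorm.norm_nonneg _ _ _))
      have h2 : f (x a b) = 0 := by
        simpa [u, amplify] using congrFun (congrFun (congrFun (congrFun h a) b) 0) 0
      rw [hfx] at h2
      simp [hab] at h2 }

/-- The space `ℓ₁^n` with its maximal operator space structure. -/
def maxEllOne (n : ℕ) : OperatorSpace (PiLp 1 fun _ : Fin n => ℂ) :=
  maximalSpace (PiLp 1 fun _ : Fin n => ℂ)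

end Maximal

section RowPlusColumn

/-- The matrix norms of the operator space direct sum `E ⊕₁ F`: `‖(x, y)‖` is the supremum of
`‖u_m(x) + v_m(y)‖` over all pairs of complete contractions `u : E → M_k`, `v : F → M_k` and
all `k` (as for the maximal structure, nothing changes if `B(H)` is allowed instead of `M_k`). -/
def oneSum {E F : Type*} [AddCommGroup E] [Module ℂ E] [AddCommGroup F] [Module ℂ F]
    (S : OperatorSpace E) (T : OperatorSpace F) : MatrixSeminorm (E × F) :=
  MatrixSeminorm.sup
    (fun i : (k : ℕ) ×
        ({u : E →ₗ[ℂ] Matrix (Fin k) (Fin k) ℂ //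
            IsCompleteContraction S (matrixSpace (Fin k) (Fin k)) u} ×
          {v : F →ₗ[ℂ] Matrix (Fin k) (Fin k) ℂ //
            IsCompleteContraction T (matrixSpace (Fin k) (Fin k)) v}) =>
      (matrixSpace (Fin i.1) (Fin i.1)).toMatrixSeminorm.pullback (i.2.1.1.coprod i.2.2.1))
    (by
      intro m x
      refine ⟨S.norm m (amplify (LinearMap.fst ℂ E F) m x) +
        T.norm m (amplify (LinearMap.snd ℂ E F) m x), ?_⟩
      rintro _ ⟨⟨k, ⟨u, hu⟩, ⟨v, hv⟩⟩, rfl⟩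
      have h : amplify (u.coprod v) m x = amplify u m (amplify (LinearMap.fst ℂ E F) m x) +
          amplify v m (amplify (LinearMap.snd ℂ E F) m x) := by
        ext; simp [amplify]
      change (matrixSpace (Fin k) (Fin k)).norm m (amplify (u.coprod v) m x) ≤ _
      rw [h]
      exact (MatrixSeminorm.add_le _ _ _ _).trans (add_le_add (hu _ _) (hv _ _)))

theorem le_oneSum {E F : Type*} [AddCommGroup E] [Module ℂ E] [AddCommGroup F] [Module ℂ F]
    (S : OperatorSpace E) (T : OperatorSpace F) {k : ℕ} (u : E →ₗ[ℂ] Matrix (Fin k) (Fin k) ℂ)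
    (v : F →ₗ[ℂ] Matrix (Fin k) (Fin k) ℂ)
    (hu : IsCompleteContraction S (matrixSpace (Fin k) (Fin k)) u)
    (hv : IsCompleteContraction T (matrixSpace (Fin k) (Fin k)) v) (m : ℕ)
    (x : Matrix (Fin m) (Fin m) (E × F)) :
    (matrixSpace (Fin k) (Fin k)).norm m (amplify (u.coprod v) m x) ≤ (oneSum S T).norm m x :=
  MatrixSeminorm.le_sup (fun i : (k : ℕ) ×
        ({u : E →ₗ[ℂ] Matrix (Fin k) (Fin k) ℂ //
            IsCompleteContraction S (matrixSpace (Fin k) (Fin k)) u} ×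
          {v : F →ₗ[ℂ] Matrix (Fin k) (Fin k) ℂ //
            IsCompleteContraction T (matrixSpace (Fin k) (Fin k)) v}) =>
      (matrixSpace (Fin i.1) (Fin i.1)).toMatrixSeminorm.pullback (i.2.1.1.coprod i.2.2.1))
    _ ⟨k, ⟨u, hu⟩, ⟨v, hv⟩⟩ m x

/-- The row space `R_n`, where `∑ a_j e_j` is the `1 × n` matrix with entries `a_j`. -/
def rowSpace (n : ℕ) : OperatorSpace (Fin n → ℂ) :=
  (matrixSpace Unit (Fin n)).pullback
    { toFun := fun a => Matrix.replicateRow Unit a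
      map_add' := fun _ _ => rfl
      map_smul' := fun _ _ => rfl } (Matrix.replicateRow_injective)

/-- The column space `C_n`, where `∑ a_j e_j` is the `n × 1` matrix with entries `a_j`. -/
def columnSpace (n : ℕ) : OperatorSpace (Fin n → ℂ) :=
  (matrixSpace (Fin n) Unit).pullback
    { toFun := fun a => Matrix.replicateCol Unit a
      map_add' := fun _ _ => rfl
      map_smul' := fun _ _ => rfl } (Matrix.replicateCol_injective)

/-- The coordinate map `a ↦ a_j`, with values in `M_1`. -/
def coordMap (n : ℕ) (j : Fin n) : (Fin n → ℂ) →ₗ[ℂ] Matrix (Fin 1) (Fin 1) ℂ where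
  toFun a := Matrix.of fun _ _ => a j
  map_add' _ _ := rfl
  map_smul' _ _ := rfl

theorem coordMap_apply (n : ℕ) (j : Fin n) (a : Fin n → ℂ) (i i' : Fin 1) :
    coordMap n j a i i' = a j := rfl

theorem coordMap_rowSpace (n : ℕ) (j : Fin n) :
    IsCompleteContraction (rowSpace n) (matrixSpace (Fin 1) (Fin 1)) (coordMap n j) := by
  intro m x
  refine opNorm_le_of_sq (norm_nonneg _) fun v => ?_
  have h := sum_norm_mulVec_sq_le (Matrix.comp (Fin m) (Fin m) Unit (Fin n) ℂ
    (x.map fun a => Matrix.replicateRow Unit a)) (fun c => if c.2 = j then v (c.1, 0) else 0)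
  simp only [Fintype.sum_prod_type, Finset.univ_unique, Finset.sum_singleton] at h ⊢
  refine le_trans (le_of_eq ?_) (h.trans (le_of_eq ?_))
  · simp [Matrix.mulVec, dotProduct, Fintype.sum_prod_type, coordMap_apply, amplify]
  · congr 1
    refine Finset.sum_congr rfl fun a _ => ?_
    rw [Finset.sum_eq_single j (by intro b _ hb; simp [hb]) (by simp)]
    simp

theorem coordMap_columnSpace (n : ℕ) (j : Fin n) :
    IsCompleteContraction (columnSpace n) (matrixSpace (Fin 1) (Fin 1)) (coordMap n j) := by
  intro m x
  refine opNorm_le_of_sq (norm_nonneg _) fun v => ?_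
  have h := sum_norm_mulVec_sq_le (Matrix.comp (Fin m) (Fin m) (Fin n) Unit ℂ
    (x.map fun a => Matrix.replicateCol Unit a)) (fun c => v (c.1, 0))
  simp only [Fintype.sum_prod_type, Finset.univ_unique, Finset.sum_singleton] at h ⊢
  refine le_trans (Finset.sum_le_sum fun a _ => ?_) h
  refine le_trans (le_of_eq ?_) (Finset.single_le_sum (fun _ _ => sq_nonneg _)
    (Finset.mem_univ j))
  simp [Matrix.mulVec, dotProduct, Fintype.sum_prod_type, coordMap_apply, amplify]

/-- The operator space `R_n + C_n`: the quotient of `R_n ⊕₁ C_n` by the map `(a, b) ↦ a + b`. -/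
def rowPlusColumn (n : ℕ) : OperatorSpace (Fin n → ℂ) where
  toMatrixSeminorm := (oneSum (rowSpace n) (columnSpace n)).quotient
    (LinearMap.id.coprod LinearMap.id) (fun a => ⟨(a, 0), by simp⟩)
  eq_zero_of_norm m x hx := by
    have key : ∀ j, (matrixSpace (Fin 1) (Fin 1)).norm m (amplify (coordMap n j) m x) ≤ 0 := by
      intro j
      refine le_trans ?_ hx.le
      have hne : Nonempty {z : Matrix (Fin m) (Fin m) ((Fin n → ℂ) × (Fin n → ℂ)) //
          amplify (LinearMap.id.coprod LinearMap.id) m z = x} :=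
        ⟨x.map fun a => (a, 0), by ext; simp [amplify]⟩
      refine le_ciInf fun z => ?_
      have hz : amplify (coordMap n j) m x =
          amplify ((coordMap n j).coprod (coordMap n j)) m z.1 := by
        conv_lhs => rw [← z.2]
        ext; simp [amplify]
      rw [hz]
      exact le_oneSum (rowSpace n) (columnSpace n) _ _ (coordMap_rowSpace n j)
        (coordMap_columnSpace n j) m z.1
    ext a b j
    have h := (matrixSpace (Fin 1) (Fin 1)).eq_zero_of_norm m _
      (le_antisymm (key j) (MatrixSeminorm.norm_nonneg _ _ _))
    exact congrFun (congrFun (congrFun (congrFun h a) b) 0) 0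

end RowPlusColumn

section OperatorHilbert

/-- The matrix `∑_j x_j ⊗ conj(y_j)`. -/
def tensorConj {n : ℕ} {p q : Type*} (x : Fin n → Matrix p p ℂ) (y : Fin n → Matrix q q ℂ) :
    Matrix (p × q) (p × q) ℂ :=
  ∑ j, x j ⊗ₖ (y j).map (starRingEnd ℂ)

theorem norm_sum_mul_conj_le {ι : Type*} [Fintype ι] (a b : ι → ℂ) :
    ‖∑ i, a i * starRingEnd ℂ (b i)‖ ≤ √(∑ i, ‖a i‖ ^ 2) * √(∑ i, ‖b i‖ ^ 2) := by
  have h := norm_inner_le_norm (𝕜 := ℂ) (WithLp.toLp 2 b) (WithLp.toLp 2 a)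
  rw [EuclideanSpace.norm_eq, EuclideanSpace.norm_eq, mul_comm] at h
  simpa [PiLp.inner_apply] using h

section CauchySchwarz

open scoped ComplexOrder

variable {p q r : Type*} [Fintype p] [Fintype q] [Fintype r]

theorem trace_mul_conjTranspose (A B : Matrix p q ℂ) :
    (A * B.conjTranspose).trace = ∑ c : p × q, A c.1 c.2 * starRingEnd ℂ (B c.1 c.2) := by
  simp [Matrix.trace, Matrix.mul_apply, Fintype.sum_prod_type]

theorem trace_mul_conjTranspose_self (A : Matrix p q ℂ) :
    (A * A.conjTranspose).trace = ((∑ c : p × q, ‖A c.1 c.2‖ ^ 2 : ℝ) : ℂ) := by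
  rw [trace_mul_conjTranspose]
  push_cast
  exact Finset.sum_congr rfl fun c _ => Complex.mul_conj' _

theorem sum_norm_sq_of_diagonal [DecidableEq q] (A : Matrix p q ℂ) (t : q → ℝ)
    (hA : A.conjTranspose * A = Matrix.diagonal (fun i => ((t i ^ 2 : ℝ) : ℂ))) :
    (∑ c : p × p, ‖(A * A.conjTranspose) c.1 c.2‖ ^ 2) = ∑ i, t i ^ 4 := by
  have h1 := trace_mul_conjTranspose_self (A * A.conjTranspose)
  have h2 : (A * A.conjTranspose) * (A * A.conjTranspose).conjTranspose =
      A * ((A.conjTranspose * A) * A.conjTranspose) := by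
    simp [Matrix.mul_assoc]
  rw [h2, Matrix.trace_mul_comm, Matrix.mul_assoc, hA, Matrix.diagonal_mul_diagonal,
    Matrix.trace_diagonal] at h1
  have h3 : ∀ i, ((t i ^ 2 : ℝ) : ℂ) * ((t i ^ 2 : ℝ) : ℂ) = ((t i ^ 4 : ℝ) : ℂ) := by
    intro i
    push_cast
    ring
  simp only [h3] at h1
  exact_mod_cast h1.symm

theorem exists_factorization [DecidableEq q] (ξ : Matrix p q ℂ) :
    ∃ (P : Matrix p q ℂ) (Q : Matrix q q ℂ), ξ = P * Q.conjTranspose ∧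
      (∑ c : p × p, ‖(P * P.conjTranspose) c.1 c.2‖ ^ 2) = ∑ c : p × q, ‖ξ c.1 c.2‖ ^ 2 ∧
      (∑ c : q × q, ‖(Q * Q.conjTranspose) c.1 c.2‖ ^ 2) = ∑ c : p × q, ‖ξ c.1 c.2‖ ^ 2 := by
  have hH := Matrix.isHermitian_conjTranspose_mul_self ξ
  have hpos : ∀ i, 0 ≤ hH.eigenvalues i :=
    (Matrix.posSemidef_conjTranspose_mul_self ξ).eigenvalues_nonneg
  set d := hH.eigenvalues with hd
  set V : Matrix q q ℂ := hH.eigenvectorUnitary.1 with hV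
  have hVV : V.conjTranspose * V = 1 := Unitary.coe_star_mul_self hH.eigenvectorUnitary
  have hVV' : V * V.conjTranspose = 1 := Unitary.coe_mul_star_self hH.eigenvectorUnitary
  have hspec : ξ.conjTranspose * ξ = V * Matrix.diagonal (fun i => (d i : ℂ)) * V.conjTranspose := by
    have := hH.spectral_theorem
    rw [Unitary.conjStarAlgAut_apply] at this
    exact this
  have hW : (ξ * V).conjTranspose * (ξ * V) = Matrix.diagonal (fun i => (d i : ℂ)) := by
    calc _ = V.conjTranspose * (ξ.conjTranspose * ξ) * V := by
            simp only [Matrix.conjTranspose_mul, Matrix.mul_assoc]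
      _ = (V.conjTranspose * V) * Matrix.diagonal (fun i => (d i : ℂ)) *
            (V.conjTranspose * V) := by
            rw [hspec]; simp only [Matrix.mul_assoc]
      _ = _ := by rw [hVV]; simp
  set t : q → ℝ := fun i => √(√(d i)) with ht
  have ht4 : ∀ i, t i ^ 4 = d i := by
    intro i
    have h1 : t i ^ 2 = √(d i) := Real.sq_sqrt (Real.sqrt_nonneg _)
    calc t i ^ 4 = (t i ^ 2) ^ 2 := by ring
      _ = d i := by rw [h1, Real.sq_sqrt (hpos i)]
  have hzero : ∀ i, t i = 0 → ∀ a, (ξ * V) a i = 0 := by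
    intro i hi a
    have h := congrFun (congrFun hW i) i
    have hdi : d i = 0 := by rw [← ht4, hi]; simp
    rw [Matrix.diagonal_apply_eq, hdi, Matrix.mul_apply] at h
    have h2 : ∑ b, ‖(ξ * V) b i‖ ^ 2 = 0 := by
      have h3 : ((∑ b, ‖(ξ * V) b i‖ ^ 2 : ℝ) : ℂ) = 0 := by
        rw [Complex.ofReal_zero] at h
        rw [← h]
        push_cast
        refine Finset.sum_congr rfl fun b _ => ?_
        rw [Matrix.conjTranspose_apply, mul_comm]
        exact (Complex.mul_conj' _).symm
      exact_mod_cast h3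
    have h4 := (Finset.sum_eq_zero_iff_of_nonneg (fun b _ => sq_nonneg _)).mp h2 a
      (Finset.mem_univ a)
    simpa using h4
  set Q : Matrix q q ℂ := V * Matrix.diagonal (fun i => (t i : ℂ)) with hQ
  set P : Matrix p q ℂ := ξ * V * Matrix.diagonal (fun i => ((t i)⁻¹ : ℂ)) with hP
  have hdiag : ∀ f : q → ℝ, (Matrix.diagonal (fun i => (f i : ℂ))).conjTranspose =
      Matrix.diagonal (fun i => (f i : ℂ)) := by
    intro f
    rw [Matrix.diagonal_conjTranspose]
    congr 1
    ext i
    simp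
  have hPP : P.conjTranspose * P = Matrix.diagonal (fun i => ((t i ^ 2 : ℝ) : ℂ)) := by
    have h1 : (Matrix.diagonal (fun i => ((t i)⁻¹ : ℂ))).conjTranspose =
        Matrix.diagonal (fun i => ((t i)⁻¹ : ℂ)) := by
      simp
    calc _ = Matrix.diagonal (fun i => ((t i)⁻¹ : ℂ)) * ((ξ * V).conjTranspose * (ξ * V)) *
            Matrix.diagonal (fun i => ((t i)⁻¹ : ℂ)) := by
            rw [hP, Matrix.conjTranspose_mul, h1]; simp only [Matrix.mul_assoc]
      _ = _ := by
        rw [hW, Matrix.diagonal_mul_diagonal, Matrix.diagonal_mul_diagonal]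
        congr 1
        ext i
        rw [← ht4]
        by_cases h0 : t i = 0
        · simp [h0]
        · have : (t i : ℂ) ≠ 0 := by exact_mod_cast h0
          push_cast
          field_simp
  have hQQ : Q.conjTranspose * Q = Matrix.diagonal (fun i => ((t i ^ 2 : ℝ) : ℂ)) := by
    calc _ = Matrix.diagonal (fun i => (t i : ℂ)) * (V.conjTranspose * V) *
            Matrix.diagonal (fun i => (t i : ℂ)) := by
            rw [hQ, Matrix.conjTranspose_mul, hdiag]; simp only [Matrix.mul_assoc]
      _ = _ := by
        rw [hVV, Matrix.mul_one, Matrix.diagonal_mul_diagonal]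
        congr 1
        ext i
        push_cast
        ring
  have hsum : ∑ c : p × q, ‖ξ c.1 c.2‖ ^ 2 = ∑ i, d i := by
    have h1 := trace_mul_conjTranspose_self ξ
    rw [Matrix.trace_mul_comm, hspec, Matrix.trace_mul_comm, ← Matrix.mul_assoc, hVV,
      Matrix.one_mul, Matrix.trace_diagonal] at h1
    exact_mod_cast h1.symm
  refine ⟨P, Q, ?_, ?_, ?_⟩
  rotate_left
  · rw [sum_norm_sq_of_diagonal P t hPP, hsum]
    exact Finset.sum_congr rfl fun i _ => ht4 i
  · rw [sum_norm_sq_of_diagonal Q t hQQ, hsum]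
    exact Finset.sum_congr rfl fun i _ => ht4 i
  have h1 : ξ * V * Matrix.diagonal (fun i => ((t i)⁻¹ : ℂ) * (t i : ℂ)) = ξ * V := by
    ext a i
    rw [Matrix.mul_diagonal]
    by_cases h0 : t i = 0
    · rw [hzero i h0 a]; simp
    · have : (t i : ℂ) ≠ 0 := by exact_mod_cast h0
      rw [inv_mul_cancel₀ this, mul_one]
  calc ξ = ξ * V * V.conjTranspose := by rw [Matrix.mul_assoc, hVV', Matrix.mul_one]
    _ = _ := by
      rw [hP, hQ, Matrix.conjTranspose_mul, hdiag]
      conv_lhs => rw [← h1, ← Matrix.diagonal_mul_diagonal]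
      simp only [Matrix.mul_assoc]

theorem tensorConj_mulVec {n : ℕ} (x : Fin n → Matrix p p ℂ) (y : Fin n → Matrix q q ℂ)
    (ξ : Matrix p q ℂ) (c : p × q) :
    ((tensorConj x y).mulVec fun c => ξ c.1 c.2) c =
      (∑ j, x j * ξ * (y j).conjTranspose) c.1 c.2 := by
  simp only [tensorConj, Matrix.sum_mulVec, Finset.sum_apply, Matrix.sum_apply]
  refine Finset.sum_congr rfl fun j _ => ?_
  simp only [Matrix.mulVec, dotProduct, Fintype.sum_prod_type, Matrix.kroneckerMap_apply,
    Matrix.map_apply, Matrix.mul_apply, Finset.sum_mul, Matrix.conjTranspose_apply]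
  rw [Finset.sum_comm]
  refine Finset.sum_congr rfl fun a _ => Finset.sum_congr rfl fun b _ => ?_
  simp only [starRingEnd_apply]
  ring

variable [DecidableEq p] [DecidableEq q] {n : ℕ}

theorem trace_sum_le (x : Fin n → Matrix p p ℂ) (P : Matrix p r ℂ) (R : Matrix p r ℂ) :
    ∑ j, ∑ c : r × r, ‖(R.conjTranspose * x j * P) c.1 c.2‖ ^ 2 ≤
      ‖tensorConj x x‖ * √(∑ c : p × p, ‖(P * P.conjTranspose) c.1 c.2‖ ^ 2) *
        √(∑ c : p × p, ‖(R * R.conjTranspose) c.1 c.2‖ ^ 2) := by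
  have h1 : ((∑ j, ∑ c : r × r, ‖(R.conjTranspose * x j * P) c.1 c.2‖ ^ 2 : ℝ) : ℂ) =
      ∑ c : p × p, ((tensorConj x x).mulVec fun c => (P * P.conjTranspose) c.1 c.2) c *
        starRingEnd ℂ ((R * R.conjTranspose) c.1 c.2) := by
    simp only [tensorConj_mulVec]
    rw [← trace_mul_conjTranspose, Matrix.sum_mul, Matrix.trace_sum, Complex.ofReal_sum]
    refine Finset.sum_congr rfl fun j _ => ?_
    rw [← trace_mul_conjTranspose_self]
    have h2 : R.conjTranspose * x j * P * (R.conjTranspose * x j * P).conjTranspose =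
        R.conjTranspose * (x j * P * P.conjTranspose * (x j).conjTranspose * R) := by
      simp [Matrix.mul_assoc]
    rw [h2, Matrix.trace_mul_comm]
    congr 1
    simp [Matrix.mul_assoc]
  have h0 : 0 ≤ ∑ j, ∑ c : r × r, ‖(R.conjTranspose * x j * P) c.1 c.2‖ ^ 2 :=
    Finset.sum_nonneg fun j _ => Finset.sum_nonneg fun c _ => sq_nonneg _
  have h3 := congrArg norm h1
  rw [Complex.norm_real, Real.norm_of_nonneg h0] at h3
  rw [h3]
  refine (norm_sum_mul_conj_le _ _).trans ?_
  gcongr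
  rw [← Real.sqrt_sq (norm_nonneg (tensorConj x x)), ← Real.sqrt_mul (sq_nonneg _)]
  exact Real.sqrt_le_sqrt (sum_norm_mulVec_sq_le _ _)

/-- Haagerup's Cauchy-Schwarz inequality. -/
theorem norm_tensorConj_le (x : Fin n → Matrix p p ℂ) (y : Fin n → Matrix q q ℂ) :
    ‖tensorConj x y‖ ≤ √‖tensorConj x x‖ * √‖tensorConj y y‖ := by
  have key : ∀ ξ η : Matrix p q ℂ,
      ‖∑ c : p × q, (∑ j, x j * ξ * (y j).conjTranspose) c.1 c.2 * starRingEnd ℂ (η c.1 c.2)‖ ≤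
      √‖tensorConj x x‖ * √‖tensorConj y y‖ * √(∑ c : p × q, ‖ξ c.1 c.2‖ ^ 2) *
        √(∑ c : p × q, ‖η c.1 c.2‖ ^ 2) := by
    intro ξ η
    obtain ⟨P, Q, hξ, hP, hQ⟩ := exists_factorization ξ
    obtain ⟨R, Z, hη, hR, hZ⟩ := exists_factorization η
    have h1 := trace_sum_le x P R
    have h2 := trace_sum_le y Q Z
    rw [hP, hR] at h1
    rw [hQ, hZ] at h2
    set s := √(∑ c : p × q, ‖ξ c.1 c.2‖ ^ 2) with hs
    set t := √(∑ c : p × q, ‖η c.1 c.2‖ ^ 2) with ht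
    have h3 : ∑ c : p × q, (∑ j, x j * ξ * (y j).conjTranspose) c.1 c.2 *
        starRingEnd ℂ (η c.1 c.2) =
        ∑ i : Fin n × (q × q), (R.conjTranspose * x i.1 * P) i.2.1 i.2.2 *
          starRingEnd ℂ ((Z.conjTranspose * y i.1 * Q) i.2.1 i.2.2) := by
      rw [← trace_mul_conjTranspose, Matrix.sum_mul, Matrix.trace_sum, Fintype.sum_prod_type]
      refine Finset.sum_congr rfl fun j _ => ?_
      refine Eq.trans ?_ (trace_mul_conjTranspose (R.conjTranspose * x j * P)
        (Z.conjTranspose * y j * Q))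
      have h4 : x j * ξ * (y j).conjTranspose * η.conjTranspose =
          (x j * P * Q.conjTranspose * (y j).conjTranspose * Z) * R.conjTranspose := by
        rw [hξ, hη]; simp [Matrix.mul_assoc]
      rw [h4, Matrix.trace_mul_comm]
      congr 1
      simp [Matrix.mul_assoc]
    rw [h3]
    refine (norm_sum_mul_conj_le _ _).trans ?_
    rw [Fintype.sum_prod_type, Fintype.sum_prod_type]
    have hst : 0 ≤ s * t := by positivity
    calc _ ≤ √(‖tensorConj x x‖ * s * t) * √(‖tensorConj y y‖ * s * t) :=
          mul_le_mul (Real.sqrt_le_sqrt h1) (Real.sqrt_le_sqrt h2) (Real.sqrt_nonneg _)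
            (Real.sqrt_nonneg _)
      _ = _ := by
        rw [mul_assoc, mul_assoc, Real.sqrt_mul (norm_nonneg _), Real.sqrt_mul (norm_nonneg _),
          mul_mul_mul_comm, Real.mul_self_sqrt hst]
        ring
  refine opNorm_le_of_sq (by positivity) fun v => ?_
  set w : p × q → ℂ := (tensorConj x y).mulVec v with hw
  set ξ : Matrix p q ℂ := Matrix.of fun a b => v (a, b) with hξ
  set η : Matrix p q ℂ := Matrix.of fun a b => w (a, b) with hη
  have hwξ : ∀ c, (∑ j, x j * ξ * (y j).conjTranspose) c.1 c.2 = w c := by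
    intro c
    rw [← tensorConj_mulVec]
    rfl
  have h := key ξ η
  simp only [hwξ] at h
  have h1 : ∑ c : p × q, w c * starRingEnd ℂ (η c.1 c.2) = ((∑ c, ‖w c‖ ^ 2 : ℝ) : ℂ) := by
    push_cast
    exact Finset.sum_congr rfl fun c _ => Complex.mul_conj' _
  have hw0 : 0 ≤ ∑ c, ‖w c‖ ^ 2 := Finset.sum_nonneg fun c _ => sq_nonneg _
  have hv0 : 0 ≤ ∑ c, ‖v c‖ ^ 2 := Finset.sum_nonneg fun c _ => sq_nonneg _
  rw [h1, Complex.norm_real, Real.norm_of_nonneg hw0] at h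
  change ∑ c, ‖w c‖ ^ 2 ≤ _ * √(∑ c, ‖v c‖ ^ 2) * √(∑ c, ‖w c‖ ^ 2) at h
  rw [← Real.sq_sqrt hw0, ← Real.sq_sqrt hv0, ← mul_pow]
  set a := √(∑ c, ‖w c‖ ^ 2) with ha
  rw [← Real.sq_sqrt hw0, ← ha] at h
  have ha0 : 0 ≤ a := Real.sqrt_nonneg _
  refine pow_le_pow_left₀ ha0 ?_ 2
  rcases ha0.eq_or_lt with h0 | h0
  · rw [← h0]; positivity
  · rw [sq] at h
    exact le_of_mul_le_mul_right h h0

end CauchySchwarz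

/-- The coefficients `x_j ∈ M_m` of `x = ∑ x_j ⊗ e_j ∈ M_m(ℂ^n)`. -/
def coeff {n m : ℕ} (x : Matrix (Fin m) (Fin m) (EuclideanSpace ℂ (Fin n))) :
    Fin n → Matrix (Fin m) (Fin m) ℂ :=
  fun j => x.map fun a => a j

/-- The linear map `ℓ₂^n → M_k` that sends `e_j` to `conj(y_j)`. -/
def conjMap {n k : ℕ} (y : Fin n → Matrix (Fin k) (Fin k) ℂ) :
    EuclideanSpace ℂ (Fin n) →ₗ[ℂ] Matrix (Fin k) (Fin k) ℂ where
  toFun a := ∑ j, a j • (y j).map (starRingEnd ℂ)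
  map_add' a b := by simp [add_smul, Finset.sum_add_distrib]
  map_smul' c a := by simp [mul_smul, Finset.smul_sum]

theorem matrixSpace_conjMap {n k m : ℕ} (y : Fin n → Matrix (Fin k) (Fin k) ℂ)
    (x : Matrix (Fin m) (Fin m) (EuclideanSpace ℂ (Fin n))) :
    (matrixSpace (Fin k) (Fin k)).norm m (amplify (conjMap y) m x) =
      ‖tensorConj (coeff x) y‖ := by
  change ‖Matrix.comp (Fin m) (Fin m) (Fin k) (Fin k) ℂ (amplify (conjMap y) m x)‖ = _
  congr 1
  ext ⟨i, a⟩ ⟨j, b⟩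
  simp [tensorConj, coeff, amplify, conjMap, Matrix.sum_apply]

theorem conjMap_bdd (n m : ℕ) (x : Matrix (Fin m) (Fin m) (EuclideanSpace ℂ (Fin n))) :
    ∀ i : (k : ℕ) × {y : Fin n → Matrix (Fin k) (Fin k) ℂ // ‖tensorConj y y‖ ≤ 1},
      ((matrixSpace (Fin i.1) (Fin i.1)).toMatrixSeminorm.pullback (conjMap i.2.1)).norm m x ≤
        √‖tensorConj (coeff x) (coeff x)‖ := by
  rintro ⟨k, y, hy⟩
  refine (matrixSpace_conjMap y x).trans_le ((norm_tensorConj_le _ _).trans ?_)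
  exact mul_le_of_le_one_right (Real.sqrt_nonneg _) (Real.sqrt_le_one.mpr hy)

/-- The supremum of `‖∑ x_j ⊗ conj(y_j)‖` over all `y` with `‖∑ y_j ⊗ conj(y_j)‖ ≤ 1`. -/
def operatorHilbertAux (n : ℕ) : MatrixSeminorm (EuclideanSpace ℂ (Fin n)) :=
  MatrixSeminorm.sup
    (fun i : (k : ℕ) × {y : Fin n → Matrix (Fin k) (Fin k) ℂ // ‖tensorConj y y‖ ≤ 1} =>
      (matrixSpace (Fin i.1) (Fin i.1)).toMatrixSeminorm.pullback (conjMap i.2.1))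
    (fun m x => ⟨_, by rintro _ ⟨i, rfl⟩; exact conjMap_bdd n m x i⟩)

theorem tensorConj_smul_smul {n : ℕ} {p q : Type*} (c d : ℝ) (x : Fin n → Matrix p p ℂ)
    (y : Fin n → Matrix q q ℂ) :
    tensorConj ((c : ℂ) • x) ((d : ℂ) • y) = ((c * d : ℝ) : ℂ) • tensorConj x y := by
  ext i j
  simp [tensorConj, Matrix.sum_apply, Finset.mul_sum]
  exact Finset.sum_congr rfl fun _ _ => by ring

theorem operatorHilbertAux_norm (n m : ℕ)
    (x : Matrix (Fin m) (Fin m) (EuclideanSpace ℂ (Fin n))) :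
    (operatorHilbertAux n).norm m x = √‖tensorConj (coeff x) (coeff x)‖ := by
  refine le_antisymm (Real.iSup_le (conjMap_bdd n m x) (Real.sqrt_nonneg _)) ?_
  set c := √‖tensorConj (coeff x) (coeff x)‖ with hc
  rcases (Real.sqrt_nonneg ‖tensorConj (coeff x) (coeff x)‖).eq_or_lt with h0 | h0
  · rw [hc, ← h0]; exact MatrixSeminorm.norm_nonneg _ _ _
  · have hcc : ‖tensorConj (coeff x) (coeff x)‖ = c * c := (Real.mul_self_sqrt (norm_nonneg _)).symm
    have hc0 : 0 < c := h0
    have hy : ‖tensorConj (((c⁻¹ : ℝ) : ℂ) • coeff x) (((c⁻¹ : ℝ) : ℂ) • coeff x)‖ ≤ 1 := by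
      rw [tensorConj_smul_smul, norm_smul, hcc, Complex.norm_real,
        Real.norm_of_nonneg (by positivity)]
      field_simp
      rfl
    have h := MatrixSeminorm.le_sup
      (fun i : (k : ℕ) × {y : Fin n → Matrix (Fin k) (Fin k) ℂ // ‖tensorConj y y‖ ≤ 1} =>
        (matrixSpace (Fin i.1) (Fin i.1)).toMatrixSeminorm.pullback (conjMap i.2.1))
      (fun m x => ⟨_, by rintro _ ⟨i, rfl⟩; exact conjMap_bdd n m x i⟩) ⟨m, _, hy⟩ m x
    refine le_trans (le_of_eq ?_) h
    refine Eq.trans ?_ (matrixSpace_conjMap _ x).symm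
    have h2 := tensorConj_smul_smul 1 c⁻¹ (coeff x) (coeff x)
    rw [Complex.ofReal_one, one_smul] at h2
    rw [h2, norm_smul, hcc, Complex.norm_real, Real.norm_of_nonneg (by positivity)]
    field_simp

/-- The `n`-dimensional operator Hilbert space `OH_n`:
`‖∑ x_j ⊗ e_j‖ = ‖∑ x_j ⊗ conj(x_j)‖^{1/2}` for all `x_j ∈ M_m`, where `(e_j)` is the orthonormal
basis of `ℓ₂^n`. -/
def operatorHilbert (n : ℕ) : OperatorSpace (EuclideanSpace ℂ (Fin n)) where
  norm m x := √‖tensorConj (coeff x) (coeff x)‖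
  add_le m x y := by
    simp only [← operatorHilbertAux_norm]; exact (operatorHilbertAux n).add_le m x y
  smul_eq m c x := by
    simp only [← operatorHilbertAux_norm]; exact (operatorHilbertAux n).smul_eq m c x
  blockSum_le m k x y := by
    simp only [← operatorHilbertAux_norm]; exact (operatorHilbertAux n).blockSum_le m k x y
  scalarMul_le k m α x β := by
    simp only [← operatorHilbertAux_norm]; exact (operatorHilbertAux n).scalarMul_le k m α x β
  eq_zero_of_norm m x hx := by
    have h := norm_eq_zero.mp ((Real.sqrt_eq_zero (norm_nonneg _)).mp hx)
    ext a b j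
    have h1 := congrFun (congrFun h (a, a)) (b, b)
    have h2 : ((∑ j, ‖x a b j‖ ^ 2 : ℝ) : ℂ) = 0 := by
      rw [← Matrix.zero_apply (a, a) (b, b), ← h1]
      simp only [tensorConj, coeff, Matrix.sum_apply, Matrix.kroneckerMap_apply, Matrix.map_apply]
      push_cast
      exact Finset.sum_congr rfl fun c _ => (Complex.mul_conj' _).symm
    have h3 : ∑ j, ‖x a b j‖ ^ 2 = 0 := by exact_mod_cast h2
    have h4 := (Finset.sum_eq_zero_iff_of_nonneg (fun b _ => sq_nonneg _)).mp h3 j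
      (Finset.mem_univ j)
    simpa using h4

end OperatorHilbert

end MatricialMultiplicity

end

/-! For each of the three spaces there is a `β` such that `∑ u_j ⊗ e_j` has norm at least `√n β`
in `M_N(E)` for all unitaries `u_j`, while `‖∑ w(e_j) ⊗ conj(w(e_j))‖ ≤ β²` whenever `‖w_N‖ ≤ 1`.
Hence, if `E` embeds well into `k` copies of `M_N`, the `k` coordinates of the embedding give tuples
`z` with `‖∑ z_j ⊗ conj(z_j)‖ ≤ n` such that every tuple `u` of `n` unitaries is nearly normed by
one of them: `‖∑ u_j ⊗ conj(z_j)‖ > (1 - δ) n`. It is enough to find `exp (b n N²)` tuples of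
unitaries no two of which are nearly normed by the same `z`.

Such tuples come from a quantum expander. On the Weyl coefficients of a matrix, conjugation by the
clock matrix, by a quadratic phase and by the Fourier matrix acts, up to phases, as multiplication
by a character, a shear and a rotation of the discrete torus `(ℤ/N)²`. A function vanishing at the
origin is not almost invariant under all three, so a matrix almost commuting with these unitaries is
almost scalar. Random signs and a sub-Gaussian bound give exponentially many tuples of about `n/5`
unitaries that are pairwise far apart in Hilbert–Schmidt norm; each is completed to a tuple `u` of
`n` unitaries by copies of the identity and of the three expander unitaries.

If `z` nearly norms `u`, then near equality in Haagerup's Cauchy–Schwarz inequality shows that two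
positive matrices are nearly intertwined by the `u_j`, so by the spectral gap both are nearly
scalar, and `z` is close to `u` up to multiplication by a unitary on each side. If `z` nearly norms
both `u` and `v`, then `v` is therefore close to `g u h` for unitaries `g` and `h`. On the common
expander part this forces `g` and `h` to be nearly scalar and inverse to each other, so `u` and `v`
are close, which the choice of the tuples excludes. -/

noncomputable section

namespace MatricialMultiplicity

open Matrix
open scoped Matrix.Norms.L2Operator Kronecker

section HilbertSchmidt

variable {p q : Type*} [Fintype p] [Fintype q]

/-- The square of the Hilbert–Schmidt norm. Its square root is not made an instance, since the norm
of a matrix is the operator norm throughout. -/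
def hsSq (A : Matrix p q ℂ) : ℝ := ∑ c : p × q, ‖A c.1 c.2‖ ^ 2

/-- The Hilbert–Schmidt inner product `Tr (A Bᴴ)`, linear in the first variable. -/
def hsInner (A B : Matrix p q ℂ) : ℂ := ∑ c : p × q, A c.1 c.2 * starRingEnd ℂ (B c.1 c.2)

theorem hsSq_eq_sum (A : Matrix p q ℂ) : hsSq A = ∑ i, ∑ j, ‖A i j‖ ^ 2 :=
  Fintype.sum_prod_type _

theorem hsSq_nonneg (A : Matrix p q ℂ) : 0 ≤ hsSq A :=
  Finset.sum_nonneg fun _ _ => sq_nonneg _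

theorem hsInner_eq_trace (A B : Matrix p q ℂ) : hsInner A B = (A * Bᴴ).trace :=
  (trace_mul_conjTranspose A B).symm

theorem hsInner_self (A : Matrix p q ℂ) : hsInner A A = hsSq A := by
  rw [hsInner_eq_trace, trace_mul_conjTranspose_self, hsSq]

theorem ofReal_hsSq_eq_trace (A : Matrix p q ℂ) : (hsSq A : ℂ) = (A * Aᴴ).trace :=
  (trace_mul_conjTranspose_self A).symm

theorem ofReal_hsSq_eq_trace_conjTranspose_mul (A : Matrix p q ℂ) :
    (hsSq A : ℂ) = (Aᴴ * A).trace := by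
  rw [ofReal_hsSq_eq_trace, trace_mul_comm]

theorem hsSq_conjTranspose (A : Matrix p q ℂ) : hsSq Aᴴ = hsSq A := by
  rw [hsSq_eq_sum, hsSq_eq_sum, Finset.sum_comm]
  simp only [conjTranspose_apply, norm_star]

theorem hsSq_sub_comm (A B : Matrix p q ℂ) : hsSq (A - B) = hsSq (B - A) := by
  simp only [hsSq, Matrix.sub_apply, norm_sub_rev]

theorem hsSq_smul (c : ℂ) (A : Matrix p q ℂ) : hsSq (c • A) = ‖c‖ ^ 2 * hsSq A := by
  simp [hsSq, mul_pow, Finset.mul_sum]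

theorem hsSq_one [DecidableEq p] : hsSq (1 : Matrix p p ℂ) = Fintype.card p := by
  rw [hsSq_eq_sum]
  simp [one_apply, apply_ite, ite_pow]

theorem hsSq_diagonal [DecidableEq p] (d : p → ℂ) : hsSq (diagonal d) = ∑ i, ‖d i‖ ^ 2 := by
  rw [hsSq_eq_sum]
  refine Finset.sum_congr rfl fun i _ => ?_
  rw [Finset.sum_eq_single i (by intro j _ hj; simp [diagonal_apply_ne _ hj.symm]) (by simp)]
  simp

theorem hsSq_submatrix_equiv {r s : Type*} [Fintype r] [Fintype s] (e : r ≃ p) (f : s ≃ q)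
    (A : Matrix p q ℂ) : hsSq (A.submatrix e f) = hsSq A :=
  Fintype.sum_equiv (e.prodCongr f) _ _ fun _ => rfl

theorem hsSq_add_le (A B : Matrix p q ℂ) : hsSq (A + B) ≤ 2 * hsSq A + 2 * hsSq B := by
  simp only [hsSq, Finset.mul_sum, ← Finset.sum_add_distrib]
  refine Finset.sum_le_sum fun c _ => ?_
  have h := pow_le_pow_left₀ (norm_nonneg _) (norm_add_le (A c.1 c.2) (B c.1 c.2)) 2
  rw [Matrix.add_apply]
  linarith [add_sq_le (a := ‖A c.1 c.2‖) (b := ‖B c.1 c.2‖)]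

theorem hsSq_sub_le (A B C : Matrix p q ℂ) :
    hsSq (A - C) ≤ 2 * hsSq (A - B) + 2 * hsSq (B - C) := by
  simpa only [sub_add_sub_cancel] using hsSq_add_le (A - B) (B - C)

theorem hsSq_sub (A B : Matrix p q ℂ) :
    hsSq (A - B) = hsSq A + hsSq B - 2 * (hsInner A B).re := by
  simp only [hsSq, hsInner, Complex.re_sum, Finset.mul_sum, ← Finset.sum_add_distrib,
    ← Finset.sum_sub_distrib]
  refine Finset.sum_congr rfl fun c _ => ?_
  simp only [Matrix.sub_apply, ← Complex.normSq_eq_norm_sq, Complex.normSq_sub]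

theorem norm_hsInner_le (A B : Matrix p q ℂ) : ‖hsInner A B‖ ≤ √(hsSq A) * √(hsSq B) :=
  norm_sum_mul_conj_le _ _

theorem norm_sum_hsInner_le {ι : Type*} [Fintype ι] (x y : ι → Matrix p q ℂ) :
    ‖∑ j, hsInner (x j) (y j)‖ ≤ √(∑ j, hsSq (x j)) * √(∑ j, hsSq (y j)) := by
  simp only [hsInner, hsSq, ← Fintype.sum_prod_type']
  exact norm_sum_mul_conj_le _ _

theorem hsInner_sub_left (A B C : Matrix p q ℂ) :
    hsInner (A - B) C = hsInner A C - hsInner B C := by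
  simp [hsInner, sub_mul]

theorem hsInner_sub_right (A B C : Matrix p q ℂ) :
    hsInner A (B - C) = hsInner A B - hsInner A C := by
  simp [hsInner, mul_sub]

theorem hsInner_smul_left (c : ℂ) (A B : Matrix p q ℂ) :
    hsInner (c • A) B = c * hsInner A B := by
  simp [hsInner, Finset.mul_sum, mul_assoc]

theorem hsInner_smul_right (c : ℂ) (A B : Matrix p q ℂ) :
    hsInner A (c • B) = starRingEnd ℂ c * hsInner A B := by
  simp [hsInner, Finset.mul_sum, mul_left_comm]

end HilbertSchmidt

section Unitary

variable {p q : Type*} [Fintype p] [Fintype q] [DecidableEq p] {U : Matrix p p ℂ}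

theorem conjTranspose_mul_self_of_mem_unitaryGroup (hU : U ∈ unitaryGroup p ℂ) : Uᴴ * U = 1 :=
  mem_unitaryGroup_iff'.mp hU

theorem mul_conjTranspose_self_of_mem_unitaryGroup (hU : U ∈ unitaryGroup p ℂ) : U * Uᴴ = 1 :=
  mem_unitaryGroup_iff.mp hU

theorem conjTranspose_mem_unitaryGroup (hU : U ∈ unitaryGroup p ℂ) : Uᴴ ∈ unitaryGroup p ℂ :=
  Unitary.star_mem hU

theorem norm_le_one_of_mem_unitaryGroup (hU : U ∈ unitaryGroup p ℂ) : ‖U‖ ≤ 1 :=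
  (subsingleton_or_nontrivial (Matrix p p ℂ)).elim
    (fun _ => by simp [Subsingleton.elim U 0]) fun _ => (CStarRing.norm_of_mem_unitary hU).le

theorem hsSq_unitary_mul (hU : U ∈ unitaryGroup p ℂ) (A : Matrix p q ℂ) :
    hsSq (U * A) = hsSq A := by
  have h : (hsSq (U * A) : ℂ) = hsSq A := by
    rw [ofReal_hsSq_eq_trace_conjTranspose_mul, ofReal_hsSq_eq_trace_conjTranspose_mul,
      conjTranspose_mul, Matrix.mul_assoc, ← Matrix.mul_assoc _ U,
      conjTranspose_mul_self_of_mem_unitaryGroup hU, Matrix.one_mul]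
  exact_mod_cast h

theorem hsSq_mul_unitary (hU : U ∈ unitaryGroup p ℂ) (A : Matrix q p ℂ) :
    hsSq (A * U) = hsSq A := by
  rw [← hsSq_conjTranspose, conjTranspose_mul,
    hsSq_unitary_mul (conjTranspose_mem_unitaryGroup hU), hsSq_conjTranspose]

theorem hsSq_of_mem_unitaryGroup (hU : U ∈ unitaryGroup p ℂ) : hsSq U = Fintype.card p := by
  rw [← mul_one U, hsSq_unitary_mul hU, hsSq_one]

theorem hsSq_commutator_of_mem_unitaryGroup (hU : U ∈ unitaryGroup p ℂ) (A : Matrix p p ℂ) :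
    hsSq (U * A - A * U) = hsSq (U * A * Uᴴ - A) := by
  rw [← hsSq_mul_unitary hU (U * A * Uᴴ - A), Matrix.sub_mul, Matrix.mul_assoc _ Uᴴ,
    conjTranspose_mul_self_of_mem_unitaryGroup hU, Matrix.mul_one]

end Unitary

section SingularValues

theorem conjTranspose_diagonal_ofReal {p : Type*} [DecidableEq p] (s : p → ℝ) :
    (diagonal fun i => (s i : ℂ))ᴴ = diagonal fun i => (s i : ℂ) := by
  simp [diagonal_conjTranspose, Pi.star_def]

open scoped ComplexOrder in
theorem apply_eq_zero_of_conjTranspose_mul_self_apply {p q : Type*} [Fintype p]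
    {B : Matrix p q ℂ} {i : q}
    (hB : (Bᴴ * B) i i = 0) (a : p) : B a i = 0 :=
  congrFun (dotProduct_star_self_eq_zero.mp hB : (fun a => B a i) = 0) a

variable {p : Type*} [Fintype p] [DecidableEq p]

theorem exists_unitary_mul_diagonal {B : Matrix p p ℂ} {d : p → ℝ}
    (hB : Bᴴ * B = diagonal fun i => ((d i ^ 2 : ℝ) : ℂ)) :
    ∃ U ∈ unitaryGroup p ℂ, B = U * diagonal fun i => (d i : ℂ) := by
  let v : p → EuclideanSpace ℂ p := fun i => WithLp.toLp 2 fun a => (d i : ℂ)⁻¹ * B a i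
  have inner_v (i j) : inner ℂ (v i) (v j) = (d i : ℂ)⁻¹ * (d j : ℂ)⁻¹ * (Bᴴ * B) i j := by
    simp only [v, PiLp.inner_apply, RCLike.inner_apply, mul_apply, Finset.mul_sum,
      conjTranspose_apply, map_mul, map_inv₀, Complex.conj_ofReal, ← starRingEnd_apply]
    exact Finset.sum_congr rfl fun a _ => by ring
  have orthonormal_v : Orthonormal ℂ ({i | d i ≠ 0}.domRestrict v) := by
    rw [orthonormal_iff_ite]
    rintro ⟨i, hi⟩ ⟨j, hj⟩
    simp only [Set.domRestrict_apply, inner_v, hB, Subtype.mk.injEq, diagonal_apply]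
    split_ifs with h
    · subst h
      have : (d i : ℂ) ≠ 0 := by exact_mod_cast hi
      push_cast
      field_simp
    · simp
  obtain ⟨b, hb⟩ := orthonormal_v.exists_orthonormalBasis_extension_of_card_eq (by simp)
  refine ⟨of fun a i => b i a, mem_unitaryGroup_iff'.mpr ?_, ?_⟩
  · ext i j
    rw [one_apply, ← orthonormal_iff_ite.mp b.orthonormal i j]
    simp [PiLp.inner_apply, mul_apply, star_apply, mul_comm]
  · ext a i
    rw [mul_diagonal, of_apply]
    by_cases h : d i = 0
    · rw [h, Complex.ofReal_zero, mul_zero]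
      exact apply_eq_zero_of_conjTranspose_mul_self_apply (by simp [hB, h]) a
    · have hd : (d i : ℂ) ≠ 0 := by exact_mod_cast h
      rw [hb i h]
      simp only [v]
      field_simp

open scoped ComplexOrder in
theorem exists_svd (A : Matrix p p ℂ) :
    ∃ U ∈ unitaryGroup p ℂ, ∃ V ∈ unitaryGroup p ℂ, ∃ s : p → ℝ, 0 ≤ s ∧
      A = U * (diagonal fun i => (s i : ℂ)) * Vᴴ := by
  have hA := isHermitian_conjTranspose_mul_self A
  have eigenvalues_nonneg := (posSemidef_conjTranspose_mul_self A).eigenvalues_nonneg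
  set V : Matrix p p ℂ := hA.eigenvectorUnitary.1
  have hV : V ∈ unitaryGroup p ℂ := hA.eigenvectorUnitary.2
  have diagonalized : (A * V)ᴴ * (A * V) =
      diagonal fun i => ((√(hA.eigenvalues i) ^ 2 : ℝ) : ℂ) := by
    have h : Vᴴ * (Aᴴ * A) * V = diagonal fun i => (hA.eigenvalues i : ℂ) :=
      (Unitary.conjStarAlgAut_star_apply ..).symm.trans
        hA.conjStarAlgAut_star_eigenvectorUnitary
    simp only [Real.sq_sqrt (eigenvalues_nonneg _), ← h, conjTranspose_mul, Matrix.mul_assoc]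
  obtain ⟨U, hU, hUV⟩ := exists_unitary_mul_diagonal diagonalized
  refine ⟨U, hU, V, hV, fun i => √(hA.eigenvalues i), fun i => Real.sqrt_nonneg _, ?_⟩
  rw [← hUV, Matrix.mul_assoc, mul_conjTranspose_self_of_mem_unitaryGroup hV, Matrix.mul_one]

end SingularValues

section AlmostInvariantFunctions

theorem sum_sq_le_sum_map_sq_add {α : Type*} [Fintype α] (φ : α → ℝ) (σ : α ≃ α) {e t : ℝ}
    (ht : 0 < t) (h : ∑ v, (φ (σ v) - φ v) ^ 2 ≤ e) (P : Finset α) :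
    ∑ v ∈ P, φ v ^ 2 ≤
      ∑ v ∈ P.map σ.toEmbedding, φ v ^ 2 + (t * ∑ v, φ v ^ 2 + (1 + t⁻¹) * e) := by
  have pointwise (v : α) : φ v ^ 2 ≤
      φ (σ v) ^ 2 + (t * φ (σ v) ^ 2 + (1 + t⁻¹) * (φ (σ v) - φ v) ^ 2) := by
    have h : φ (σ v) ^ 2 + (t * φ (σ v) ^ 2 + (1 + t⁻¹) * (φ (σ v) - φ v) ^ 2) - φ v ^ 2 =
        t⁻¹ * (t * φ (σ v) + (φ (σ v) - φ v)) ^ 2 := by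
      field_simp
      ring
    have : 0 ≤ t⁻¹ * (t * φ (σ v) + (φ (σ v) - φ v)) ^ 2 := by positivity
    linarith
  calc ∑ v ∈ P, φ v ^ 2
      ≤ ∑ v ∈ P, φ (σ v) ^ 2 +
          ∑ v ∈ P, (t * φ (σ v) ^ 2 + (1 + t⁻¹) * (φ (σ v) - φ v) ^ 2) := by
        rw [← Finset.sum_add_distrib]
        exact Finset.sum_le_sum fun v _ => pointwise v
    _ ≤ ∑ v ∈ P, φ (σ v) ^ 2 + ∑ v, (t * φ (σ v) ^ 2 + (1 + t⁻¹) * (φ (σ v) - φ v) ^ 2) := by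
        refine add_le_add_right (Finset.sum_le_univ_sum_of_nonneg fun v => ?_) _
        positivity
    _ ≤ ∑ v ∈ P.map σ.toEmbedding, φ v ^ 2 + (t * ∑ v, φ v ^ 2 + (1 + t⁻¹) * e) := by
        rw [Finset.sum_map, Finset.sum_add_distrib, ← Finset.mul_sum, ← Finset.mul_sum,
          σ.sum_comp fun v => φ v ^ 2]
        simp only [Equiv.coe_toEmbedding]
        gcongr

theorem four_mul_abs_valMinAbs_div_le {N : ℕ} [NeZero N] (a : ZMod N) :
    4 * |(a.valMinAbs : ℝ)| / N ≤ ‖ZMod.stdAddChar a - 1‖ := by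
  have hN : (0 : ℝ) < N := by exact_mod_cast Nat.pos_of_neZero N
  have exp_eq : (ZMod.stdAddChar a : ℂ) =
      Complex.exp (Complex.I * ((2 * (Real.pi * a.valMinAbs / N) : ℝ) : ℂ)) := by
    conv_lhs => rw [← ZMod.coe_valMinAbs a, ZMod.stdAddChar_coe]
    push_cast
    ring_nf
  set j := a.valMinAbs
  have half_angle_le : |Real.pi * j / N| ≤ Real.pi / 2 := by
    have : (j.natAbs : ℝ) ≤ N / 2 := by
      rw [le_div_iff₀ two_pos]
      exact_mod_cast Nat.le_div_iff_mul_le two_pos |>.mp a.natAbs_valMinAbs_le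
    rw [Nat.cast_natAbs, Int.cast_abs] at this
    rw [abs_div, abs_mul, abs_of_pos Real.pi_pos, abs_of_pos hN, div_le_iff₀ hN]
    nlinarith [Real.pi_pos]
  have jordan := Real.mul_abs_le_abs_sin half_angle_le
  rw [exp_eq, Complex.norm_exp_I_mul_ofReal_sub_one, mul_div_cancel_left₀ _ two_ne_zero,
    Real.norm_eq_abs, abs_mul, abs_two]
  refine le_trans (le_of_eq ?_) (mul_le_mul_of_nonneg_left jordan two_pos.le)
  rw [abs_div, abs_mul, abs_of_pos Real.pi_pos, abs_of_pos hN]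
  field_simp
  ring

variable {N : ℕ}

/-- The action of the quadratic phase `x ↦ 2x²` on the coefficients of the Weyl operators. -/
def shear (N : ℕ) : ZMod N × ZMod N ≃ ZMod N × ZMod N where
  toFun v := (v.1, v.2 - 4 * v.1)
  invFun v := (v.1, v.2 + 4 * v.1)
  left_inv v := by simp
  right_inv v := by simp

/-- The action of the Fourier matrix on the coefficients of the Weyl operators. -/
def rotation (N : ℕ) : ZMod N × ZMod N ≃ ZMod N × ZMod N where
  toFun v := (v.2, -v.1)
  invFun v := (-v.2, v.1)
  left_inv v := by simp
  right_inv v := by simp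

section Sectors

variable [NeZero N]

/-- The part of the discrete torus where the first coordinate is large. Coordinates are measured by
the representative `valMinAbs` of least absolute value; below `N / 10` no wrap-around occurs in
`b ± 4 a`. -/
def largeFst (N : ℕ) [NeZero N] : Finset (ZMod N × ZMod N) := {v | N ≤ 10 * v.1.valMinAbs.natAbs}

/-- The part of the discrete torus where the second coordinate is large. -/
def largeSnd (N : ℕ) [NeZero N] : Finset (ZMod N × ZMod N) := {v | N ≤ 10 * v.2.valMinAbs.natAbs}

/-- The sector `|b| ≤ |a|`, `a ≠ 0` of the central square of the discrete torus. -/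
def flatSector (N : ℕ) [NeZero N] : Finset (ZMod N × ZMod N) :=
  {v | 10 * v.1.valMinAbs.natAbs < N ∧ 10 * v.2.valMinAbs.natAbs < N ∧
    v.2.valMinAbs.natAbs ≤ v.1.valMinAbs.natAbs ∧ v.1.valMinAbs ≠ 0}

/-- The sector `|a| ≤ |b|`, `b ≠ 0` of the central square of the discrete torus. -/
def steepSector (N : ℕ) [NeZero N] : Finset (ZMod N × ZMod N) :=
  {v | 10 * v.1.valMinAbs.natAbs < N ∧ 10 * v.2.valMinAbs.natAbs < N ∧
    v.1.valMinAbs.natAbs ≤ v.2.valMinAbs.natAbs ∧ v.2.valMinAbs ≠ 0}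

theorem valMinAbs_add_four_mul {a b : ZMod N} (ha : 10 * a.valMinAbs.natAbs < N)
    (hb : 10 * b.valMinAbs.natAbs < N) :
    (b + 4 * a).valMinAbs = b.valMinAbs + 4 * a.valMinAbs := by
  rw [ZMod.valMinAbs_spec]
  exact ⟨by simp, by rw [Set.mem_Ioc]; omega⟩

theorem valMinAbs_sub_four_mul {a b : ZMod N} (ha : 10 * a.valMinAbs.natAbs < N)
    (hb : 10 * b.valMinAbs.natAbs < N) :
    (b - 4 * a).valMinAbs = b.valMinAbs - 4 * a.valMinAbs := by
  rw [ZMod.valMinAbs_spec]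
  exact ⟨by simp, by rw [Set.mem_Ioc]; omega⟩

theorem largeSnd_map_rotation_subset :
    (largeSnd N).map (rotation N).toEmbedding ⊆ largeFst N := by
  intro v hv
  obtain ⟨w, hw, rfl⟩ := Finset.mem_map.mp hv
  simpa [largeFst, largeSnd, rotation] using hw

theorem steepSector_map_rotation_subset :
    (steepSector N).map (rotation N).toEmbedding ⊆ flatSector N := by
  intro v hv
  obtain ⟨w, hw, rfl⟩ := Finset.mem_map.mp hv
  simp only [flatSector, steepSector, rotation, Finset.mem_filter, Finset.mem_univ, true_and,
    Equiv.coe_toEmbedding, Equiv.coe_fn_mk, ZMod.natAbs_valMinAbs_neg] at hw ⊢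
  tauto

theorem disjoint_flatSector_map_shear :
    Disjoint ((flatSector N).map (shear N).toEmbedding)
      ((flatSector N).map (shear N).symm.toEmbedding) := by
  rw [Finset.disjoint_left]
  intro v hv hv'
  obtain ⟨w, hw, rfl⟩ := Finset.mem_map.mp hv
  obtain ⟨w', hw', h⟩ := Finset.mem_map.mp hv'
  simp only [flatSector, shear, Finset.mem_filter, Finset.mem_univ, true_and,
    Equiv.coe_toEmbedding, Equiv.coe_fn_mk, Equiv.coe_fn_symm_mk, Prod.mk.injEq] at hw hw' h
  obtain ⟨fst_eq, snd_eq⟩ := h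
  have h := valMinAbs_sub_four_mul hw.1 hw.2.1
  rw [← snd_eq, valMinAbs_add_four_mul hw'.1 hw'.2.1, fst_eq] at h
  rw [fst_eq] at hw'
  omega

theorem flatSector_map_shear_subset :
    (flatSector N).map (shear N).toEmbedding ⊆ steepSector N ∪ (largeFst N ∪ largeSnd N) := by
  intro v hv
  obtain ⟨w, hw, rfl⟩ := Finset.mem_map.mp hv
  simp only [flatSector, steepSector, largeFst, largeSnd, shear, Finset.mem_filter,
    Finset.mem_univ, true_and, Finset.mem_union, Equiv.coe_toEmbedding, Equiv.coe_fn_mk] at hw ⊢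
  rw [valMinAbs_sub_four_mul hw.1 hw.2.1]
  omega

theorem flatSector_map_shear_symm_subset :
    (flatSector N).map (shear N).symm.toEmbedding ⊆
      steepSector N ∪ (largeFst N ∪ largeSnd N) := by
  intro v hv
  obtain ⟨w, hw, rfl⟩ := Finset.mem_map.mp hv
  simp only [flatSector, steepSector, largeFst, largeSnd, shear, Finset.mem_filter,
    Finset.mem_univ, true_and, Finset.mem_union, Equiv.coe_toEmbedding,
    Equiv.coe_fn_symm_mk] at hw ⊢
  rw [valMinAbs_add_four_mul hw.1 hw.2.1]
  omega

theorem eq_zero_of_notMem_sectors {v : ZMod N × ZMod N}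
    (hv : v ∉ flatSector N ∪ (steepSector N ∪ (largeFst N ∪ largeSnd N))) : v = 0 := by
  simp only [flatSector, steepSector, largeFst, largeSnd, Finset.mem_union, Finset.mem_filter,
    Finset.mem_univ, true_and] at hv
  exact Prod.ext ((ZMod.valMinAbs_eq_zero v.1).mp (by omega))
    ((ZMod.valMinAbs_eq_zero v.2).mp (by omega))

theorem sum_largeFst_sq_le (φ : ZMod N × ZMod N → ℝ) :
    ∑ v ∈ largeFst N, φ v ^ 2 ≤ 25 / 4 * ∑ v, ‖ZMod.stdAddChar v.1 - 1‖ ^ 2 * φ v ^ 2 := by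
  have hN : (0 : ℝ) < N := by exact_mod_cast Nat.pos_of_neZero N
  rw [Finset.mul_sum]
  refine (Finset.sum_le_sum fun v hv => ?_).trans
    (Finset.sum_le_univ_sum_of_nonneg fun v => by positivity)
  have large : (N : ℝ) ≤ 10 * |(v.1.valMinAbs : ℝ)| := by
    rw [← Int.cast_abs, ← Nat.cast_natAbs]
    exact_mod_cast (Finset.mem_filter.mp hv).2
  have : 2 / 5 ≤ ‖ZMod.stdAddChar v.1 - 1‖ := by
    refine le_trans ?_ (four_mul_abs_valMinAbs_div_le v.1)
    rw [le_div_iff₀ hN]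
    linarith
  nlinarith [mul_nonneg (sub_nonneg.mpr (pow_le_pow_left₀ (by norm_num) this 2)) (sq_nonneg (φ v))]

theorem sum_union_sq_le {α : Type*} [DecidableEq α] (φ : α → ℝ) (P Q : Finset α) :
    ∑ v ∈ P ∪ Q, φ v ^ 2 ≤ ∑ v ∈ P, φ v ^ 2 + ∑ v ∈ Q, φ v ^ 2 := by
  rw [← Finset.sum_union_inter]
  exact le_add_of_nonneg_right (Finset.sum_nonneg fun v _ => sq_nonneg _)

/- The shear and its inverse send the flat sector to disjoint subsets of its complement, so almost
invariance gives mass at least twice that of the flat sector to the complement; but the rotation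
sends the steep sector into the flat one, and little mass lies where a coordinate is large. -/
theorem sum_sq_le_of_almost_invariant (φ : ZMod N × ZMod N → ℝ) (h0 : φ 0 = 0) {e : ℝ}
    (hmul : ∑ v, ‖ZMod.stdAddChar v.1 - 1‖ ^ 2 * φ v ^ 2 ≤ e)
    (hshear : ∑ v, (φ (shear N v) - φ v) ^ 2 ≤ e)
    (hrot : ∑ v, (φ (rotation N v) - φ v) ^ 2 ≤ e) :
    ∑ v, φ v ^ 2 ≤ 600 * e := by
  set M := ∑ v, φ v ^ 2
  set offFlat := steepSector N ∪ (largeFst N ∪ largeSnd N)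
  have hshear_symm : ∑ v, (φ ((shear N).symm v) - φ v) ^ 2 ≤ e := by
    rw [← (shear N).sum_comp]
    simpa only [Equiv.symm_apply_apply, sub_sq_comm] using hshear
  have mono {P Q : Finset (ZMod N × ZMod N)} (h : P ⊆ Q) : ∑ v ∈ P, φ v ^ 2 ≤ ∑ v ∈ Q, φ v ^ 2 :=
    Finset.sum_le_sum_of_subset_of_nonneg h fun v _ _ => sq_nonneg _
  have transport (σ : ZMod N × ZMod N ≃ ZMod N × ZMod N)
      (hσ : ∑ v, (φ (σ v) - φ v) ^ 2 ≤ e) (P : Finset (ZMod N × ZMod N)) :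
      ∑ v ∈ P, φ v ^ 2 ≤ ∑ v ∈ P.map σ.toEmbedding, φ v ^ 2 + (M / 40 + 41 * e) :=
    (sum_sq_le_sum_map_sq_add φ σ (t := 1 / 40) (by norm_num) hσ P).trans_eq (by ring)
  have large_fst := (sum_largeFst_sq_le φ).trans (mul_le_mul_of_nonneg_left hmul (by norm_num))
  have large_snd := (transport _ hrot (largeSnd N)).trans
    (add_le_add_left (mono largeSnd_map_rotation_subset) _)
  have steep := (transport _ hrot (steepSector N)).trans
    (add_le_add_left (mono steepSector_map_rotation_subset) _)
  have offFlat_le : ∑ v ∈ offFlat, φ v ^ 2 ≤ ∑ v ∈ steepSector N, φ v ^ 2 +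
      (∑ v ∈ largeFst N, φ v ^ 2 + ∑ v ∈ largeSnd N, φ v ^ 2) :=
    (sum_union_sq_le φ _ _).trans (add_le_add_right (sum_union_sq_le φ _ _) _)
  have two_flat_le : 2 * ∑ v ∈ flatSector N, φ v ^ 2 ≤
      ∑ v ∈ offFlat, φ v ^ 2 + 2 * (M / 40 + 41 * e) := by
    have h := mono <|
      Finset.union_subset flatSector_map_shear_subset flatSector_map_shear_symm_subset
    rw [Finset.sum_union disjoint_flatSector_map_shear] at h
    linarith [transport _ hshear (flatSector N), transport _ hshear_symm (flatSector N)]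
  have cover : M ≤ ∑ v ∈ flatSector N, φ v ^ 2 + ∑ v ∈ offFlat, φ v ^ 2 := by
    refine le_trans (le_of_eq ?_) (sum_union_sq_le φ _ _)
    refine (Finset.sum_subset (Finset.subset_univ _) fun v _ hv => ?_).symm
    rw [eq_zero_of_notMem_sectors hv, h0, zero_pow two_ne_zero]
  have : 0 ≤ e := (Finset.sum_nonneg fun v _ => sq_nonneg _).trans hrot
  linarith

end Sectors

end AlmostInvariantFunctions

section WeylCoefficients

variable {N : ℕ} [NeZero N]

theorem conj_stdAddChar (a : ZMod N) :
    starRingEnd ℂ (ZMod.stdAddChar a) = ZMod.stdAddChar (-a) :=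
  (AddChar.map_neg_eq_conj _ _).symm

theorem norm_stdAddChar (a : ZMod N) : ‖(ZMod.stdAddChar a : ℂ)‖ = 1 :=
  AddChar.norm_apply _ _

theorem sum_stdAddChar_mul (b : ZMod N) :
    ∑ x : ZMod N, (ZMod.stdAddChar (x * b) : ℂ) = if b = 0 then (N : ℂ) else 0 := by
  rw [AddChar.sum_mulShift b (ZMod.isPrimitive_stdAddChar N), ZMod.card]
  simp only [Nat.cast_ite, Nat.cast_zero]

theorem inv_ofReal_sqrt_mul_self (N : ℕ) :
    ((√N : ℝ) : ℂ)⁻¹ * ((√N : ℝ) : ℂ)⁻¹ = (N : ℂ)⁻¹ := by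
  rw [← mul_inv, ← Complex.ofReal_mul, Real.mul_self_sqrt (Nat.cast_nonneg N),
    Complex.ofReal_natCast]

/-- The diagonal unitary matrix with phases `g`. -/
def phaseMatrix (g : ZMod N → ZMod N) : Matrix (ZMod N) (ZMod N) ℂ :=
  diagonal fun x => ZMod.stdAddChar (g x)

/-- The unitary matrix of the discrete Fourier transform. -/
def fourierMatrix (N : ℕ) [NeZero N] : Matrix (ZMod N) (ZMod N) ℂ :=
  of fun x y => ((√N : ℝ) : ℂ)⁻¹ * ZMod.stdAddChar (x * y)

/-- The coefficient of `A` at the Weyl operator `e_x ↦ χ(b x) e_(x + a)`, where `v = (a, b)`. -/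
def weylCoeff (A : Matrix (ZMod N) (ZMod N) ℂ) (v : ZMod N × ZMod N) : ℂ :=
  (N : ℂ)⁻¹ * ∑ x, ZMod.stdAddChar (-(v.2 * x)) * A (x + v.1) x

theorem phaseMatrix_mem_unitaryGroup (g : ZMod N → ZMod N) :
    phaseMatrix g ∈ unitaryGroup (ZMod N) ℂ := by
  rw [mem_unitaryGroup_iff', star_eq_conjTranspose, phaseMatrix, diagonal_conjTranspose,
    diagonal_mul_diagonal, ← diagonal_one]
  congr 1
  ext x
  rw [Pi.star_apply, ← starRingEnd_apply, Complex.conj_mul', norm_stdAddChar]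
  norm_num

theorem fourierMatrix_conjTranspose_apply (x y : ZMod N) :
    (fourierMatrix N)ᴴ x y = ((√N : ℝ) : ℂ)⁻¹ * ZMod.stdAddChar (-(y * x)) := by
  rw [conjTranspose_apply, fourierMatrix, of_apply, ← starRingEnd_apply, map_mul, map_inv₀,
    conj_stdAddChar, Complex.conj_ofReal]

theorem fourierMatrix_mem_unitaryGroup : fourierMatrix N ∈ unitaryGroup (ZMod N) ℂ := by
  refine mem_unitaryGroup_iff.mpr ?_
  ext x y
  have entry (t : ZMod N) : fourierMatrix N x t * (fourierMatrix N)ᴴ t y =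
      (N : ℂ)⁻¹ * ZMod.stdAddChar (t * (x - y)) := by
    rw [fourierMatrix_conjTranspose_apply, fourierMatrix, of_apply, mul_mul_mul_comm,
      inv_ofReal_sqrt_mul_self, ← AddChar.map_add_eq_mul]
    ring_nf
  simp only [star_eq_conjTranspose, mul_apply, entry]
  rw [← Finset.mul_sum, sum_stdAddChar_mul, one_apply]
  simp only [sub_eq_zero, mul_ite, mul_zero, inv_mul_cancel₀ (NeZero.ne (N : ℂ))]

theorem weylCoeff_sub (A B : Matrix (ZMod N) (ZMod N) ℂ) (v : ZMod N × ZMod N) :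
    weylCoeff (A - B) v = weylCoeff A v - weylCoeff B v := by
  simp [weylCoeff, mul_sub]

theorem weylCoeff_smul_one_zero (c : ℂ) :
    weylCoeff (c • 1 : Matrix (ZMod N) (ZMod N) ℂ) 0 = c := by
  simp [weylCoeff, inv_mul_cancel_left₀ (NeZero.ne (N : ℂ))]

theorem sum_norm_weylCoeff_sq (A : Matrix (ZMod N) (ZMod N) ℂ) :
    ∑ v, ‖weylCoeff A v‖ ^ 2 = (N : ℝ)⁻¹ * hsSq A := by
  set B : Matrix (ZMod N) (ZMod N) ℂ := of fun x a => A (x + a) x with hB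
  have hsSq_shifted : hsSq B = hsSq A := by
    rw [hsSq_eq_sum, hsSq_eq_sum, Finset.sum_comm (f := fun i j => ‖A i j‖ ^ 2)]
    exact Finset.sum_congr rfl fun x _ => Equiv.sum_comp (Equiv.addLeft x) fun y => ‖A y x‖ ^ 2
  have weylCoeff_eq (a b : ZMod N) :
      weylCoeff A (a, b) = ((√N : ℝ) : ℂ)⁻¹ * ((fourierMatrix N)ᴴ * B) b a := by
    simp only [weylCoeff, mul_apply, fourierMatrix_conjTranspose_apply, hB, of_apply,
      Finset.mul_sum, mul_comm b, ← inv_ofReal_sqrt_mul_self, mul_assoc]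
  calc ∑ v, ‖weylCoeff A v‖ ^ 2
      = ∑ b, ∑ a, (N : ℝ)⁻¹ * ‖((fourierMatrix N)ᴴ * B) b a‖ ^ 2 := by
        rw [Fintype.sum_prod_type_right]
        simp only [weylCoeff_eq, norm_mul, mul_pow, norm_inv, Complex.norm_real, inv_pow,
          Real.norm_of_nonneg (Real.sqrt_nonneg _), Real.sq_sqrt (Nat.cast_nonneg N)]
    _ = (N : ℝ)⁻¹ * hsSq ((fourierMatrix N)ᴴ * B) := by
        simp only [hsSq_eq_sum, Finset.mul_sum]
    _ = (N : ℝ)⁻¹ * hsSq A := by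
        rw [hsSq_unitary_mul (conjTranspose_mem_unitaryGroup fourierMatrix_mem_unitaryGroup),
          hsSq_shifted]

theorem weylCoeff_phase_conj (g : ZMod N → ZMod N) (A : Matrix (ZMod N) (ZMod N) ℂ)
    (v : ZMod N × ZMod N) :
    weylCoeff (phaseMatrix g * A * (phaseMatrix g)ᴴ) v =
      (N : ℂ)⁻¹ * ∑ x, ZMod.stdAddChar (g (x + v.1) - g x - v.2 * x) * A (x + v.1) x := by
  unfold weylCoeff
  congr 1
  refine Finset.sum_congr rfl fun x _ => ?_
  rw [phaseMatrix, diagonal_conjTranspose, mul_diagonal, diagonal_mul, Pi.star_apply,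
    ← starRingEnd_apply, conj_stdAddChar, sub_eq_add_neg, sub_eq_add_neg, AddChar.map_add_eq_mul,
    AddChar.map_add_eq_mul]
  ring

theorem weylCoeff_phase_conj_eq {g : ZMod N → ZMod N} {v w : ZMod N × ZMod N} {a : ZMod N}
    (hfst : w.1 = v.1) (hg : ∀ x, g (x + v.1) - g x - v.2 * x = a + -(w.2 * x))
    (A : Matrix (ZMod N) (ZMod N) ℂ) :
    weylCoeff (phaseMatrix g * A * (phaseMatrix g)ᴴ) v = ZMod.stdAddChar a * weylCoeff A w := by
  rw [weylCoeff_phase_conj, weylCoeff, mul_left_comm]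
  simp only [hg, hfst, AddChar.map_add_eq_mul, mul_assoc, Finset.mul_sum]

theorem weylCoeff_clock_conj (A : Matrix (ZMod N) (ZMod N) ℂ) (v : ZMod N × ZMod N) :
    weylCoeff (phaseMatrix id * A * (phaseMatrix id)ᴴ) v =
      ZMod.stdAddChar v.1 * weylCoeff A v :=
  weylCoeff_phase_conj_eq rfl (fun x => by simp only [id]; ring) A

theorem weylCoeff_quadratic_conj (A : Matrix (ZMod N) (ZMod N) ℂ) (v : ZMod N × ZMod N) :
    weylCoeff (phaseMatrix (2 * · ^ 2) * A * (phaseMatrix (2 * · ^ 2))ᴴ) v =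
      ZMod.stdAddChar (2 * v.1 ^ 2) * weylCoeff A (shear N v) := by
  obtain ⟨a, b⟩ := v
  have phase (x : ZMod N) :
      2 * (x + a) ^ 2 - 2 * x ^ 2 - b * x = 2 * a ^ 2 + -((b - 4 * a) * x) := by ring
  exact weylCoeff_phase_conj_eq (v := (a, b)) (w := (a, b - 4 * a)) rfl phase A

theorem sum_stdAddChar_mul_fourier_conj (A : Matrix (ZMod N) (ZMod N) ℂ) (a b : ZMod N) :
    ∑ x : ZMod N, ZMod.stdAddChar (-(b * x)) *
      (fourierMatrix N * A * (fourierMatrix N)ᴴ) (x + a) x =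
      ∑ t, ZMod.stdAddChar (a * (t + b)) * A (t + b) t := by
  have entry (x : ZMod N) : ZMod.stdAddChar (-(b * x)) *
      (fourierMatrix N * A * (fourierMatrix N)ᴴ) (x + a) x =
      ∑ t, ∑ s, (N : ℂ)⁻¹ * (ZMod.stdAddChar (a * s) * A s t) *
        ZMod.stdAddChar (x * (s - (t + b))) := by
    simp only [mul_apply, fourierMatrix_conjTranspose_apply, Finset.sum_mul, Finset.mul_sum]
    simp only [fourierMatrix, of_apply]
    refine Finset.sum_congr rfl fun t _ => Finset.sum_congr rfl fun s _ => ?_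
    have phases : (ZMod.stdAddChar (a * s) : ℂ) * ZMod.stdAddChar (x * (s - (t + b))) =
        ZMod.stdAddChar (-(b * x)) * ZMod.stdAddChar ((x + a) * s) *
          ZMod.stdAddChar (-(x * t)) := by
      simp only [← AddChar.map_add_eq_mul]
      ring_nf
    rw [← inv_ofReal_sqrt_mul_self]
    linear_combination -(((√N : ℝ) : ℂ)⁻¹ * ((√N : ℝ) : ℂ)⁻¹ * A s t) * phases
  simp only [entry]
  rw [Finset.sum_comm]
  refine Finset.sum_congr rfl fun t _ => ?_
  rw [Finset.sum_comm]
  simp only [← Finset.mul_sum, sum_stdAddChar_mul, sub_eq_zero, mul_ite, mul_zero,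
    Finset.sum_ite_eq', Finset.mem_univ, if_true]
  rw [mul_right_comm, inv_mul_cancel₀ (NeZero.ne (N : ℂ)), one_mul]

theorem weylCoeff_fourier_conj (A : Matrix (ZMod N) (ZMod N) ℂ) (v : ZMod N × ZMod N) :
    weylCoeff (fourierMatrix N * A * (fourierMatrix N)ᴴ) v =
      ZMod.stdAddChar (v.1 * v.2) * weylCoeff A (rotation N v) := by
  rw [weylCoeff, sum_stdAddChar_mul_fourier_conj, weylCoeff, mul_left_comm]
  congr 1
  rw [Finset.mul_sum]
  refine Finset.sum_congr rfl fun x _ => ?_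
  rw [← mul_assoc, ← AddChar.map_add_eq_mul]
  simp only [rotation, Equiv.coe_fn_mk]
  ring_nf

end WeylCoefficients

section QuantumExpander

variable {p κ : Type*} [Fintype p] [DecidableEq p] [Fintype κ]

/-- A tuple of matrices has the spectral gap `γ⁻¹` when commuting with it approximately forces being
approximately scalar. Tuples of unitaries with this property for a `γ` independent of their size
are quantum expanders. -/
def HasSpectralGap (w : κ → Matrix p p ℂ) (γ : ℝ) : Prop :=
  ∀ A : Matrix p p ℂ, ∃ c : ℂ, hsSq (A - c • 1) ≤ γ * ∑ k, hsSq (w k * A - A * w k)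

theorem HasSpectralGap.submatrix_equiv {q : Type*} [Fintype q] [DecidableEq q]
    {w : κ → Matrix p p ℂ} {γ : ℝ} (hw : HasSpectralGap w γ) (e : q ≃ p) :
    HasSpectralGap (fun k => (w k).submatrix e e) γ := by
  intro A
  obtain ⟨c, hc⟩ := hw (A.submatrix e.symm e.symm)
  have pull_back (B C : Matrix p p ℂ) :
      B.submatrix e e - C.submatrix e e = (B - C).submatrix e e := rfl
  have hA : A = (A.submatrix e.symm e.symm).submatrix e e := by simp
  have hone : (c • 1 : Matrix q q ℂ) = (c • 1 : Matrix p p ℂ).submatrix e e := by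
    rw [submatrix_smul, Pi.smul_apply, Pi.smul_apply, submatrix_one_equiv]
  refine ⟨c, ?_⟩
  rw [hA, hone]
  simpa only [submatrix_mul_equiv, pull_back, hsSq_submatrix_equiv] using hc

section Weyl

variable {N : ℕ} [NeZero N]

/-- The clock matrix, a quadratic phase and the Fourier matrix. -/
def expander (N : ℕ) [NeZero N] : Fin 3 → Matrix (ZMod N) (ZMod N) ℂ :=
  ![phaseMatrix id, phaseMatrix (2 * · ^ 2), fourierMatrix N]

theorem expander_mem_unitaryGroup (k : Fin 3) : expander N k ∈ unitaryGroup (ZMod N) ℂ := by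
  fin_cases k
  exacts [phaseMatrix_mem_unitaryGroup _, phaseMatrix_mem_unitaryGroup _,
    fourierMatrix_mem_unitaryGroup]

theorem sum_norm_weylCoeff_conj_sub_sq {U : Matrix (ZMod N) (ZMod N) ℂ}
    (hU : U ∈ unitaryGroup (ZMod N) ℂ) (B : Matrix (ZMod N) (ZMod N) ℂ) :
    ∑ v, ‖weylCoeff (U * B * Uᴴ) v - weylCoeff B v‖ ^ 2 =
      (N : ℝ)⁻¹ * hsSq (U * B - B * U) := by
  simp only [← weylCoeff_sub, sum_norm_weylCoeff_sq, hsSq_commutator_of_mem_unitaryGroup hU]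

theorem sum_norm_weylCoeff_comp_sub_sq_le {U : Matrix (ZMod N) (ZMod N) ℂ}
    (hU : U ∈ unitaryGroup (ZMod N) ℂ) (B : Matrix (ZMod N) (ZMod N) ℂ)
    {σ : ZMod N × ZMod N → ZMod N × ZMod N} {f : ZMod N × ZMod N → ZMod N}
    (hσ : ∀ v, weylCoeff (U * B * Uᴴ) v = ZMod.stdAddChar (f v) * weylCoeff B (σ v)) :
    ∑ v, (‖weylCoeff B (σ v)‖ - ‖weylCoeff B v‖) ^ 2 ≤ (N : ℝ)⁻¹ * hsSq (U * B - B * U) := by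
  rw [← sum_norm_weylCoeff_conj_sub_sq hU]
  refine Finset.sum_le_sum fun v _ => ?_
  rw [← sq_abs, hσ]
  gcongr
  simpa only [norm_mul, norm_stdAddChar, one_mul] using
    abs_norm_sub_norm_le (ZMod.stdAddChar (f v) * weylCoeff B (σ v)) (weylCoeff B v)

theorem hsSq_le_of_weylCoeff_zero_eq_zero {B : Matrix (ZMod N) (ZMod N) ℂ}
    (hB : weylCoeff B 0 = 0) :
    hsSq B ≤ 600 * ∑ k, hsSq (expander N k * B - B * expander N k) := by
  have hN : (0 : ℝ) < (N : ℝ)⁻¹ := inv_pos.mpr (by exact_mod_cast Nat.pos_of_neZero N)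
  have le_sum (k : Fin 3) : (N : ℝ)⁻¹ * hsSq (expander N k * B - B * expander N k) ≤
      (N : ℝ)⁻¹ * ∑ k, hsSq (expander N k * B - B * expander N k) :=
    mul_le_mul_of_nonneg_left (Finset.single_le_sum
      (f := fun k => hsSq (expander N k * B - B * expander N k))
      (fun k _ => hsSq_nonneg _) (Finset.mem_univ k)) hN.le
  have clock : ∑ v, ‖ZMod.stdAddChar v.1 - 1‖ ^ 2 * ‖weylCoeff B v‖ ^ 2 =
      (N : ℝ)⁻¹ * hsSq (expander N 0 * B - B * expander N 0) := by
    rw [← sum_norm_weylCoeff_conj_sub_sq (expander_mem_unitaryGroup 0)]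
    refine Finset.sum_congr rfl fun v _ => ?_
    rw [expander, cons_val_zero, weylCoeff_clock_conj, ← mul_pow, ← norm_mul, sub_mul, one_mul]
  have h := sum_sq_le_of_almost_invariant (fun v => ‖weylCoeff B v‖) (by rw [hB, norm_zero])
    (clock.trans_le (le_sum 0))
    ((sum_norm_weylCoeff_comp_sub_sq_le (expander_mem_unitaryGroup 1) B
      (weylCoeff_quadratic_conj B)).trans (le_sum 1))
    ((sum_norm_weylCoeff_comp_sub_sq_le (expander_mem_unitaryGroup 2) B
      (weylCoeff_fourier_conj B)).trans (le_sum 2))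
  rw [sum_norm_weylCoeff_sq, mul_left_comm] at h
  exact le_of_mul_le_mul_left h hN

theorem hasSpectralGap_expander : HasSpectralGap (expander N) 600 := by
  intro A
  refine ⟨weylCoeff A 0, ?_⟩
  refine (hsSq_le_of_weylCoeff_zero_eq_zero
    (by rw [weylCoeff_sub, weylCoeff_smul_one_zero, sub_self])).trans_eq ?_
  simp only [mul_sub, sub_mul, Matrix.mul_smul, Matrix.smul_mul, Matrix.mul_one, Matrix.one_mul,
    sub_sub_sub_cancel_right]

end Weyl

theorem exists_unitary_hasSpectralGap (p : Type*) [Fintype p] [DecidableEq p] [Nonempty p] :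
    ∃ w : Fin 3 → Matrix p p ℂ, (∀ k, w k ∈ unitaryGroup p ℂ) ∧ HasSpectralGap w 600 := by
  let e : p ≃ ZMod (Fintype.card p) := Fintype.equivOfCardEq (by simp)
  refine ⟨_, fun k => ?_, hasSpectralGap_expander.submatrix_equiv e⟩
  rw [mem_unitaryGroup_iff, star_eq_conjTranspose, conjTranspose_submatrix, submatrix_mul_equiv,
    mul_conjTranspose_self_of_mem_unitaryGroup (expander_mem_unitaryGroup k), submatrix_one_equiv]

end QuantumExpander

section RandomSigns

variable {α : Type*} [Fintype α] [DecidableEq α]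

/-- The sign `±1` encoded by a truth value, so that `α → Bool` is the sample space of independent
uniform signs indexed by `α`. -/
def boolSign (b : Bool) : ℝ := if b then 1 else -1

theorem boolSign_not (b : Bool) : boolSign (!b) = -boolSign b := by
  cases b <;> simp [boolSign]

theorem abs_boolSign (b : Bool) : |boolSign b| = 1 := by
  cases b <;> simp [boolSign]

theorem sum_exp_boolSign_mul_le (a : α → ℝ) :
    ∑ ω : α → Bool, Real.exp (∑ i, boolSign (ω i) * a i) ≤
      Fintype.card (α → Bool) * Real.exp ((∑ i, a i ^ 2) / 2) := by
  have single (x : ℝ) : ∑ b : Bool, Real.exp (boolSign b * x) ≤ 2 * Real.exp (x ^ 2 / 2) := by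
    have h := Real.cosh_le_exp_half_sq x
    rw [Real.cosh_eq] at h
    simp only [boolSign, Fintype.sum_bool, if_true, Bool.false_eq_true, if_false, one_mul,
      neg_one_mul]
    linarith
  calc ∑ ω : α → Bool, Real.exp (∑ i, boolSign (ω i) * a i)
      = ∏ i, ∑ b : Bool, Real.exp (boolSign b * a i) := by
        rw [Finset.prod_univ_sum, Fintype.piFinset_univ]
        exact Finset.sum_congr rfl fun ω _ => Real.exp_sum _ _
    _ ≤ ∏ i, (2 * Real.exp (a i ^ 2 / 2)) :=
        Finset.prod_le_prod (fun _ _ => Finset.sum_nonneg fun _ _ => (Real.exp_pos _).le)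
          fun i _ => single (a i)
    _ = _ := by
        rw [Finset.prod_mul_distrib, ← Real.exp_sum, Finset.sum_div]
        simp

theorem sum_boolSign_mul_eq_zero (i : α) (f : (α → Bool) → ℝ)
    (hf : ∀ ω b, f (Function.update ω i b) = f ω) :
    ∑ ω : α → Bool, boolSign (ω i) * f ω = 0 := by
  have flip_involutive :
      Function.Involutive fun ω : α → Bool => Function.update ω i (!ω i) := fun ω => by simp
  have flipped := Equiv.sum_comp flip_involutive.toPerm fun ω => boolSign (ω i) * f ω
  simp only [Function.Involutive.coe_toPerm, hf, Function.update_self, boolSign_not, neg_mul,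
    Finset.sum_neg_distrib] at flipped
  linarith

theorem card_mul_exp_le_sum_exp {β : Type*} [Fintype β] {x : β → ℝ} {m : ℝ}
    (h : Fintype.card β * m ≤ ∑ i, x i) :
    Fintype.card β * Real.exp m ≤ ∑ i, Real.exp (x i) := by
  have tangent (t : ℝ) : Real.exp m * (1 + (t - m)) ≤ Real.exp t := by
    rw [← sub_add_cancel t m, Real.exp_add, mul_comm, add_comm 1, sub_add_cancel]
    gcongr
    exact Real.add_one_le_exp _
  refine le_trans ?_ (Finset.sum_le_sum fun i _ => tangent (x i))
  rw [← Finset.mul_sum, Finset.sum_add_distrib, Finset.sum_sub_distrib, mul_comm]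
  simp only [Finset.sum_const, Finset.card_univ, nsmul_eq_mul, mul_one]
  gcongr
  linarith

variable {J p : Type*}

/-- The `j`-th of a family of independent random `p × p` matrices with independent uniform signs
as entries. -/
def signMatrix (ω : J × p × p → Bool) (j : J) : Matrix p p ℂ :=
  of fun a b => (boolSign (ω (j, a, b)) : ℂ)

variable [Fintype p]

theorem hsSq_signMatrix (ω : J × p × p → Bool) (j : J) :
    hsSq (signMatrix ω j) = (Fintype.card p : ℝ) ^ 2 := by
  simp [hsSq, signMatrix, Complex.norm_real, Real.norm_eq_abs, abs_boolSign, sq]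

theorem hsSq_signMatrix_mul_conjTranspose (ω : J × p × p → Bool) (j : J) :
    hsSq (signMatrix ω j * (signMatrix ω j)ᴴ) =
      ∑ a, ∑ c, ∑ b, ∑ d, boolSign (ω (j, a, b)) * (boolSign (ω (j, c, b)) *
        boolSign (ω (j, a, d)) * boolSign (ω (j, c, d))) := by
  rw [hsSq_eq_sum]
  refine Finset.sum_congr rfl fun a _ => Finset.sum_congr rfl fun c _ => ?_
  have entry : (signMatrix ω j * (signMatrix ω j)ᴴ) a c =
      ((∑ b, boolSign (ω (j, a, b)) * boolSign (ω (j, c, b)) : ℝ) : ℂ) := by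
    simp [mul_apply, signMatrix]
  rw [entry, Complex.norm_real, Real.norm_eq_abs, sq_abs, sq, Finset.sum_mul_sum]
  exact Finset.sum_congr rfl fun b _ => Finset.sum_congr rfl fun d _ => by ring

variable [Fintype J] [DecidableEq J] [DecidableEq p]

theorem sum_boolSign_rectangle_le (j : J) (a c b d : p) :
    ∑ ω : J × p × p → Bool, boolSign (ω (j, a, b)) *
        (boolSign (ω (j, c, b)) * boolSign (ω (j, a, d)) * boolSign (ω (j, c, d))) ≤
      Fintype.card (J × p × p → Bool) *
        ((if a = c then (1 : ℝ) else 0) + if b = d then 1 else 0) := by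
  by_cases h : a = c ∨ b = d
  · have one_le : (1 : ℝ) ≤ (if a = c then (1 : ℝ) else 0) + if b = d then 1 else 0 := by
      rcases h with h | h <;> rw [if_pos h]
      · exact le_add_of_nonneg_right (by positivity)
      · exact le_add_of_nonneg_left (by positivity)
    have le_one (ω : J × p × p → Bool) : boolSign (ω (j, a, b)) *
        (boolSign (ω (j, c, b)) * boolSign (ω (j, a, d)) * boolSign (ω (j, c, d))) ≤ 1 :=
      (le_abs_self _).trans_eq (by simp only [abs_mul, abs_boolSign, mul_one])
    refine (Finset.sum_le_card_nsmul _ _ 1 fun ω _ => le_one ω).trans ?_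
    rw [Finset.card_univ, nsmul_eq_mul]
    gcongr
  · rw [not_or] at h
    rw [sum_boolSign_mul_eq_zero]
    · positivity
    · intro ω t
      rw [Function.update_of_ne, Function.update_of_ne, Function.update_of_ne] <;>
      · simp only [ne_eq, Prod.mk.injEq, true_and, not_and]
        tauto

theorem sum_hsSq_signMatrix_mul_conjTranspose_le (j : J) :
    ∑ ω : J × p × p → Bool, hsSq (signMatrix ω j * (signMatrix ω j)ᴴ) ≤
      Fintype.card (J × p × p → Bool) * (2 * (Fintype.card p : ℝ) ^ 3) := by
  calc ∑ ω : J × p × p → Bool, hsSq (signMatrix ω j * (signMatrix ω j)ᴴ)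
      = ∑ a, ∑ c, ∑ b, ∑ d, ∑ ω : J × p × p → Bool, boolSign (ω (j, a, b)) *
          (boolSign (ω (j, c, b)) * boolSign (ω (j, a, d)) * boolSign (ω (j, c, d))) := by
        simp only [hsSq_signMatrix_mul_conjTranspose,
          Finset.sum_comm (s := (Finset.univ : Finset (J × p × p → Bool)))]
    _ ≤ ∑ a : p, ∑ c : p, ∑ b : p, ∑ d : p, Fintype.card (J × p × p → Bool) *
          ((if a = c then (1 : ℝ) else 0) + if b = d then 1 else 0) := by
        gcongr
        exact sum_boolSign_rectangle_le ..
    _ = _ := by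
        simp only [← Finset.mul_sum, Finset.sum_add_distrib, Finset.sum_ite_eq, Finset.mem_univ,
          if_true, Finset.sum_const, Finset.card_univ, nsmul_eq_mul, mul_one]
        ring

end RandomSigns

section TraceNorm

variable {p : Type*} [Fintype p] [DecidableEq p] {U V : Matrix p p ℂ}

theorem hsSq_unitary_mul_diagonal_mul (hU : U ∈ unitaryGroup p ℂ) (hV : V ∈ unitaryGroup p ℂ)
    (s : p → ℝ) : hsSq (U * (diagonal fun i => (s i : ℂ)) * V) = ∑ i, s i ^ 2 := by
  simp only [hsSq_mul_unitary hV, hsSq_unitary_mul hU, hsSq_diagonal, Complex.norm_real,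
    Real.norm_eq_abs, sq_abs]

theorem svd_mul_conjTranspose (hV : V ∈ unitaryGroup p ℂ) (s : p → ℝ) :
    U * (diagonal fun i => (s i : ℂ)) * Vᴴ * (U * (diagonal fun i => (s i : ℂ)) * Vᴴ)ᴴ =
      U * (diagonal fun i => ((s i ^ 2 : ℝ) : ℂ)) * Uᴴ := by
  rw [conjTranspose_mul, conjTranspose_mul, conjTranspose_diagonal_ofReal,
    conjTranspose_conjTranspose, Matrix.mul_assoc, ← Matrix.mul_assoc Vᴴ,
    conjTranspose_mul_self_of_mem_unitaryGroup hV, Matrix.one_mul, ← Matrix.mul_assoc,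
    Matrix.mul_assoc U, diagonal_mul_diagonal]
  simp only [sq, Complex.ofReal_mul]

theorem hsInner_mul_svd (hU : U ∈ unitaryGroup p ℂ) (hV : V ∈ unitaryGroup p ℂ) (s : p → ℝ) :
    hsInner (U * Vᴴ) (U * (diagonal fun i => (s i : ℂ)) * Vᴴ) = ∑ i, (s i : ℂ) := by
  rw [hsInner_eq_trace, conjTranspose_mul, conjTranspose_mul, conjTranspose_diagonal_ofReal,
    conjTranspose_conjTranspose, Matrix.mul_assoc, ← Matrix.mul_assoc _ V,
    conjTranspose_mul_self_of_mem_unitaryGroup hV, Matrix.one_mul, trace_mul_comm,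
    Matrix.mul_assoc, conjTranspose_mul_self_of_mem_unitaryGroup hU, Matrix.mul_one,
    trace_diagonal]

theorem three_mul_sq_sub_pow_four_le {s l : ℝ} (hs : 0 ≤ s) (hl : 0 < l) :
    (3 * s ^ 2 / l - s ^ 4 / l ^ 3) / 2 ≤ s := by
  have h : (3 * s ^ 2 / l - s ^ 4 / l ^ 3) / 2 = (3 * l ^ 2 * s ^ 2 - s ^ 4) / (2 * l ^ 3) := by
    field_simp
  have factored : 0 ≤ s * ((s - l) ^ 2 * (s + 2 * l)) := by positivity
  rw [h, div_le_iff₀ (by positivity)]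
  linarith

/-- The supremum of `Re ⟨u, G⟩` over unitaries is the trace norm of `G`, which is thus bounded
below by the second and fourth moments of the singular values. -/
theorem exists_unitary_le_re_hsInner (G : Matrix p p ℂ) :
    ∃ u ∈ unitaryGroup p ℂ, ∀ l : ℝ, 0 < l →
      (3 * hsSq G / l - hsSq (G * Gᴴ) / l ^ 3) / 2 ≤ (hsInner u G).re := by
  obtain ⟨U, hU, V, hV, s, hs, rfl⟩ := exists_svd G
  have hV' := conjTranspose_mem_unitaryGroup hV
  refine ⟨U * Vᴴ, mul_mem hU hV', fun l hl => ?_⟩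
  rw [svd_mul_conjTranspose hV, hsSq_unitary_mul_diagonal_mul hU hV',
    hsSq_unitary_mul_diagonal_mul hU (conjTranspose_mem_unitaryGroup hU),
    hsInner_mul_svd hU hV, Complex.re_sum, Finset.mul_sum, Finset.sum_div, Finset.sum_div,
    ← Finset.sum_sub_distrib, Finset.sum_div]
  refine Finset.sum_le_sum fun i _ => ?_
  rw [← pow_mul]
  exact three_mul_sq_sub_pow_four_le (hs i) hl

end TraceNorm

section Packing

variable {J p : Type*} [Fintype J] [Fintype p]

theorem re_sum_hsInner_signMatrix (t : J → Matrix p p ℂ) (ω : J × p × p → Bool) :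
    (∑ j, hsInner (t j) (signMatrix ω j)).re =
      ∑ i : J × p × p, boolSign (ω i) * (t i.1 i.2.1 i.2.2).re := by
  simp [hsInner, signMatrix, Fintype.sum_prod_type (α₁ := J), Complex.re_sum, mul_comm]

variable [DecidableEq J] [DecidableEq p]

theorem sum_exp_re_sum_hsInner_signMatrix_le (t : J → Matrix p p ℂ) (θ : ℝ) :
    ∑ ω : J × p × p → Bool, Real.exp (θ * (∑ j, hsInner (t j) (signMatrix ω j)).re) ≤
      Fintype.card (J × p × p → Bool) * Real.exp (θ ^ 2 * (∑ j, hsSq (t j)) / 2) := by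
  simp only [re_sum_hsInner_signMatrix, Finset.mul_sum, mul_left_comm θ]
  refine (sum_exp_boolSign_mul_le fun i : J × p × p => θ * (t i.1 i.2.1 i.2.2).re).trans ?_
  gcongr
  simp only [mul_pow, ← Finset.mul_sum, hsSq, Fintype.sum_prod_type (α₁ := J)]
  gcongr θ ^ 2 * (∑ j, ∑ c, ?_)
  rw [← sq_abs]
  gcongr
  exact Complex.abs_re_le_norm _

theorem le_sum_unitary_bound [Nonempty p] (j : J) :
    Fintype.card (J × p × p → Bool) * (7 / 10 * √(Fintype.card p) ^ 3) ≤
      ∑ ω : J × p × p → Bool, (3 * hsSq (signMatrix ω j) / (√2 * √(Fintype.card p)) -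
        hsSq (signMatrix ω j * (signMatrix ω j)ᴴ) / (√2 * √(Fintype.card p)) ^ 3) / 2 := by
  set Q : ℝ := ↑(Fintype.card (J × p × p → Bool))
  set r : ℝ := √(Fintype.card p)
  have hr : 0 < r := Real.sqrt_pos.mpr (by exact_mod_cast Fintype.card_pos)
  have hr2 : (Fintype.card p : ℝ) = r ^ 2 := (Real.sq_sqrt (Nat.cast_nonneg _)).symm
  have fourth_moment := sum_hsSq_signMatrix_mul_conjTranspose_le (p := p) j
  simp only [hsSq_signMatrix]
  rw [hr2] at fourth_moment ⊢
  simp only [← Finset.sum_div, Finset.sum_sub_distrib, Finset.sum_const, Finset.card_univ,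
    nsmul_eq_mul]
  change _ ≤ (Q * (3 * (r ^ 2) ^ 2) / (√2 * r) - _) / 2
  have optimum : (Q * (3 * (r ^ 2) ^ 2) / (√2 * r) - Q * (2 * (r ^ 2) ^ 3) / (√2 * r) ^ 3) / 2 =
      Q * (r ^ 3 / √2) := by
    have h : (√2 * r) ^ 3 = 2 * r ^ 2 * (√2 * r) := by
      rw [pow_succ, mul_pow, Real.sq_sqrt zero_le_two]
    rw [h]
    field_simp
    ring
  have sqrt_two_le : √2 ≤ 10 / 7 := Real.sqrt_le_iff.mpr ⟨by norm_num, by norm_num⟩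
  calc Q * (7 / 10 * r ^ 3) = Q * (r ^ 3 / (10 / 7)) := by ring
    _ ≤ Q * (r ^ 3 / √2) := by gcongr
    _ = _ := optimum.symm
    _ ≤ _ := by gcongr

theorem exists_unitary_le_sum_re_hsInner_signMatrix (J p : Type*) [Fintype J] [Fintype p]
    [DecidableEq J] [DecidableEq p] [Nonempty p] :
    ∃ u : (J × p × p → Bool) → J → Matrix p p ℂ, (∀ ω j, u ω j ∈ unitaryGroup p ℂ) ∧
      Fintype.card (J × p × p → Bool) * (7 / 10 * (Fintype.card J * √(Fintype.card p) ^ 3)) ≤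
        ∑ ω, (∑ j, hsInner (u ω j) (signMatrix ω j)).re := by
  choose u hu le_inner using
    fun (ω : J × p × p → Bool) j => exists_unitary_le_re_hsInner (signMatrix ω j)
  refine ⟨u, hu, ?_⟩
  have hl : 0 < √2 * √(Fintype.card p : ℝ) :=
    mul_pos (by positivity) (Real.sqrt_pos.mpr (by exact_mod_cast Fintype.card_pos))
  simp only [Complex.re_sum]
  rw [Finset.sum_comm]
  refine le_trans ?_ (Finset.sum_le_sum fun j _ => (le_sum_unitary_bound j).trans
    (Finset.sum_le_sum fun ω _ => le_inner ω j _ hl))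
  rw [Finset.sum_const, Finset.card_univ, nsmul_eq_mul]
  exact le_of_eq (by ring)

omit [DecidableEq J] [DecidableEq p] in
theorem re_sum_hsInner_signMatrix_sub_le {u t : J → Matrix p p ℂ}
    (hut : ∑ j, hsSq (u j - t j) ≤ Fintype.card J * Fintype.card p / 4)
    (ω : J × p × p → Bool) :
    (∑ j, hsInner (u j) (signMatrix ω j)).re - Fintype.card J * √(Fintype.card p) ^ 3 / 2 ≤
      (∑ j, hsInner (t j) (signMatrix ω j)).re := by
  have difference : (∑ j, hsInner (u j) (signMatrix ω j)).re -
      (∑ j, hsInner (t j) (signMatrix ω j)).re ≤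
      √(∑ j, hsSq (u j - t j)) * √(∑ j, hsSq (signMatrix ω j)) := by
    rw [← Complex.sub_re, ← Finset.sum_sub_distrib]
    simp only [← hsInner_sub_left]
    exact (Complex.re_le_norm _).trans (norm_sum_hsInner_le _ _)
  have bound : √(∑ j, hsSq (u j - t j)) * √(∑ j, hsSq (signMatrix ω j)) ≤
      Fintype.card J * √(Fintype.card p) ^ 3 / 2 := by
    simp only [hsSq_signMatrix, Finset.sum_const, Finset.card_univ, nsmul_eq_mul]
    rw [← Real.sqrt_mul (Finset.sum_nonneg fun j _ => hsSq_nonneg _)]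
    refine Real.sqrt_le_iff.mpr ⟨by positivity, ?_⟩
    have hr2 : √(Fintype.card p : ℝ) ^ 2 = Fintype.card p := Real.sq_sqrt (Nat.cast_nonneg _)
    calc _ ≤ (Fintype.card J * Fintype.card p / 4 : ℝ) *
          (Fintype.card J * (Fintype.card p : ℝ) ^ 2) := by gcongr
      _ = _ := by linear_combination (-(Fintype.card J : ℝ) ^ 2 / 4) *
        ((√(Fintype.card p : ℝ) ^ 2) ^ 2 + √(Fintype.card p : ℝ) ^ 2 * Fintype.card p +
          (Fintype.card p : ℝ) ^ 2) * hr2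
  linarith

omit [DecidableEq J] in
/-- If `T` is dense, every random sign tuple correlates well with some element of `T`; by the
sub-Gaussian bound a single element has a large correlation only with tiny probability. -/
theorem exp_le_card_of_dense [Nonempty p] (T : Finset (J → Matrix p p ℂ))
    (hT : ∀ t ∈ T, ∀ j, t j ∈ unitaryGroup p ℂ)
    (hdense : ∀ u : J → Matrix p p ℂ, (∀ j, u j ∈ unitaryGroup p ℂ) →
      ∃ t ∈ T, ∑ j, hsSq (u j - t j) ≤ Fintype.card J * Fintype.card p / 4) :
    Real.exp (Fintype.card J * (Fintype.card p : ℝ) ^ 2 / 50) ≤ T.card := by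
  classical
  let corr (t : J → Matrix p p ℂ) (ω : J × p × p → Bool) : ℝ :=
    (∑ j, hsInner (t j) (signMatrix ω j)).re
  set Q : ℝ := ↑(Fintype.card (J × p × p → Bool))
  set K : ℝ := ↑(Fintype.card J)
  set r : ℝ := √(Fintype.card p)
  have hQ : 0 < Q := Nat.cast_pos.mpr Fintype.card_pos
  have : 0 ≤ r := Real.sqrt_nonneg _
  have hr2 : (Fintype.card p : ℝ) = r ^ 2 := (Real.sq_sqrt (Nat.cast_nonneg _)).symm
  obtain ⟨u, hu, mean_u⟩ := exists_unitary_le_sum_re_hsInner_signMatrix J p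
  choose t ht near using fun ω => hdense (u ω) (hu ω)
  have mean_t : Q * (r / 5 * (K * r ^ 3 / 5)) ≤ ∑ ω, r / 5 * corr (t ω) ω := by
    have h := Finset.sum_le_sum fun ω (_ : ω ∈ Finset.univ) =>
      re_sum_hsInner_signMatrix_sub_le (near ω) ω
    rw [Finset.sum_sub_distrib, Finset.sum_const, Finset.card_univ, nsmul_eq_mul] at h
    rw [← Finset.mul_sum, mul_left_comm]
    gcongr
    linarith
  have moment (a : J → Matrix p p ℂ) (ha : a ∈ T) :
      ∑ ω, Real.exp (r / 5 * corr a ω) ≤ Q * Real.exp ((r / 5) ^ 2 * (K * r ^ 2) / 2) := by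
    have h := sum_exp_re_sum_hsInner_signMatrix_le a (r / 5)
    simpa only [hsSq_of_mem_unitaryGroup (hT a ha _), Finset.sum_const, Finset.card_univ,
      nsmul_eq_mul, hr2] using h
  have union_bound : Q * Real.exp (r / 5 * (K * r ^ 3 / 5)) ≤
      Q * (T.card * Real.exp ((r / 5) ^ 2 * (K * r ^ 2) / 2)) := by
    refine (card_mul_exp_le_sum_exp mean_t).trans ?_
    calc ∑ ω, Real.exp (r / 5 * corr (t ω) ω)
        ≤ ∑ ω, ∑ t ∈ T, Real.exp (r / 5 * corr t ω) := Finset.sum_le_sum fun ω _ =>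
          Finset.single_le_sum (f := fun t => Real.exp (r / 5 * corr t ω))
            (fun _ _ => (Real.exp_pos _).le) (ht ω)
      _ ≤ ∑ _t ∈ T, Q * Real.exp ((r / 5) ^ 2 * (K * r ^ 2) / 2) :=
          Finset.sum_comm.trans_le (Finset.sum_le_sum moment)
      _ = _ := by rw [Finset.sum_const, nsmul_eq_mul, mul_left_comm]
  have exponent : r / 5 * (K * r ^ 3 / 5) =
      K * (Fintype.card p : ℝ) ^ 2 / 50 + (r / 5) ^ 2 * (K * r ^ 2) / 2 := by
    rw [hr2]; ring
  rw [exponent, Real.exp_add] at union_bound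
  exact le_of_mul_le_mul_right (le_of_mul_le_mul_left union_bound hQ) (Real.exp_pos _)

theorem exists_finset_pairwise_card_eq {α : Type*} {P : α → Prop} {R : α → α → Prop}
    (symm : ∀ a b, R a b → R b a) (irrefl : ∀ a, ¬ R a a) {k : ℕ}
    (extend : ∀ T : Finset α, T.card < k → (∀ t ∈ T, P t) → ∃ a, P a ∧ ∀ t ∈ T, R a t) :
    ∃ T : Finset α, (∀ t ∈ T, P t) ∧ (T : Set α).Pairwise R ∧ T.card = k := by
  classical
  induction k with
  | zero => exact ⟨∅, by simp⟩
  | succ k ih =>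
    obtain ⟨T, hT, hR, rfl⟩ := ih fun T hk => extend T (hk.trans (Nat.lt_succ_self k))
    obtain ⟨a, ha, haT⟩ := extend T (Nat.lt_succ_self _) hT
    have not_mem : a ∉ T := fun h => irrefl a (haT a h)
    refine ⟨insert a T, (Finset.forall_mem_insert ..).mpr ⟨ha, hT⟩, ?_,
      Finset.card_insert_of_notMem not_mem⟩
    rw [Finset.coe_insert, Set.pairwise_insert]
    exact ⟨hR, fun t ht _ => ⟨haT t ht, symm _ _ (haT t ht)⟩⟩

theorem exists_packing (J p : Type*) [Fintype J] [Fintype p] [DecidableEq p] [Nonempty p] :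
    ∃ T : Finset (J → Matrix p p ℂ), (∀ t ∈ T, ∀ j, t j ∈ unitaryGroup p ℂ) ∧
      (T : Set (J → Matrix p p ℂ)).Pairwise
        (fun t t' => Fintype.card J * Fintype.card p / 4 < ∑ j, hsSq (t j - t' j)) ∧
      Real.exp (Fintype.card J * (Fintype.card p : ℝ) ^ 2 / 50) ≤ T.card := by
  classical
  obtain ⟨T, hT, separated, card_eq⟩ := exists_finset_pairwise_card_eq
    (P := fun t : J → Matrix p p ℂ => ∀ j, t j ∈ unitaryGroup p ℂ)
    (R := fun t t' => (Fintype.card J * Fintype.card p / 4 : ℝ) < ∑ j, hsSq (t j - t' j))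
    (k := ⌈Real.exp (Fintype.card J * (Fintype.card p : ℝ) ^ 2 / 50)⌉₊)
    (fun t t' h => by simpa only [hsSq_sub_comm] using h)
    (fun t => by
      simp only [sub_self, not_lt]
      exact (Finset.sum_eq_zero fun j _ => by simp [hsSq]).trans_le (by positivity))
    (fun T hk hT => by
      by_contra! hdense
      exact (Nat.lt_ceil.mp hk).not_ge (exp_le_card_of_dense T hT hdense))
  exact ⟨T, hT, separated, (Nat.le_ceil _).trans_eq (by rw [card_eq])⟩

end Packing

section TensorAction

theorem norm_map_conj_le {p q : Type*} [Fintype p] [Fintype q] [DecidableEq q]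
    (A : Matrix p q ℂ) : ‖A.map (starRingEnd ℂ)‖ ≤ ‖A‖ := by
  refine opNorm_le_of_sq (norm_nonneg _) fun v => ?_
  have map_mulVec (i : p) : (A.map (starRingEnd ℂ)).mulVec v i =
      starRingEnd ℂ (A.mulVec (fun j => starRingEnd ℂ (v j)) i) := by
    simp [mulVec, dotProduct]
  simpa [map_mulVec] using sum_norm_mulVec_sq_le A fun j => starRingEnd ℂ (v j)

theorem norm_one_kronecker_le {p q r : Type*} [Fintype p] [Fintype q] [Fintype r] [DecidableEq q]
    [DecidableEq r] (A : Matrix p q ℂ) : ‖(1 : Matrix r r ℂ) ⊗ₖ A‖ ≤ ‖A‖ := by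
  have swap : (1 : Matrix r r ℂ) ⊗ₖ A =
      (A ⊗ₖ (1 : Matrix r r ℂ)).submatrix (Equiv.prodComm r p) (Equiv.prodComm r q) := by
    ext ⟨a, b⟩ ⟨c, d⟩
    simp [mul_comm]
  rw [swap]
  exact (norm_submatrix_equiv_le _ _ _).trans (norm_kronecker_one_le A)

variable {n : ℕ} {p q : Type*} [Fintype p] [Fintype q] [DecidableEq p] [DecidableEq q]

theorem norm_kronecker_le (A : Matrix p p ℂ) (B : Matrix q q ℂ) : ‖A ⊗ₖ B‖ ≤ ‖A‖ * ‖B‖ := by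
  have factor : A ⊗ₖ B = (A ⊗ₖ (1 : Matrix q q ℂ)) * ((1 : Matrix p p ℂ) ⊗ₖ B) := by
    rw [← mul_kronecker_mul, Matrix.mul_one, Matrix.one_mul]
  rw [factor]
  exact (l2_opNorm_mul _ _).trans (mul_le_mul (norm_kronecker_one_le A) (norm_one_kronecker_le B)
    (norm_nonneg _) (norm_nonneg _))

theorem norm_tensorConj_self_le {x : Fin n → Matrix p p ℂ} (hx : ∀ j, ‖x j‖ ≤ 1) :
    ‖tensorConj x x‖ ≤ n := by
  refine (norm_sum_le _ _).trans ?_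
  have norm_term_le : ∀ j ∈ Finset.univ, ‖x j ⊗ₖ (x j).map (starRingEnd ℂ)‖ ≤ 1 := fun j _ =>
    (norm_kronecker_le _ _).trans (mul_le_one₀ (hx j) (norm_nonneg _)
      ((norm_map_conj_le _).trans (hx j)))
  simpa using Finset.sum_le_card_nsmul _ _ _ norm_term_le

omit [DecidableEq p] [DecidableEq q]

/-- The operator `∑ x_j ⊗ conj(y_j)` on `ℓ₂ ⊗ ℓ₂`, acting on matrices by identifying a vector of
`ℓ₂ ⊗ ℓ₂` with its matrix of coordinates. -/
def tensorAct (x : Fin n → Matrix p p ℂ) (y : Fin n → Matrix q q ℂ) (ξ : Matrix p q ℂ) :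
    Matrix p q ℂ :=
  ∑ j, x j * ξ * (y j)ᴴ

variable (x : Fin n → Matrix p p ℂ) (y : Fin n → Matrix q q ℂ)

theorem tensorAct_sub (ξ η : Matrix p q ℂ) :
    tensorAct x y (ξ - η) = tensorAct x y ξ - tensorAct x y η := by
  simp only [tensorAct, Matrix.mul_sub, Matrix.sub_mul, Finset.sum_sub_distrib]

theorem tensorAct_smul (c : ℂ) (ξ : Matrix p q ℂ) :
    tensorAct x y (c • ξ) = c • tensorAct x y ξ := by
  simp only [tensorAct, Matrix.mul_smul, Matrix.smul_mul, Finset.smul_sum]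

theorem hsInner_tensorAct (ξ η : Matrix p q ℂ) :
    hsInner (tensorAct x y ξ) η = ∑ j, hsInner (x j * ξ * (y j)ᴴ) η := by
  simp only [hsInner_eq_trace, tensorAct, Matrix.sum_mul, trace_sum]

theorem hsSq_tensorAct (ξ : Matrix p q ℂ) :
    hsSq (tensorAct x y ξ) = ∑ c, ‖(tensorConj x y).mulVec (fun c => ξ c.1 c.2) c‖ ^ 2 := by
  simp only [tensorConj_mulVec]
  rfl

variable [DecidableEq p] [DecidableEq q]

theorem hsSq_tensorAct_le (ξ : Matrix p q ℂ) :
    hsSq (tensorAct x y ξ) ≤ ‖tensorConj x y‖ ^ 2 * hsSq ξ :=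
  (hsSq_tensorAct x y ξ).trans_le (sum_norm_mulVec_sq_le (tensorConj x y) fun c => ξ c.1 c.2)

theorem norm_hsInner_tensorAct_le (ξ η : Matrix p q ℂ) :
    ‖hsInner (tensorAct x y ξ) η‖ ≤ ‖tensorConj x y‖ * √(hsSq ξ) * √(hsSq η) := by
  refine (norm_hsInner_le _ _).trans ?_
  gcongr
  rw [← Real.sqrt_sq (norm_nonneg (tensorConj x y)), ← Real.sqrt_mul (sq_nonneg _)]
  exact Real.sqrt_le_sqrt (hsSq_tensorAct_le x y ξ)

omit [DecidableEq p] [DecidableEq q] in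
theorem exists_hsSq_eq_one_smul {ξ : Matrix p q ℂ} (hξ : 0 < hsSq ξ) :
    ∃ ξ₁ : Matrix p q ℂ, hsSq ξ₁ = 1 ∧ ξ = ((√(hsSq ξ) : ℝ) : ℂ) • ξ₁ := by
  have sqrt_pos := Real.sqrt_pos.mpr hξ
  refine ⟨((√(hsSq ξ) : ℝ) : ℂ)⁻¹ • ξ, ?_, ?_⟩
  · rw [hsSq_smul, norm_inv, Complex.norm_real, Real.norm_of_nonneg sqrt_pos.le, inv_pow,
      Real.sq_sqrt hξ.le, inv_mul_cancel₀ hξ.ne']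
  · rw [smul_inv_smul₀ (Complex.ofReal_ne_zero.mpr sqrt_pos.ne')]

variable {x y}

theorem exists_hsInner_tensorAct_gt {c : ℝ} (hc : 0 ≤ c) (h : c < ‖tensorConj x y‖) :
    ∃ ξ η : Matrix p q ℂ, hsSq ξ = 1 ∧ hsSq η = 1 ∧ c < (hsInner (tensorAct x y ξ) η).re := by
  obtain ⟨ζ, hζ⟩ : ∃ ζ : Matrix p q ℂ, c ^ 2 * hsSq ζ < hsSq (tensorAct x y ζ) := by
    by_contra! not_expanding
    refine absurd (opNorm_le_of_sq hc fun v => ?_) (not_le.mpr h)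
    have := not_expanding (of fun a b => v (a, b))
    rwa [hsSq_tensorAct] at this
  have image_pos : 0 < hsSq (tensorAct x y ζ) :=
    (mul_nonneg (sq_nonneg _) (hsSq_nonneg _)).trans_lt hζ
  have pos : 0 < hsSq ζ := (hsSq_nonneg ζ).lt_of_ne fun h0 => by
    have := hsSq_tensorAct_le x y ζ
    rw [← h0, mul_zero] at this
    exact this.not_gt image_pos
  obtain ⟨ξ, hξ, ζ_eq⟩ := exists_hsSq_eq_one_smul pos
  have action_eq : tensorAct x y ζ = ((√(hsSq ζ) : ℝ) : ℂ) • tensorAct x y ξ := by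
    conv_lhs => rw [ζ_eq, tensorAct_smul]
  have hsSq_eq : hsSq (tensorAct x y ζ) = hsSq ζ * hsSq (tensorAct x y ξ) := by
    rw [action_eq, hsSq_smul, Complex.norm_real, Real.norm_of_nonneg (Real.sqrt_nonneg _),
      Real.sq_sqrt pos.le]
  have sq_lt : c ^ 2 < hsSq (tensorAct x y ξ) := by nlinarith
  obtain ⟨η, hη, η_eq⟩ := exists_hsSq_eq_one_smul ((sq_nonneg c).trans_lt sq_lt)
  refine ⟨ξ, η, hξ, hη, ?_⟩
  rw [η_eq, hsInner_smul_left, hsInner_self, hη, Complex.ofReal_one, mul_one, Complex.ofReal_re]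
  exact Real.lt_sqrt_of_sq_lt sq_lt

end TensorAction

section PolarFactorization

variable {p : Type*} [Fintype p] [DecidableEq p]

omit [DecidableEq p] in
theorem sum_sub_sq_le_of_close {s : p → ℝ} (hs : 0 ≤ s) (h1 : ∑ i, s i ^ 2 = 1)
    {r : ℝ} (hr : 0 ≤ r) (hpr : Fintype.card p * r ^ 2 = 1) (c : ℂ) :
    ∑ i, (s i - r) ^ 2 ≤ 2 * ∑ i, ‖(s i : ℂ) - c‖ ^ 2 := by
  set S := ∑ i, s i with hS
  have sum_sub_sq (t : ℝ) : ∑ i, (s i - t) ^ 2 = 1 - 2 * t * S + Fintype.card p * t ^ 2 := by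
    have expand (i : p) : (s i - t) ^ 2 = s i ^ 2 - 2 * t * s i + t ^ 2 := by ring
    simp only [expand, Finset.sum_add_distrib, Finset.sum_sub_distrib, ← Finset.mul_sum,
      Finset.sum_const, Finset.card_univ, nsmul_eq_mul, h1, hS]
  have re_le : ∑ i, (s i - c.re) ^ 2 ≤ ∑ i, ‖(s i : ℂ) - c‖ ^ 2 := by
    refine Finset.sum_le_sum fun i _ => ?_
    have := Complex.abs_re_le_norm ((s i : ℂ) - c)
    rw [Complex.sub_re, Complex.ofReal_re] at this
    exact (sq_abs _).symm.trans_le (pow_le_pow_left₀ (abs_nonneg _) this 2)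
  have rS_nonneg : 0 ≤ r * S := mul_nonneg hr (Finset.sum_nonneg fun i _ => hs i)
  have rS_le_one : r * S ≤ 1 := by
    have : (0 : ℝ) ≤ ∑ i, (s i - r) ^ 2 := Finset.sum_nonneg fun i _ => sq_nonneg _
    rw [sum_sub_sq, hpr] at this
    linarith
  -- The mean of the `s i` is `r ^ 2 * S`; it minimizes the sum of squared deviations.
  have variance_le : 1 - (r * S) ^ 2 ≤ ∑ i, (s i - c.re) ^ 2 := by
    have : (0 : ℝ) ≤ Fintype.card p * (c.re - r ^ 2 * S) ^ 2 := by positivity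
    rw [sum_sub_sq]
    linear_combination this + (r ^ 2 * S ^ 2 - 2 * c.re * S) * hpr
  rw [sum_sub_sq, hpr]
  nlinarith

theorem svd_eq_mul_conjTranspose {s : p → ℝ} (hs : 0 ≤ s) (A B : Matrix p p ℂ) :
    A * (diagonal fun i => (s i : ℂ)) * Bᴴ =
      A * (diagonal fun i => ((√(s i) : ℝ) : ℂ)) *
        (B * (diagonal fun i => ((√(s i) : ℝ) : ℂ)))ᴴ := by
  rw [conjTranspose_mul, conjTranspose_diagonal_ofReal, ← Matrix.mul_assoc,
    Matrix.mul_assoc A _ (diagonal _), diagonal_mul_diagonal]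
  simp only [← Complex.ofReal_mul, Real.mul_self_sqrt (hs _)]

theorem hsSq_unitary_mul_diagonal_mul_sub_smul {U V : Matrix p p ℂ} (hU : U ∈ unitaryGroup p ℂ)
    (hV : V ∈ unitaryGroup p ℂ) (s : p → ℝ) (c : ℂ) :
    hsSq (U * (diagonal fun i => (s i : ℂ)) * V - c • (U * V)) = ∑ i, ‖(s i : ℂ) - c‖ ^ 2 := by
  have factor : U * (diagonal fun i => (s i : ℂ)) * V - c • (U * V) =
      U * (diagonal fun i => (s i : ℂ) - c) * V := by
    rw [← diagonal_sub, ← smul_one_eq_diagonal, Matrix.mul_sub, Matrix.sub_mul, Matrix.mul_smul,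
      Matrix.mul_one, Matrix.smul_mul]
  rw [factor, hsSq_mul_unitary hV, hsSq_unitary_mul hU, hsSq_diagonal]

/- With the singular value decomposition `ξ = U D Vᴴ`, take `P = U √D`, `Q = V √D`, `W = U Vᴴ`;
then `P Pᴴ = U D Uᴴ`, so the singular values of `ξ` are close to a constant when `P Pᴴ` is close
to a scalar. -/
theorem exists_polar_factorization [Nonempty p] {ξ : Matrix p p ℂ} (hξ : hsSq ξ = 1) :
    ∃ W ∈ unitaryGroup p ℂ, ∃ P Q : Matrix p p ℂ, ξ = P * Qᴴ ∧ hsSq (P * Pᴴ) = 1 ∧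
      hsSq (Q * Qᴴ) = 1 ∧ ∀ c : ℂ,
        hsSq (ξ - (((√(Fintype.card p))⁻¹ : ℝ) : ℂ) • W) ≤ 2 * hsSq (P * Pᴴ - c • 1) := by
  obtain ⟨U, hU, V, hV, s, hs, rfl⟩ := exists_svd ξ
  have hV' := conjTranspose_mem_unitaryGroup hV
  have hU' := conjTranspose_mem_unitaryGroup hU
  rw [hsSq_unitary_mul_diagonal_mul hU hV'] at hξ
  refine ⟨U * Vᴴ, mul_mem hU hV', _, _, svd_eq_mul_conjTranspose hs U V, ?_, ?_, fun c => ?_⟩ <;>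
    rw [← svd_eq_mul_conjTranspose hs]
  · rw [hsSq_unitary_mul_diagonal_mul hU hU', hξ]
  · rw [hsSq_unitary_mul_diagonal_mul hV hV', hξ]
  · rw [← mul_conjTranspose_self_of_mem_unitaryGroup hU,
      hsSq_unitary_mul_diagonal_mul_sub_smul hU hU', hsSq_unitary_mul_diagonal_mul_sub_smul hU hV']
    simp only [← Complex.ofReal_sub, Complex.norm_real, Real.norm_eq_abs, sq_abs]
    refine sum_sub_sq_le_of_close hs hξ (by positivity) ?_ c
    rw [inv_pow, Real.sq_sqrt (Nat.cast_nonneg _)]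
    exact mul_inv_cancel₀ (Nat.cast_ne_zero.mpr Fintype.card_ne_zero)

end PolarFactorization

section NearEquality

variable {n : ℕ} {p q r : Type*} [Fintype p] [Fintype q] [Fintype r]

theorem hsInner_tensorAct_mul_conjTranspose (x : Fin n → Matrix p p ℂ) (y : Fin n → Matrix q q ℂ)
    (P R : Matrix p r ℂ) (Q Z : Matrix q r ℂ) :
    hsInner (tensorAct x y (P * Qᴴ)) (R * Zᴴ) =
      ∑ j, hsInner (Rᴴ * x j * P) (Zᴴ * y j * Q) := by
  rw [hsInner_tensorAct]
  refine Finset.sum_congr rfl fun j _ => ?_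
  rw [hsInner_eq_trace, hsInner_eq_trace, conjTranspose_mul R, conjTranspose_conjTranspose,
    ← Matrix.mul_assoc, trace_mul_comm]
  simp only [conjTranspose_mul, conjTranspose_conjTranspose, Matrix.mul_assoc]

theorem hsSq_unitary_mul_sub_mul_unitary [DecidableEq p] {U : Matrix p p ℂ}
    (hU : U ∈ unitaryGroup p ℂ) (P R : Matrix p r ℂ) :
    hsSq (U * (P * Pᴴ) - R * Rᴴ * U) =
      hsSq (P * Pᴴ) + hsSq (R * Rᴴ) - 2 * hsSq (Rᴴ * U * P) := by
  have inner_eq : hsInner (U * (P * Pᴴ)) (R * Rᴴ * U) = hsSq (Rᴴ * U * P) := by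
    rw [hsInner_eq_trace, ofReal_hsSq_eq_trace, conjTranspose_mul, conjTranspose_mul R,
      conjTranspose_conjTranspose, ← Matrix.mul_assoc, ← Matrix.mul_assoc, trace_mul_comm]
    simp only [conjTranspose_mul, conjTranspose_conjTranspose, Matrix.mul_assoc]
  rw [hsSq_sub, hsSq_unitary_mul hU, hsSq_mul_unitary hU, inner_eq, Complex.ofReal_re]

variable [DecidableEq p] [DecidableEq q]

theorem sum_hsSq_le (z : Fin n → Matrix p p ℂ) :
    ∑ j, hsSq (z j) ≤ ‖tensorConj z z‖ * Fintype.card p := by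
  have inner_eq : hsInner (tensorAct z z 1) 1 = ((∑ j, hsSq (z j) : ℝ) : ℂ) := by
    rw [hsInner_tensorAct]
    simp only [hsInner_eq_trace, Matrix.mul_one, conjTranspose_one, Complex.ofReal_sum,
      ofReal_hsSq_eq_trace]
  have := norm_hsInner_tensorAct_le z z 1 1
  rw [inner_eq, hsSq_one, mul_assoc, Real.mul_self_sqrt (Nat.cast_nonneg _)] at this
  exact (Real.le_norm_self _).trans ((Complex.norm_real _).symm.trans_le this)

theorem sum_hsSq_conj_le {z : Fin n → Matrix q q ℂ} {Q Z : Matrix q r ℂ}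
    (hQ : hsSq (Q * Qᴴ) = 1) (hZ : hsSq (Z * Zᴴ) = 1) :
    ∑ j, hsSq (Zᴴ * z j * Q) ≤ ‖tensorConj z z‖ := by
  classical
  have := trace_sum_le z Q Z
  change ∑ j, hsSq (Zᴴ * z j * Q) ≤
    ‖tensorConj z z‖ * √(hsSq (Q * Qᴴ)) * √(hsSq (Z * Zᴴ)) at this
  rwa [hQ, hZ, Real.sqrt_one, mul_one, mul_one] at this

/- Near equality in Haagerup's Cauchy–Schwarz inequality: if `∑ u_j ⊗ conj(z_j)` nearly attains its
maximal norm `n` at the pair `P Qᴴ`, `R Zᴴ`, then the `u_j` nearly intertwine `P Pᴴ` and `R Rᴴ`. -/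
theorem sum_hsSq_intertwine_le {u : Fin n → Matrix p p ℂ}
    {z : Fin n → Matrix q q ℂ} (hu : ∀ j, u j ∈ unitaryGroup p ℂ) (hz : ‖tensorConj z z‖ ≤ n)
    {P R : Matrix p r ℂ} {Q Z : Matrix q r ℂ} (hP : hsSq (P * Pᴴ) = 1) (hQ : hsSq (Q * Qᴴ) = 1)
    (hR : hsSq (R * Rᴴ) = 1) (hZ : hsSq (Z * Zᴴ) = 1) {ε : ℝ} (hε : ε ≤ 1)
    (h : (1 - ε) * n ≤ (hsInner (tensorAct u z (P * Qᴴ)) (R * Zᴴ)).re) :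
    ∑ j, hsSq (u j * (P * Pᴴ) - R * Rᴴ * u j) ≤ 4 * ε * n := by
  set X := ∑ j, hsSq (Rᴴ * u j * P) with hX
  have X_nonneg : 0 ≤ X := Finset.sum_nonneg fun j _ => hsSq_nonneg _
  have n_nonneg : (0 : ℝ) ≤ n := Nat.cast_nonneg n
  have cauchy_schwarz : (1 - ε) * n ≤ √X * √n := by
    rw [hsInner_tensorAct_mul_conjTranspose] at h
    refine (h.trans (Complex.re_le_norm _)).trans ((norm_sum_hsInner_le _ _).trans ?_)
    exact mul_le_mul_of_nonneg_left (Real.sqrt_le_sqrt ((sum_hsSq_conj_le hQ hZ).trans hz))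
      (Real.sqrt_nonneg _)
  have X_lower : (1 - 2 * ε) * n ≤ X := by
    have sq_le : ((1 - ε) * n) ^ 2 ≤ X * n := by
      have := pow_le_pow_left₀ (mul_nonneg (by linarith) n_nonneg) cauchy_schwarz 2
      rwa [mul_pow (√X), Real.sq_sqrt X_nonneg, Real.sq_sqrt n_nonneg] at this
    rcases n_nonneg.eq_or_lt with n_eq | n_pos
    · rwa [← n_eq, mul_zero]
    · nlinarith [mul_nonneg (mul_nonneg n_nonneg n_nonneg) (sq_nonneg ε)]
  simp only [hsSq_unitary_mul_sub_mul_unitary (hu _), hP, hR]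
  rw [Finset.sum_sub_distrib, ← Finset.mul_sum, ← hX, Finset.sum_const, Finset.card_univ,
    Fintype.card_fin, nsmul_eq_mul]
  linarith

theorem re_hsInner_tensorAct_le (x : Fin n → Matrix p p ℂ) (y : Fin n → Matrix q q ℂ)
    (ξ ξ' η η' : Matrix p q ℂ) :
    (hsInner (tensorAct x y ξ) η).re ≤ (hsInner (tensorAct x y ξ') η').re +
      ‖tensorConj x y‖ * (√(hsSq (ξ - ξ')) * √(hsSq η) + √(hsSq ξ') * √(hsSq (η - η'))) := by
  have left := (Complex.re_le_norm _).trans (norm_hsInner_tensorAct_le x y (ξ - ξ') η)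
  have right := (Complex.re_le_norm _).trans (norm_hsInner_tensorAct_le x y ξ' (η - η'))
  rw [tensorAct_sub, hsInner_sub_left, Complex.sub_re] at left
  rw [hsInner_sub_right, Complex.sub_re] at right
  linarith

end NearEquality

section Rigidity

variable {n : ℕ} {p : Type*} [Fintype p] [DecidableEq p]

/-- If `A` and `B` are nearly intertwined by the matrices `u_j` with `j ∈ J`, then both are close to
the same scalar. In contrast with `HasSpectralGap` this does not change when all the `u_j` are
multiplied on the left or on the right by a fixed unitary. -/
def HasIntertwiningGapOn {ι : Type*} (u : ι → Matrix p p ℂ) (J : Finset ι) (γ : ℝ) : Prop :=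
  ∀ A B : Matrix p p ℂ, ∃ c : ℂ,
    hsSq (A - c • 1) + hsSq (B - c • 1) ≤ γ * ∑ j ∈ J, hsSq (u j * A - B * u j)

variable {u v z : Fin n → Matrix p p ℂ} {J : Finset (Fin n)} {L κ δ : ℝ}

theorem HasIntertwiningGapOn.exists_le (hgap : HasIntertwiningGapOn u J (L ^ 2 / (8 * n)))
    {A B : Matrix p p ℂ} {a : ℝ} (ha : 0 ≤ a)
    (h : ∑ j ∈ J, hsSq (u j * A - B * u j) ≤ a * n) :
    ∃ c : ℂ, hsSq (A - c • 1) + hsSq (B - c • 1) ≤ L ^ 2 / 8 * a := by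
  obtain ⟨c, hc⟩ := hgap A B
  refine ⟨c, hc.trans ?_⟩
  calc L ^ 2 / (8 * n) * ∑ j ∈ J, hsSq (u j * A - B * u j) ≤ L ^ 2 / (8 * n) * (a * n) := by gcongr
    _ = L ^ 2 / 8 * a * (n / n) := by ring
    _ ≤ L ^ 2 / 8 * a := mul_le_of_le_one_right (by positivity) (div_self_le_one _)

theorem exists_unitary_near_maximizer [Nonempty p]
    (hgap : HasIntertwiningGapOn u J (L ^ 2 / (8 * n))) (hu : ∀ j, u j ∈ unitaryGroup p ℂ)
    (hz : ‖tensorConj z z‖ ≤ n) (hκ : κ ^ 2 ≤ 1) (huz : (1 - κ ^ 2) * n < ‖tensorConj u z‖) :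
    ∃ ξ η : Matrix p p ℂ, hsSq ξ = 1 ∧ hsSq η = 1 ∧
      (1 - κ ^ 2) * n < (hsInner (tensorAct u z ξ) η).re ∧
      ∃ V ∈ unitaryGroup p ℂ, ∃ W ∈ unitaryGroup p ℂ,
        hsSq (ξ - (((√(Fintype.card p))⁻¹ : ℝ) : ℂ) • V) ≤ (L * κ) ^ 2 ∧
        hsSq (η - (((√(Fintype.card p))⁻¹ : ℝ) : ℂ) • W) ≤ (L * κ) ^ 2 := by
  obtain ⟨ξ, η, hξ, hη, near_max⟩ := exists_hsInner_tensorAct_gt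
    (mul_nonneg (by linarith) (Nat.cast_nonneg n)) huz
  obtain ⟨V, hV, P, Q, ξ_eq, hP, hQ, near_V⟩ := exists_polar_factorization hξ
  obtain ⟨W, hW, R, Z, η_eq, hR, hZ, near_W⟩ := exists_polar_factorization hη
  have intertwine := sum_hsSq_intertwine_le hu hz hP hQ hR hZ hκ (by
    rw [← ξ_eq, ← η_eq]; exact near_max.le)
  obtain ⟨c, hc⟩ := hgap.exists_le (by positivity)
    ((Finset.sum_le_univ_sum_of_nonneg fun j => hsSq_nonneg _).trans intertwine)
  refine ⟨ξ, η, hξ, hη, near_max, V, hV, W, hW, ?_, ?_⟩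
  · linarith [near_V c, hsSq_nonneg (R * Rᴴ - c • 1)]
  · linarith [near_W c, hsSq_nonneg (P * Pᴴ - c • 1)]

theorem norm_tensorConj_le_of_unitary (hu : ∀ j, u j ∈ unitaryGroup p ℂ)
    (hz : ‖tensorConj z z‖ ≤ n) : ‖tensorConj u z‖ ≤ n := by
  have hu' : ‖tensorConj u u‖ ≤ n :=
    norm_tensorConj_self_le fun j => norm_le_one_of_mem_unitaryGroup (hu j)
  calc ‖tensorConj u z‖ ≤ √‖tensorConj u u‖ * √‖tensorConj z z‖ := norm_tensorConj_le u z
    _ ≤ √n * √n := by gcongr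
    _ = n := Real.mul_self_sqrt (Nat.cast_nonneg n)

theorem exists_unitary_le_sum_re_hsInner [Nonempty p]
    (hgap : HasIntertwiningGapOn u J (L ^ 2 / (8 * n))) (hL : 0 ≤ L)
    (hu : ∀ j, u j ∈ unitaryGroup p ℂ) (hz : ‖tensorConj z z‖ ≤ n) (hκ : 0 ≤ κ) (hκ1 : κ ≤ 1)
    (huz : (1 - κ ^ 2) * n < ‖tensorConj u z‖) :
    ∃ W ∈ unitaryGroup p ℂ, ∃ V ∈ unitaryGroup p ℂ,
      (1 - (2 * L + 1) * κ) * (n * Fintype.card p) ≤ ∑ j, (hsInner (u j) (W * z j * Vᴴ)).re := by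
  have hκ2 : κ ^ 2 ≤ κ := by nlinarith
  obtain ⟨ξ, η, -, hη, near_max, V, hV, W, hW, near_V, near_W⟩ :=
    exists_unitary_near_maximizer hgap hu hz (hκ2.trans hκ1) huz
  have card_pos : (0 : ℝ) < Fintype.card p := Nat.cast_pos.mpr Fintype.card_pos
  set r : ℝ := (√(Fintype.card p))⁻¹ with hr
  have r_sq : r ^ 2 = (Fintype.card p : ℝ)⁻¹ := by rw [hr, inv_pow, Real.sq_sqrt card_pos.le]
  have hrV : hsSq ((r : ℂ) • V) = 1 := by
    rw [hsSq_smul, hsSq_of_mem_unitaryGroup hV, Complex.norm_real, Real.norm_eq_abs, sq_abs, r_sq,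
      inv_mul_cancel₀ card_pos.ne']
  have sqrt_V : √(hsSq (ξ - (r : ℂ) • V)) ≤ L * κ := Real.sqrt_le_iff.mpr ⟨by positivity, near_V⟩
  have sqrt_W : √(hsSq (η - (r : ℂ) • W)) ≤ L * κ := Real.sqrt_le_iff.mpr ⟨by positivity, near_W⟩
  have perturb := re_hsInner_tensorAct_le u z ξ ((r : ℂ) • V) η ((r : ℂ) • W)
  rw [hη, hrV, Real.sqrt_one, mul_one, one_mul] at perturb
  have error_le : ‖tensorConj u z‖ * (√(hsSq (ξ - (r : ℂ) • V)) + √(hsSq (η - (r : ℂ) • W))) ≤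
      n * (L * κ + L * κ) := by
    gcongr
    exact norm_tensorConj_le_of_unitary hu hz
  have move (j : Fin n) : hsInner (u j * V * (z j)ᴴ) W = hsInner (u j) (W * z j * Vᴴ) := by
    simp only [hsInner_eq_trace, conjTranspose_mul, conjTranspose_conjTranspose, Matrix.mul_assoc]
  refine ⟨W, hW, V, hV, ?_⟩
  have inner_eq : (hsInner (tensorAct u z ((r : ℂ) • V)) ((r : ℂ) • W)).re =
      (Fintype.card p : ℝ)⁻¹ * ∑ j, (hsInner (u j) (W * z j * Vᴴ)).re := by
    rw [tensorAct_smul, hsInner_smul_left, hsInner_smul_right, Complex.conj_ofReal, ← mul_assoc,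
      ← Complex.ofReal_mul, Complex.re_ofReal_mul, ← sq, r_sq, hsInner_tensorAct, Complex.re_sum]
    simp only [move]
  have lower : (1 - (2 * L + 1) * κ) * n ≤
      (Fintype.card p : ℝ)⁻¹ * ∑ j, (hsInner (u j) (W * z j * Vᴴ)).re := by
    rw [← inner_eq]
    nlinarith [(Nat.cast_nonneg n : (0 : ℝ) ≤ n)]
  rwa [← div_eq_inv_mul, le_div_iff₀ card_pos, mul_assoc] at lower

theorem exists_unitary_close [Nonempty p]
    (hgap : HasIntertwiningGapOn u J (L ^ 2 / (8 * n))) (hL : 0 ≤ L)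
    (hu : ∀ j, u j ∈ unitaryGroup p ℂ) (hz : ‖tensorConj z z‖ ≤ n) (hκ : 0 ≤ κ) (hκ1 : κ ≤ 1)
    (huz : (1 - κ ^ 2) * n < ‖tensorConj u z‖) :
    ∃ W ∈ unitaryGroup p ℂ, ∃ V ∈ unitaryGroup p ℂ,
      ∑ j, hsSq (u j - W * z j * Vᴴ) ≤ 2 * (2 * L + 1) * κ * (n * Fintype.card p) := by
  obtain ⟨W, hW, V, hV, inner_ge⟩ := exists_unitary_le_sum_re_hsInner hgap hL hu hz hκ hκ1 huz
  refine ⟨W, hW, V, hV, ?_⟩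
  have z_le : ∑ j, hsSq (z j) ≤ n * Fintype.card p :=
    (sum_hsSq_le z).trans (mul_le_mul_of_nonneg_right hz (Nat.cast_nonneg _))
  simp only [hsSq_sub, hsSq_of_mem_unitaryGroup (hu _),
    hsSq_mul_unitary (conjTranspose_mem_unitaryGroup hV), hsSq_unitary_mul hW]
  rw [Finset.sum_sub_distrib, Finset.sum_add_distrib, ← Finset.mul_sum, Finset.sum_const,
    Finset.card_univ, Fintype.card_fin, nsmul_eq_mul]
  linarith

theorem norm_sq_mul_hsSq_sub_le {U V g h : Matrix p p ℂ} (hU : U ∈ unitaryGroup p ℂ)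
    (hV : V ∈ unitaryGroup p ℂ) (hg : g ∈ unitaryGroup p ℂ) (c : ℂ) :
    ‖c‖ ^ 2 * hsSq (U - V) ≤
      4 * (hsSq (h - c • 1) + hsSq (gᴴ - c • 1)) + 4 * hsSq (g * U * h - V) := by
  have hg' := conjTranspose_mem_unitaryGroup hg
  have first := hsSq_sub_le (c • U) (U * h) (c • V)
  have second := hsSq_sub_le (U * h) (gᴴ * V) (c • V)
  have U_term : hsSq (c • U - U * h) = hsSq (h - c • 1) := by
    rw [hsSq_sub_comm, ← hsSq_unitary_mul hU (h - c • 1), Matrix.mul_sub, Matrix.mul_smul,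
      Matrix.mul_one]
  have middle_term : hsSq (U * h - gᴴ * V) = hsSq (g * U * h - V) := by
    rw [← hsSq_unitary_mul hg' (g * U * h - V), Matrix.mul_sub, Matrix.mul_assoc g,
      ← Matrix.mul_assoc gᴴ, conjTranspose_mul_self_of_mem_unitaryGroup hg, Matrix.one_mul]
  have V_term : hsSq (gᴴ * V - c • V) = hsSq (gᴴ - c • 1) := by
    rw [← hsSq_mul_unitary hV (gᴴ - c • 1), Matrix.sub_mul, Matrix.smul_mul, Matrix.one_mul]
  rw [U_term] at first
  rw [middle_term, V_term] at second
  rw [← hsSq_smul, smul_sub]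
  linarith [hsSq_nonneg (h - c • 1)]

theorem sum_hsSq_sub_le_of_conj [Nonempty p]
    (hgap : HasIntertwiningGapOn u J (L ^ 2 / (8 * n))) (huv : ∀ j ∈ J, u j = v j)
    (hu : ∀ j, u j ∈ unitaryGroup p ℂ) (hv : ∀ j, v j ∈ unitaryGroup p ℂ) {g h : Matrix p p ℂ}
    (hg : g ∈ unitaryGroup p ℂ) (hh : h ∈ unitaryGroup p ℂ) (hδ : 0 ≤ δ) (hLδ : L ^ 2 * δ ≤ 2)
    (hclose : ∑ j, hsSq (g * u j * h - v j) ≤ δ * (n * Fintype.card p)) :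
    ∑ j, hsSq (u j - v j) ≤ (2 * L ^ 2 + 16) * δ * (n * Fintype.card p) := by
  have card_pos : (0 : ℝ) < Fintype.card p := Nat.cast_pos.mpr Fintype.card_pos
  have intertwine : ∑ j ∈ J, hsSq (u j * h - gᴴ * u j) ≤ δ * Fintype.card p * n := by
    have term_eq : ∀ j ∈ J, hsSq (u j * h - gᴴ * u j) = hsSq (g * u j * h - v j) := by
      intro j hj
      rw [← huv j hj, ← hsSq_unitary_mul hg (u j * h - gᴴ * u j), Matrix.mul_sub,
        ← Matrix.mul_assoc, ← Matrix.mul_assoc, mul_conjTranspose_self_of_mem_unitaryGroup hg,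
        Matrix.one_mul]
    rw [Finset.sum_congr rfl term_eq]
    refine (Finset.sum_le_univ_sum_of_nonneg fun j => hsSq_nonneg _).trans ?_
    linarith
  obtain ⟨c, hc⟩ := hgap.exists_le (by positivity) intertwine
  have c_sq_ge : 1 / 4 ≤ ‖c‖ ^ 2 := by
    have := hsSq_add_le (h - c • 1) (c • 1)
    rw [sub_add_cancel, hsSq_of_mem_unitaryGroup hh, hsSq_smul, hsSq_one] at this
    refine le_of_mul_le_mul_right ?_ card_pos
    nlinarith [hsSq_nonneg (gᴴ - c • 1)]
  have sum_le : ‖c‖ ^ 2 * ∑ j, hsSq (u j - v j) ≤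
      n * (4 * (L ^ 2 / 8 * (δ * Fintype.card p))) + 4 * (δ * (n * Fintype.card p)) := by
    calc ‖c‖ ^ 2 * ∑ j, hsSq (u j - v j)
        ≤ ∑ j, (4 * (L ^ 2 / 8 * (δ * Fintype.card p)) + 4 * hsSq (g * u j * h - v j)) := by
          rw [Finset.mul_sum]
          gcongr with j
          exact (norm_sq_mul_hsSq_sub_le (hu j) (hv j) hg c).trans (by gcongr)
      _ ≤ _ := by
          rw [Finset.sum_add_distrib, Finset.sum_const, Finset.card_univ, Fintype.card_fin,
            nsmul_eq_mul, ← Finset.mul_sum]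
          linarith
  have := mul_le_mul_of_nonneg_right c_sq_ge
    (Finset.sum_nonneg fun j _ => hsSq_nonneg (u j - v j) : 0 ≤ ∑ j, hsSq (u j - v j))
  linarith

theorem sum_hsSq_sub_le_of_common [Nonempty p]
    (hgap : HasIntertwiningGapOn u J (L ^ 2 / (8 * n))) (hL : 0 ≤ L) (huv : ∀ j ∈ J, u j = v j)
    (hu : ∀ j, u j ∈ unitaryGroup p ℂ) (hv : ∀ j, v j ∈ unitaryGroup p ℂ)
    (hz : ‖tensorConj z z‖ ≤ n) (hκ : 0 ≤ κ) (hκ1 : κ ≤ 1)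
    (hLκ : 4 * L ^ 2 * (2 * L + 1) * κ ≤ 1) (huz : (1 - κ ^ 2) * n < ‖tensorConj u z‖)
    (hvz : (1 - κ ^ 2) * n < ‖tensorConj v z‖) :
    ∑ j, hsSq (u j - v j) ≤
      (2 * L ^ 2 + 16) * (8 * (2 * L + 1) * κ) * (n * Fintype.card p) := by
  have hgap_v : HasIntertwiningGapOn v J (L ^ 2 / (8 * n)) := fun A B => by
    obtain ⟨c, hc⟩ := hgap A B
    exact ⟨c, hc.trans_eq (by rw [Finset.sum_congr rfl fun j hj => by rw [huv j hj]])⟩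
  obtain ⟨W, hW, V, hV, u_close⟩ := exists_unitary_close hgap hL hu hz hκ hκ1 huz
  obtain ⟨W', hW', V', hV', v_close⟩ := exists_unitary_close hgap_v hL hv hz hκ hκ1 hvz
  have hg : W' * Wᴴ ∈ unitaryGroup p ℂ := mul_mem hW' (conjTranspose_mem_unitaryGroup hW)
  have hh : V * V'ᴴ ∈ unitaryGroup p ℂ := mul_mem hV (conjTranspose_mem_unitaryGroup hV')
  refine sum_hsSq_sub_le_of_conj hgap huv hu hv hg hh (by positivity) (by linarith) ?_
  have term_le (j : Fin n) : hsSq (W' * Wᴴ * u j * (V * V'ᴴ) - v j) ≤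
      2 * hsSq (u j - W * z j * Vᴴ) + 2 * hsSq (v j - W' * z j * V'ᴴ) := by
    have := hsSq_sub_le (W' * Wᴴ * u j * (V * V'ᴴ)) (W' * z j * V'ᴴ) (v j)
    have factor : W' * Wᴴ * u j * (V * V'ᴴ) - W' * z j * V'ᴴ =
        W' * Wᴴ * (u j - W * z j * Vᴴ) * (V * V'ᴴ) := by
      have cancel : W' * Wᴴ * (W * z j * Vᴴ) * (V * V'ᴴ) =
          W' * (Wᴴ * W) * z j * (Vᴴ * V) * V'ᴴ := by
        simp only [Matrix.mul_assoc]
      rw [Matrix.mul_sub, Matrix.sub_mul, cancel, conjTranspose_mul_self_of_mem_unitaryGroup hW,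
        conjTranspose_mul_self_of_mem_unitaryGroup hV, Matrix.mul_one, Matrix.mul_one]
    rwa [factor, hsSq_mul_unitary hh, hsSq_unitary_mul hg,
      hsSq_sub_comm (W' * z j * V'ᴴ) (v j)] at this
  refine (Finset.sum_le_sum fun j _ => term_le j).trans ?_
  rw [Finset.sum_add_distrib, ← Finset.mul_sum, ← Finset.mul_sum]
  linarith

end Rigidity

section Separation

variable {p ι κ μ ρ : Type*}

/-- The tuple obtained from `t` by adjoining `μ` copies of each of the matrices `w k`; the
equivalence `e` arranges all of them into one tuple indexed by `ι`. -/
def pad (e : ι ≃ (κ × μ) ⊕ ρ) (w : κ → Matrix p p ℂ) (t : ρ → Matrix p p ℂ) : ι → Matrix p p ℂ :=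
  fun j => Sum.elim (fun k => w k.1) t (e j)

/-- The positions at which `pad e w t` holds one of the matrices `w k`. -/
def padIndices [Fintype κ] [Fintype μ] (e : ι ≃ (κ × μ) ⊕ ρ) : Finset ι :=
  Finset.univ.map (Function.Embedding.inl.trans e.symm.toEmbedding)

section Pad

variable (e : ι ≃ (κ × μ) ⊕ ρ) (w : κ → Matrix p p ℂ)

theorem pad_symm_inl (t : ρ → Matrix p p ℂ) (k : κ × μ) :
    pad e w t (e.symm (Sum.inl k)) = w k.1 := by
  rw [pad, e.apply_symm_apply, Sum.elim_inl]

theorem pad_symm_inr (t : ρ → Matrix p p ℂ) (i : ρ) : pad e w t (e.symm (Sum.inr i)) = t i := by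
  rw [pad, e.apply_symm_apply, Sum.elim_inr]

theorem pad_injective : Function.Injective (pad e w) := fun t t' h => by
  ext1 i
  rw [← pad_symm_inr e w t, ← pad_symm_inr e w t', h]

theorem pad_eq_pad_of_mem_padIndices [Fintype κ] [Fintype μ]
    (t t' : ρ → Matrix p p ℂ) {j : ι} (hj : j ∈ padIndices e) :
    pad e w t j = pad e w t' j := by
  obtain ⟨k, -, rfl⟩ := Finset.mem_map.mp hj
  exact (pad_symm_inl e w t k).trans (pad_symm_inl e w t' k).symm

variable [Fintype p]

theorem sum_hsSq_le_sum_hsSq_pad [Fintype ι] [Fintype ρ] (t t' : ρ → Matrix p p ℂ) :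
    ∑ i, hsSq (t i - t' i) ≤ ∑ j, hsSq (pad e w t j - pad e w t' j) := by
  let freeIndex : ρ ↪ ι := Function.Embedding.inr.trans e.symm.toEmbedding
  calc ∑ i, hsSq (t i - t' i)
      = ∑ j ∈ Finset.univ.map freeIndex, hsSq (pad e w t j - pad e w t' j) := by
        rw [Finset.sum_map]
        exact Finset.sum_congr rfl fun i _ =>
          congrArg hsSq (congrArg₂ _ (pad_symm_inr ..) (pad_symm_inr ..)).symm
    _ ≤ _ := Finset.sum_le_univ_sum_of_nonneg fun j => hsSq_nonneg _

variable [DecidableEq p]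

theorem hasIntertwiningGapOn_pad [Fintype κ] [Fintype μ] [Nonempty μ] {γ : ℝ}
    (hgap : HasIntertwiningGapOn w Finset.univ γ) (t : ρ → Matrix p p ℂ) :
    HasIntertwiningGapOn (pad e w t) (padIndices e) (γ / Fintype.card μ) := fun A B => by
  obtain ⟨c, hc⟩ := hgap A B
  refine ⟨c, hc.trans_eq ?_⟩
  have card_ne_zero : (Fintype.card μ : ℝ) ≠ 0 := Nat.cast_ne_zero.mpr Fintype.card_ne_zero
  have sum_eq : ∑ j ∈ padIndices e, hsSq (pad e w t j * A - B * pad e w t j) =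
      Fintype.card μ * ∑ k, hsSq (w k * A - B * w k) := by
    simp only [padIndices, Finset.sum_map, Function.Embedding.trans_apply,
      Function.Embedding.inl_apply, Equiv.coe_toEmbedding, pad_symm_inl, Fintype.sum_prod_type,
      Finset.sum_const, Finset.card_univ, nsmul_eq_mul, Finset.mul_sum]
  rw [sum_eq, div_mul_eq_mul_div, mul_left_comm, mul_div_cancel_left₀ _ card_ne_zero]

variable {w}

theorem pad_mem_unitaryGroup {t : ρ → Matrix p p ℂ} (hw : ∀ k, w k ∈ unitaryGroup p ℂ)
    (ht : ∀ i, t i ∈ unitaryGroup p ℂ) (j : ι) : pad e w t j ∈ unitaryGroup p ℂ := by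
  unfold pad
  rcases e j with k | i
  · exact hw k.1
  · exact ht i

end Pad

variable [Fintype p] [DecidableEq p]

theorem HasIntertwiningGapOn.mono {u : ι → Matrix p p ℂ} {J : Finset ι} {γ γ' : ℝ}
    (h : HasIntertwiningGapOn u J γ) (hγ : γ ≤ γ') : HasIntertwiningGapOn u J γ' := fun A B => by
  obtain ⟨c, hc⟩ := h A B
  exact ⟨c, hc.trans (mul_le_mul_of_nonneg_right hγ (Finset.sum_nonneg fun j _ => hsSq_nonneg _))⟩

theorem HasSpectralGap.hasIntertwiningGapOn_option_elim [Fintype κ] {w : κ → Matrix p p ℂ} {γ : ℝ}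
    (hγ : 0 ≤ γ) (hw : ∀ k, w k ∈ unitaryGroup p ℂ) (hgap : HasSpectralGap w γ) :
    HasIntertwiningGapOn (fun k : Option κ => k.elim 1 w) Finset.univ
      (2 + 6 * (Fintype.card κ + 1) * γ) := fun A B => by
  obtain ⟨c, hc⟩ := hgap A
  refine ⟨c, ?_⟩
  set b := ∑ k, hsSq (w k * A - B * w k) with hb
  have b_nonneg : 0 ≤ b := Finset.sum_nonneg fun k _ => hsSq_nonneg _
  have AB_nonneg := hsSq_nonneg (A - B)
  have commutator_le (k : κ) : hsSq (w k * A - A * w k) ≤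
      2 * hsSq (w k * A - B * w k) + 2 * hsSq (A - B) := by
    have := hsSq_sub_le (w k * A) (B * w k) (A * w k)
    rwa [← Matrix.sub_mul, hsSq_mul_unitary (hw k), hsSq_sub_comm B A] at this
  have A_le : hsSq (A - c • 1) ≤ γ * (2 * b + Fintype.card κ * (2 * hsSq (A - B))) := by
    refine hc.trans (mul_le_mul_of_nonneg_left ?_ hγ)
    refine (Finset.sum_le_sum fun k _ => commutator_le k).trans_eq ?_
    rw [Finset.sum_add_distrib, ← Finset.mul_sum, Finset.sum_const, Finset.card_univ, nsmul_eq_mul]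
  have B_le := hsSq_sub_le B A (c • 1)
  rw [hsSq_sub_comm B A] at B_le
  rw [Fintype.sum_option]
  simp only [Option.elim_none, Option.elim_some, Matrix.one_mul, Matrix.mul_one, ← hb]
  have card_nonneg : (0 : ℝ) ≤ Fintype.card κ := Nat.cast_nonneg _
  nlinarith [mul_nonneg hγ b_nonneg, mul_nonneg hγ AB_nonneg,
    mul_nonneg (mul_nonneg card_nonneg hγ) b_nonneg]

theorem exists_intertwining_padding (p : Type*) [Fintype p] [DecidableEq p] [Nonempty p]
    {n : ℕ} (hn : 5 ≤ n) :
    ∃ (e : Fin n ≃ (Option (Fin 3) × Fin (n / 5)) ⊕ Fin (n - 4 * (n / 5)))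
      (w : Option (Fin 3) → Matrix p p ℂ), (∀ k, w k ∈ unitaryGroup p ℂ) ∧
      ∀ t, HasIntertwiningGapOn (pad e w t) (padIndices e) (1080 ^ 2 / (8 * n)) := by
  obtain ⟨w, hw, hgap⟩ := exists_unitary_hasSpectralGap p
  have e : Fin n ≃ (Option (Fin 3) × Fin (n / 5)) ⊕ Fin (n - 4 * (n / 5)) :=
    Fintype.equivOfCardEq (by simp; omega)
  have : Nonempty (Fin (n / 5)) := ⟨⟨0, by omega⟩⟩
  refine ⟨e, fun k => k.elim 1 w, ?_, fun t => ?_⟩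
  · rintro (_ | k)
    exacts [one_mem _, hw k]
  · have hgap' := hgap.hasIntertwiningGapOn_option_elim (by norm_num) hw
    refine (hasIntertwiningGapOn_pad e _ hgap' t).mono ?_
    have n_le : (n : ℝ) ≤ 10 * (n / 5 : ℕ) := by exact_mod_cast (by omega : n ≤ 10 * (n / 5))
    have n_pos : (0 : ℝ) < n := by exact_mod_cast (by omega : 0 < n)
    rw [Fintype.card_fin, Fintype.card_fin, div_le_div_iff₀ (by linarith) (by positivity)]
    norm_num
    linarith

theorem exists_separated_tuples (p : Type*) [Fintype p] [DecidableEq p] [Nonempty p]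
    {n : ℕ} (hn : 5 ≤ n) :
    ∃ T : Finset (Fin n → Matrix p p ℂ), (∀ u ∈ T, ∀ j, u j ∈ unitaryGroup p ℂ) ∧
      (T : Set (Fin n → Matrix p p ℂ)).Pairwise (fun u v => ∀ z : Fin n → Matrix p p ℂ,
        ‖tensorConj z z‖ ≤ n → (1 - 1 / 10 ^ 24) * n < ‖tensorConj u z‖ →
        ‖tensorConj v z‖ ≤ (1 - 1 / 10 ^ 24) * n) ∧
      Real.exp (1 / 250 * n * (Fintype.card p : ℝ) ^ 2) ≤ T.card := by
  obtain ⟨e, w, hw, hgap⟩ := exists_intertwining_padding p hn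
  obtain ⟨T, hT, separated, card_ge⟩ := exists_packing (Fin (n - 4 * (n / 5))) p
  have n_le : (n : ℝ) ≤ 5 * Fintype.card (Fin (n - 4 * (n / 5))) := by
    rw [Fintype.card_fin]
    exact_mod_cast (by omega : n ≤ 5 * (n - 4 * (n / 5)))
  have n_pos : (0 : ℝ) < n := by exact_mod_cast (by omega : 0 < n)
  have card_pos : (0 : ℝ) < Fintype.card p := Nat.cast_pos.mpr Fintype.card_pos
  refine ⟨T.map ⟨pad e w, pad_injective e w⟩, ?_, ?_, ?_⟩
  · intro u hu
    obtain ⟨t, ht, rfl⟩ := Finset.mem_map.mp hu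
    exact pad_mem_unitaryGroup e hw (hT t ht)
  · rw [Finset.coe_map]
    rintro _ ⟨t, ht, rfl⟩ _ ⟨t', ht', rfl⟩ hne z hz huz
    by_contra! hvz
    have close := sum_hsSq_sub_le_of_common (κ := 1 / 10 ^ 12) (hgap t) (by norm_num)
      (fun j hj => pad_eq_pad_of_mem_padIndices e w t t' hj) (pad_mem_unitaryGroup e hw (hT t ht))
      (pad_mem_unitaryGroup e hw (hT t' ht')) hz (by norm_num) (by norm_num) (by norm_num)
      (by norm_num at huz ⊢; exact huz) (by norm_num at hvz ⊢; exact hvz)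
    have far := separated ht ht' fun h => hne (by rw [h])
    have far_le := sum_hsSq_le_sum_hsSq_pad e w t t'
    nlinarith [mul_le_mul_of_nonneg_right n_le card_pos.le, mul_pos n_pos card_pos]
  · rw [Finset.card_map]
    refine (Real.exp_le_exp.mpr ?_).trans card_ge
    have := mul_le_mul_of_nonneg_right n_le (sq_nonneg (Fintype.card p : ℝ))
    linarith

end Separation

section Multiplicity

variable {E F : Type*} [AddCommGroup E] [Module ℂ E] [AddCommGroup F] [Module ℂ F]
  {S : OperatorSpace E} {T : OperatorSpace F} {n k N : ℕ}

theorem amplify_injective {f : E →ₗ[ℂ] F} (hf : Function.Injective f) :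
    Function.Injective (amplify f N) :=
  Matrix.map_injective hf

theorem norm_amplify_le_of_amplifyNorm {f : E →ₗ[ℂ] F} (h : amplifyNorm S T f N ≠ ⊤)
    (x : Matrix (Fin N) (Fin N) E) :
    T.norm N (amplify f N x) ≤ (amplifyNorm S T f N).toReal * S.norm N x := by
  rcases (S.norm_nonneg N x).eq_or_lt with norm_eq | norm_pos
  · have amplify_eq : amplify f N x = 0 := by
      rw [S.eq_zero_of_norm N x norm_eq.symm]
      exact Matrix.map_zero _ (map_zero f)
    rw [amplify_eq, T.norm_zero, ← norm_eq, mul_zero]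
  · set c : ℂ := (((S.norm N x)⁻¹ : ℝ) : ℂ) with hc
    have norm_c : ‖c‖ = (S.norm N x)⁻¹ := by
      rw [hc, Complex.norm_real, Real.norm_of_nonneg (by positivity)]
    have norm_le_one : S.norm N (c • x) ≤ 1 := by
      rw [S.smul_eq, norm_c, inv_mul_cancel₀ norm_pos.ne']
    have le_amplifyNorm : ENNReal.ofReal (T.norm N (amplify f N (c • x))) ≤ amplifyNorm S T f N :=
      le_iSup₂ (f := fun (x : Matrix (Fin N) (Fin N) E) (_ : S.norm N x ≤ 1) =>
        ENNReal.ofReal (T.norm N (amplify f N x))) (c • x) norm_le_one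
    rwa [ENNReal.ofReal_le_iff_le_toReal h, amplify_smul, T.smul_eq, norm_c,
      inv_mul_le_iff₀ norm_pos, mul_comm] at le_amplifyNorm

theorem amplifyNorm_ne_zero {f : E →ₗ[ℂ] F} (hf : Function.Injective f)
    {x : Matrix (Fin N) (Fin N) E} (hx : x ≠ 0) : amplifyNorm S T f N ≠ 0 := fun h => by
  have := norm_amplify_le_of_amplifyNorm (h ▸ ENNReal.zero_ne_top) x
  rw [h, ENNReal.toReal_zero, zero_mul] at this
  refine hx (amplify_injective hf ?_)
  rw [T.eq_zero_of_norm N _ (this.antisymm (T.norm_nonneg _ _))]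
  exact (Matrix.map_zero _ (map_zero f)).symm

theorem exists_equiv_of_matrixDist_lt {C : ℝ} (h : matrixDist S T N < ENNReal.ofReal C)
    {x₀ : Matrix (Fin N) (Fin N) E} (hx₀ : x₀ ≠ 0) :
    ∃ (f : E ≃ₗ[ℂ] F) (a b : ℝ), 0 < a ∧ 0 ≤ b ∧ a * b < C ∧
      (∀ x, T.norm N (amplify f.toLinearMap N x) ≤ a * S.norm N x) ∧
      ∀ x, S.norm N x ≤ b * T.norm N (amplify f.toLinearMap N x) := by
  obtain ⟨f, hf⟩ := iInf_lt_iff.mp h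
  have symm_amplify (x : Matrix (Fin N) (Fin N) E) :
      amplify f.symm.toLinearMap N (amplify f.toLinearMap N x) = x := by
    ext i j
    exact f.symm_apply_apply (x i j)
  set a := amplifyNorm S T f.toLinearMap N
  set b := amplifyNorm T S f.symm.toLinearMap N
  have a_ne_zero : a ≠ 0 := amplifyNorm_ne_zero f.injective hx₀
  have b_ne_zero : b ≠ 0 := by
    refine amplifyNorm_ne_zero (x := amplify f.toLinearMap N x₀) f.symm.injective fun h => hx₀ ?_
    rw [← symm_amplify x₀, h]
    exact Matrix.map_zero _ (map_zero f.symm)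
  obtain ⟨a_lt_top, b_lt_top⟩ : a < ⊤ ∧ b < ⊤ := by
    simpa only [ENNReal.mul_lt_top_iff, a_ne_zero, b_ne_zero, or_false] using
      hf.trans ENNReal.ofReal_lt_top
  refine ⟨f, a.toReal, b.toReal, ENNReal.toReal_pos a_ne_zero a_lt_top.ne,
    ENNReal.toReal_nonneg, ?_, norm_amplify_le_of_amplifyNorm a_lt_top.ne, fun x => ?_⟩
  · rw [← ENNReal.toReal_mul]
    exact (ENNReal.lt_ofReal_iff_toReal_lt (ENNReal.mul_lt_top a_lt_top b_lt_top).ne).mp hf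
  · have := norm_amplify_le_of_amplifyNorm b_lt_top.ne (amplify f.toLinearMap N x)
    rwa [symm_amplify] at this

theorem norm_proj_le_directSum (x : Matrix (Fin N) (Fin N) (Fin k → Matrix (Fin N) (Fin N) ℂ))
    (i : Fin k) : (matrixSpace (Fin N) (Fin N)).norm N (amplify (LinearMap.proj i) N x) ≤
      (directSum k N).norm N x :=
  MatrixSeminorm.le_sup (fun i : Fin k =>
    (matrixSpace (Fin N) (Fin N)).toMatrixSeminorm.pullback (LinearMap.proj i))
    (fun _ _ => Set.finite_range _ |>.bddAbove) i N x

theorem exists_directSum_le_norm_proj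
    {x : Matrix (Fin N) (Fin N) (Fin k → Matrix (Fin N) (Fin N) ℂ)}
    (hx : 0 < (directSum k N).norm N x) :
    ∃ i, (directSum k N).norm N x ≤
      (matrixSpace (Fin N) (Fin N)).norm N (amplify (LinearMap.proj i) N x) := by
  have norm_eq : (directSum k N).norm N x =
    ⨆ i, (matrixSpace (Fin N) (Fin N)).norm N (amplify (LinearMap.proj i) N x) := rfl
  rcases isEmpty_or_nonempty (Fin k) with _ | _
  · rw [norm_eq, Real.iSup_of_isEmpty] at hx
    exact absurd hx (lt_irrefl 0)
  · obtain ⟨i, hi⟩ := exists_eq_ciSup_of_finite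
      (f := fun i => (matrixSpace (Fin N) (Fin N)).norm N (amplify (LinearMap.proj i) N x))
    exact ⟨i, norm_eq.trans_le hi.ge⟩

theorem exists_norming_maps {V : Submodule ℂ (Fin k → Matrix (Fin N) (Fin N) ℂ)} {C : ℝ}
    (hV : matrixDist S ((directSum k N).restrict V) N < ENNReal.ofReal C)
    {x₀ : Matrix (Fin N) (Fin N) E} (hx₀ : x₀ ≠ 0) :
    ∃ w : Fin k → E →ₗ[ℂ] Matrix (Fin N) (Fin N) ℂ,
      (∀ i x, (matrixSpace (Fin N) (Fin N)).norm N (amplify (w i) N x) ≤ S.norm N x) ∧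
      ∀ x, 0 < S.norm N x → ∃ i, S.norm N x <
        C * (matrixSpace (Fin N) (Fin N)).norm N (amplify (w i) N x) := by
  obtain ⟨f, a, b, a_pos, b_nonneg, ab_lt, f_le, le_f⟩ := exists_equiv_of_matrixDist_lt hV hx₀
  let w (i : Fin k) : E →ₗ[ℂ] Matrix (Fin N) (Fin N) ℂ :=
    ((a⁻¹ : ℝ) : ℂ) • (LinearMap.proj i ∘ₗ V.subtype ∘ₗ f.toLinearMap)
  have norm_amplify_w (i : Fin k) (x : Matrix (Fin N) (Fin N) E) :
      (matrixSpace (Fin N) (Fin N)).norm N (amplify (w i) N x) =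
        a⁻¹ * (matrixSpace (Fin N) (Fin N)).norm N (amplify (LinearMap.proj i) N
          (amplify V.subtype N (amplify f.toLinearMap N x))) := by
    rw [← abs_of_nonneg (inv_nonneg.mpr a_pos.le), ← Real.norm_eq_abs, ← Complex.norm_real,
      ← (matrixSpace (Fin N) (Fin N)).smul_eq]
    rfl
  refine ⟨w, fun i x => ?_, fun x hx => ?_⟩
  · rw [norm_amplify_w, inv_mul_le_iff₀ a_pos]
    exact (norm_proj_le_directSum _ i).trans (f_le x)
  · have image_pos : 0 < (directSum k N).norm N (amplify V.subtype N (amplify f.toLinearMap N x)) :=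
      pos_of_mul_pos_right (hx.trans_le (le_f x)) b_nonneg
    obtain ⟨i, hi⟩ := exists_directSum_le_norm_proj image_pos
    refine ⟨i, ?_⟩
    rw [norm_amplify_w, ← mul_assoc]
    refine ((le_f x).trans (mul_le_mul_of_nonneg_left hi b_nonneg)).trans_lt
      (mul_lt_mul_of_pos_right ?_ (image_pos.trans_le hi))
    rwa [← div_eq_mul_inv, lt_div_iff₀ a_pos, mul_comm]

/-- The element `∑ x_j ⊗ e_j` of `M_N(E)`. -/
def tupleElement (e : Fin n → E) (x : Fin n → Matrix (Fin N) (Fin N) ℂ) :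
    Matrix (Fin N) (Fin N) E :=
  Matrix.of fun a b => ∑ j, x j a b • e j

/-- The tuple of the complex conjugates of the values of a linear map at the vectors `e_j`. The
conjugation makes up for the one in `tensorConj`. -/
def conjTuple {p : Type*} (e : Fin n → E) (w : E →ₗ[ℂ] Matrix p p ℂ) : Fin n → Matrix p p ℂ :=
  fun j => (w (e j)).map (starRingEnd ℂ)

theorem norm_amplify_tupleElement {p : Type*} [Fintype p] [DecidableEq p] (e : Fin n → E)
    (w : E →ₗ[ℂ] Matrix p p ℂ) (x : Fin n → Matrix (Fin N) (Fin N) ℂ) :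
    (matrixSpace p p).norm N (amplify w N (tupleElement e x)) = ‖tensorConj x (conjTuple e w)‖ := by
  change ‖Matrix.comp (Fin N) (Fin N) p p ℂ (amplify w N (tupleElement e x))‖ = _
  congr 1
  ext ⟨i, a⟩ ⟨j, b⟩
  simp [tensorConj, conjTuple, amplify, tupleElement, Matrix.sum_apply]

/-- In `M_N(E)` the elements `∑ u_j ⊗ e_j` with unitary `u_j` have norm at least `√n β`, while maps
`w : E → M_N` with `‖w_N‖ ≤ 1` satisfy `‖∑ w(e_j) ⊗ conj(w(e_j))‖ ≤ β²`. By Haagerup's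
Cauchy–Schwarz inequality `‖w_N (∑ u_j ⊗ e_j)‖ ≤ √n β` for each such `w`. -/
structure NormsUnitaries (S : OperatorSpace E) (e : Fin n → E) (N : ℕ) (β : ℝ) : Prop where
  pos : 0 < β
  le_norm : ∀ u : Fin n → Matrix (Fin N) (Fin N) ℂ, (∀ j, u j ∈ unitaryGroup (Fin N) ℂ) →
    √n * β ≤ S.norm N (tupleElement e u)
  norm_le : ∀ w : E →ₗ[ℂ] Matrix (Fin N) (Fin N) ℂ,
    (∀ x, (matrixSpace (Fin N) (Fin N)).norm N (amplify w N x) ≤ S.norm N x) →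
    ‖tensorConj (conjTuple e w) (conjTuple e w)‖ ≤ β ^ 2

theorem NormsUnitaries.exists_norming_tuples {e : Fin n → E} {β C : ℝ} [NeZero n]
    (hS : NormsUnitaries S e N β) {V : Submodule ℂ (Fin k → Matrix (Fin N) (Fin N) ℂ)}
    (hV : matrixDist S ((directSum k N).restrict V) N < ENNReal.ofReal C) :
    ∃ z : Fin k → Fin n → Matrix (Fin N) (Fin N) ℂ, (∀ i, ‖tensorConj (z i) (z i)‖ ≤ n) ∧
      ∀ u : Fin n → Matrix (Fin N) (Fin N) ℂ, (∀ j, u j ∈ unitaryGroup (Fin N) ℂ) →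
        ∃ i, n < C * ‖tensorConj u (z i)‖ := by
  have n_pos : (0 : ℝ) < n := Nat.cast_pos.mpr (NeZero.pos n)
  have norm_pos (u : Fin n → Matrix (Fin N) (Fin N) ℂ) (hu : ∀ j, u j ∈ unitaryGroup (Fin N) ℂ) :
      0 < S.norm N (tupleElement e u) :=
    (mul_pos (Real.sqrt_pos.mpr n_pos) hS.pos).trans_le (hS.le_norm u hu)
  have ones_ne_zero : tupleElement e (fun _ => (1 : Matrix (Fin N) (Fin N) ℂ)) ≠ 0 := fun h => by
    have := norm_pos (fun _ => 1) fun _ => one_mem _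
    rw [h, S.norm_zero] at this
    exact lt_irrefl 0 this
  obtain ⟨w, hw, norming⟩ := exists_norming_maps hV ones_ne_zero
  set c : ℝ := √n / β
  have c_pos : 0 < c := div_pos (Real.sqrt_pos.mpr n_pos) hS.pos
  have c_mul_β : c * β = √n := div_mul_cancel₀ _ hS.pos.ne'
  have sqrt_sq : √n * √n = n := Real.mul_self_sqrt n_pos.le
  refine ⟨fun i => (c : ℂ) • conjTuple e (w i), fun i => ?_, fun u hu => ?_⟩
  · rw [tensorConj_smul_smul, norm_smul, Complex.norm_real, Real.norm_of_nonneg (by positivity)]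
    calc c * c * ‖tensorConj (conjTuple e (w i)) (conjTuple e (w i))‖ ≤ c * c * β ^ 2 := by
          gcongr
          exact hS.norm_le (w i) (hw i)
      _ = c * β * (c * β) := by ring
      _ = n := by rw [c_mul_β, sqrt_sq]
  · obtain ⟨i, hi⟩ := norming _ (norm_pos u hu)
    rw [norm_amplify_tupleElement] at hi
    have smul_eq := tensorConj_smul_smul 1 c u (conjTuple e (w i))
    rw [Complex.ofReal_one, one_smul, one_mul] at smul_eq
    refine ⟨i, ?_⟩
    rw [smul_eq, norm_smul, Complex.norm_real, Real.norm_of_nonneg c_pos.le, mul_left_comm]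
    calc (n : ℝ) = c * (√n * β) := by rw [mul_left_comm, c_mul_β, sqrt_sq]
      _ < _ := mul_lt_mul_of_pos_left ((hS.le_norm u hu).trans_lt hi) c_pos

theorem NormsUnitaries.card_le {e : Fin n → E} {β C : ℝ} [NeZero n]
    (hS : NormsUnitaries S e N β) {V : Submodule ℂ (Fin k → Matrix (Fin N) (Fin N) ℂ)}
    (hV : matrixDist S ((directSum k N).restrict V) N < ENNReal.ofReal C)
    {T : Finset (Fin n → Matrix (Fin N) (Fin N) ℂ)}
    (hT : ∀ u ∈ T, ∀ j, u j ∈ unitaryGroup (Fin N) ℂ)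
    (separated : (T : Set (Fin n → Matrix (Fin N) (Fin N) ℂ)).Pairwise
      fun u v => ∀ z : Fin n → Matrix (Fin N) (Fin N) ℂ, ‖tensorConj z z‖ ≤ n →
        n < C * ‖tensorConj u z‖ → C * ‖tensorConj v z‖ ≤ n) :
    T.card ≤ k := by
  obtain ⟨z, hz, norming⟩ := hS.exists_norming_tuples hV
  have coordinate (u : Fin n → Matrix (Fin N) (Fin N) ℂ) (hu : u ∈ T) :
      ∃ i, n < C * ‖tensorConj u (z i)‖ := norming u (hT u hu)
  rcases isEmpty_or_nonempty (Fin k) with _ | _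
  · have : T = ∅ := Finset.eq_empty_of_forall_notMem fun u hu =>
      isEmptyElim (coordinate u hu).choose
    simp [this]
  choose! i hi using coordinate
  refine (Finset.card_le_card_of_injOn i (fun u _ => Finset.mem_univ (i u)) ?_).trans_eq
    (Finset.card_fin k)
  intro u hu v hv huv
  by_contra hne
  exact (hi v hv).not_ge (huv ▸ separated hu hv hne (z (i u)) (hz _) (hi u hu))

theorem NormsUnitaries.exp_le_multiplicity {e : Fin n → E} {β : ℝ} [NeZero N] (hn : 5 ≤ n)
    (hS : NormsUnitaries S e N β) :
    ENNReal.ofReal (Real.exp (1 / 250 * n * (N : ℝ) ^ 2)) ≤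
      (multiplicity S N (1 + 1 / 10 ^ 25) : ENNReal) := by
  obtain ⟨T, hT, separated, card_ge⟩ := exists_separated_tuples (Fin N) hn
  rw [Fintype.card_fin] at card_ge
  have : NeZero n := ⟨by omega⟩
  suffices card_le : (T.card : ℕ∞) ≤ multiplicity S N (1 + 1 / 10 ^ 25) by
    refine (ENNReal.ofReal_le_ofReal card_ge).trans ?_
    rw [ENNReal.ofReal_natCast]
    exact_mod_cast card_le
  refine le_iInf₂ fun k ⟨V, hV⟩ => Nat.cast_le.mpr ?_
  have dist_lt : matrixDist S ((directSum k N).restrict V) N <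
      ENNReal.ofReal (1 - 1 / 10 ^ 24)⁻¹ :=
    hV.trans_lt ((ENNReal.ofReal_lt_ofReal_iff (by norm_num)).mpr (by norm_num))
  refine hS.card_le dist_lt hT (separated.imp fun u v h z hz huz => ?_)
  have ε_pos : (0 : ℝ) < 1 - 1 / 10 ^ 24 := by norm_num
  rw [inv_mul_le_iff₀ ε_pos]
  exact h z hz ((lt_inv_mul_iff₀ ε_pos).mp huz)

end Multiplicity

section RowsAndColumns

variable {ι p q : Type*}

/-- The block row `(x_j)_j`, whose norm is `‖∑ x_j x_jᴴ‖^{1/2}`. -/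
def rowBlock (x : ι → Matrix p q ℂ) : Matrix p (ι × q) ℂ := of fun a c => x c.1 a c.2

/-- The block column `(x_j)_j`, whose norm is `‖∑ x_jᴴ x_j‖^{1/2}`. -/
def colBlock (x : ι → Matrix p q ℂ) : Matrix (ι × p) q ℂ := of fun c b => x c.1 c.2 b

theorem conjTranspose_rowBlock (x : ι → Matrix p q ℂ) :
    (rowBlock x)ᴴ = colBlock fun j => (x j)ᴴ := rfl

theorem conjTranspose_colBlock (x : ι → Matrix p q ℂ) :
    (colBlock x)ᴴ = rowBlock fun j => (x j)ᴴ := rfl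

variable [Fintype ι] [Fintype p] [Fintype q]

theorem sum_norm_colBlock_mulVec_sq (x : ι → Matrix p q ℂ) (v : q → ℂ) :
    ∑ c, ‖(colBlock x).mulVec v c‖ ^ 2 = ∑ j, ∑ t, ‖(x j).mulVec v t‖ ^ 2 :=
  Fintype.sum_prod_type _

variable [DecidableEq q]

theorem norm_colBlock_le (x : ι → Matrix p q ℂ) : ‖colBlock x‖ ≤ √(∑ j, ‖x j‖ ^ 2) := by
  refine opNorm_le_of_sq (Real.sqrt_nonneg _) fun v => ?_
  rw [sum_norm_colBlock_mulVec_sq, Real.sq_sqrt (Finset.sum_nonneg fun _ _ => sq_nonneg _),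
    Finset.sum_mul]
  exact Finset.sum_le_sum fun j _ => sum_norm_mulVec_sq_le (x j) v

variable [DecidableEq ι] [DecidableEq p]

omit [DecidableEq p] in
theorem norm_rowBlock_le (x : ι → Matrix p q ℂ) : ‖rowBlock x‖ ≤ √(∑ j, ‖x j‖ ^ 2) := by
  classical
  rw [← l2_opNorm_conjTranspose, conjTranspose_rowBlock]
  simpa only [l2_opNorm_conjTranspose] using norm_colBlock_le fun j => (x j)ᴴ

variable {n : ℕ}

theorem tensorConj_conjTranspose {p q : Type*} (x : Fin n → Matrix p p ℂ)
    (y : Fin n → Matrix q q ℂ) :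
    tensorConj (fun j => (x j)ᴴ) (fun j => (y j)ᴴ) = (tensorConj x y)ᴴ := by
  rw [tensorConj, tensorConj, conjTranspose_sum]
  refine Finset.sum_congr rfl fun j _ => ?_
  rw [conjTranspose_kronecker]
  rfl

theorem norm_tensorConj_le_rowBlock_mul_colBlock (x : Fin n → Matrix p p ℂ)
    (y : Fin n → Matrix q q ℂ) : ‖tensorConj x y‖ ≤ ‖rowBlock x‖ * ‖colBlock y‖ := by
  have factor : tensorConj x y = (rowBlock x ⊗ₖ (1 : Matrix q q ℂ)) *
      (((1 : Matrix p p ℂ) ⊗ₖ (colBlock y).map (starRingEnd ℂ)).submatrix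
        (((Equiv.prodComm (Fin n) p).prodCongr (Equiv.refl q)).trans (Equiv.prodAssoc p (Fin n) q))
        (Equiv.refl (p × q))) := by
    ext ⟨a, t⟩ ⟨b, s⟩
    simp [tensorConj, rowBlock, colBlock, Matrix.sum_apply, mul_apply, Fintype.sum_prod_type,
      one_apply]
  rw [factor]
  refine (l2_opNorm_mul _ _).trans (mul_le_mul (norm_kronecker_one_le _) ?_
    (norm_nonneg _) (norm_nonneg _))
  exact (norm_submatrix_equiv_le _ _ _).trans
    ((norm_one_kronecker_le _).trans (norm_map_conj_le _))

theorem norm_tensorConj_le_colBlock_mul_rowBlock (x : Fin n → Matrix p p ℂ)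
    (y : Fin n → Matrix q q ℂ) : ‖tensorConj x y‖ ≤ ‖colBlock x‖ * ‖rowBlock y‖ := by
  have := norm_tensorConj_le_rowBlock_mul_colBlock (fun j => (x j)ᴴ) fun j => (y j)ᴴ
  rwa [tensorConj_conjTranspose, ← conjTranspose_rowBlock, ← conjTranspose_colBlock,
    l2_opNorm_conjTranspose, l2_opNorm_conjTranspose, l2_opNorm_conjTranspose] at this

theorem exists_norm_le_one_hsSq_mul_conjTranspose_of_diagonal {W : Matrix p ι ℂ} {d : p → ℝ}
    (hd : 0 ≤ d) (hW : W * Wᴴ = diagonal fun i => ((d i ^ 2 : ℝ) : ℂ)) :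
    ∃ X : Matrix p ι ℂ, ‖X‖ ≤ 1 ∧ hsSq (X * Wᴴ) = hsSq W := by
  set D : Matrix p p ℂ := diagonal fun i => (((d i)⁻¹ : ℝ) : ℂ)
  have hD : Dᴴ = D := conjTranspose_diagonal_ofReal _
  have mul_W : D * W * Wᴴ = diagonal fun i => (d i : ℂ) := by
    rw [Matrix.mul_assoc, hW, diagonal_mul_diagonal]
    congr 1
    ext i
    rw [← Complex.ofReal_mul, sq, ← mul_assoc, inv_mul_mul_self]
  refine ⟨D * W, ?_, ?_⟩
  · have gram : D * W * (D * W)ᴴ = diagonal fun i => ((d i * (d i)⁻¹ : ℝ) : ℂ) := by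
      rw [conjTranspose_mul, hD, ← Matrix.mul_assoc, mul_W, diagonal_mul_diagonal]
      congr 1
      ext i
      rw [Complex.ofReal_mul]
    have norm_gram : ‖D * W * (D * W)ᴴ‖ ≤ 1 := by
      rw [gram, l2_opNorm_diagonal]
      refine (pi_norm_le_iff_of_nonneg zero_le_one).mpr fun i => ?_
      rw [Complex.norm_real, Real.norm_of_nonneg (mul_nonneg (hd i) (inv_nonneg.mpr (hd i)))]
      exact mul_inv_le_one
    have norm_sq := l2_opNorm_conjTranspose_mul_self (D * W)ᴴ
    rw [conjTranspose_conjTranspose, l2_opNorm_conjTranspose] at norm_sq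
    exact (sq_le_one_iff₀ (norm_nonneg _)).mp (by rwa [sq, ← norm_sq])
  · rw [mul_W, hsSq_diagonal]
    have trace_eq : (hsSq W : ℂ) = ((∑ i, d i ^ 2 : ℝ) : ℂ) := by
      rw [ofReal_hsSq_eq_trace, hW, trace_diagonal, Complex.ofReal_sum]
    rw [Complex.ofReal_injective trace_eq]
    simp only [Complex.norm_real, Real.norm_eq_abs, sq_abs]

omit [DecidableEq p] in
open scoped ComplexOrder in
theorem exists_norm_le_one_hsSq_mul_conjTranspose (Y : Matrix p ι ℂ) :
    ∃ X : Matrix p ι ℂ, ‖X‖ ≤ 1 ∧ hsSq (X * Yᴴ) = hsSq Y := by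
  classical
  have hY := isHermitian_mul_conjTranspose_self Y
  have eigenvalues_nonneg := (posSemidef_self_mul_conjTranspose Y).eigenvalues_nonneg
  set V : Matrix p p ℂ := hY.eigenvectorUnitary.1
  have hV : V ∈ unitaryGroup p ℂ := hY.eigenvectorUnitary.2
  have diagonalized : (Vᴴ * Y) * (Vᴴ * Y)ᴴ =
      diagonal fun i => ((√(hY.eigenvalues i) ^ 2 : ℝ) : ℂ) := by
    have h : Vᴴ * (Y * Yᴴ) * V = diagonal fun i => (hY.eigenvalues i : ℂ) :=
      (Unitary.conjStarAlgAut_star_apply ..).symm.trans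
        hY.conjStarAlgAut_star_eigenvectorUnitary
    simp only [Real.sq_sqrt (eigenvalues_nonneg _), ← h, conjTranspose_mul,
      conjTranspose_conjTranspose, Matrix.mul_assoc]
  obtain ⟨X, hX, hsSq_X⟩ := exists_norm_le_one_hsSq_mul_conjTranspose_of_diagonal
    (fun i => Real.sqrt_nonneg _) diagonalized
  refine ⟨X, hX, ?_⟩
  rwa [conjTranspose_mul, conjTranspose_conjTranspose, ← Matrix.mul_assoc, hsSq_mul_unitary hV,
    hsSq_unitary_mul (conjTranspose_mem_unitaryGroup hV)] at hsSq_X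

omit [DecidableEq p] in
theorem norm_rowBlock_vecMulVec_single_le (X : Matrix p ι ℂ) (i : q) :
    ‖rowBlock fun j => vecMulVec (X.col j) (Pi.single i 1)‖ ≤ ‖X‖ := by
  refine opNorm_le_of_sq (norm_nonneg _) fun v => ?_
  have mulVec_eq : (rowBlock fun j => vecMulVec (X.col j) (Pi.single i 1)) *ᵥ v =
      X *ᵥ fun j => v (j, i) := by
    ext a
    simp [mulVec, dotProduct, Fintype.sum_prod_type, rowBlock, vecMulVec, Pi.single_apply]
  rw [mulVec_eq]
  refine (sum_norm_mulVec_sq_le X _).trans (mul_le_mul_of_nonneg_left ?_ (sq_nonneg _))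
  rw [Fintype.sum_prod_type]
  exact Finset.sum_le_sum fun j _ => Finset.single_le_sum (f := fun s => ‖v (j, s)‖ ^ 2)
    (fun _ _ => sq_nonneg _) (Finset.mem_univ i)

omit [DecidableEq q] in
theorem tensorAct_vecMulVec_single (X : Matrix p (Fin n) ℂ) (z : Fin n → Matrix q q ℂ) (i : p)
    (h : q → ℂ) :
    tensorAct (fun j => vecMulVec (X.col j) (Pi.single i 1)) z
      (vecMulVec (Pi.single i 1) (star h)) = X * (of fun t j => (z j *ᵥ h) t)ᴴ := by
  have mul_vecMulVec_mul (j : Fin n) : vecMulVec (X.col j) (Pi.single i 1) *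
      vecMulVec (Pi.single i 1) (star h) * (z j)ᴴ = vecMulVec (X.col j) (star (z j *ᵥ h)) := by
    rw [vecMulVec_mul_vecMulVec, single_dotProduct, Pi.single_eq_same, one_mul, one_smul,
      vecMulVec_mul, star_mulVec]
  simp only [tensorAct, mul_vecMulVec_mul]
  ext a t
  simp [Matrix.sum_apply, mul_apply, vecMulVec_apply]

omit [DecidableEq q] in
theorem hsSq_vecMulVec_single (i : p) (h : q → ℂ) :
    hsSq (vecMulVec (Pi.single i 1) (star h)) = ∑ s, ‖h s‖ ^ 2 := by
  rw [hsSq_eq_sum, Finset.sum_eq_single i (by intro b _ hb; simp [vecMulVec_apply, hb]) (by simp)]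
  simp [vecMulVec_apply]

/- Testing with matrices `x_j` that have a single nonzero column, formed from the partial isometry
`X` in the polar decomposition of `Y`, recovers the Hilbert–Schmidt norm of `Y = (z_j h)_j`. -/
theorem norm_colBlock_le_one_of_forall_norm_tensorConj_le [Nonempty p] {z : Fin n → Matrix p p ℂ}
    (hz : ∀ x : Fin n → Matrix p p ℂ, ‖tensorConj x z‖ ≤ ‖rowBlock x‖) : ‖colBlock z‖ ≤ 1 := by
  refine opNorm_le_of_sq zero_le_one fun h => ?_
  let i : p := Classical.arbitrary p
  let Y : Matrix p (Fin n) ℂ := of fun t j => (z j *ᵥ h) t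
  obtain ⟨X, hX, hsSq_X⟩ := exists_norm_le_one_hsSq_mul_conjTranspose Y
  have norm_test := (hz _).trans ((norm_rowBlock_vecMulVec_single_le X i).trans hX)
  calc ∑ c, ‖(colBlock z *ᵥ h) c‖ ^ 2 = hsSq Y := by
        rw [sum_norm_colBlock_mulVec_sq, hsSq_eq_sum, Finset.sum_comm]
        rfl
    _ = hsSq (tensorAct _ z (vecMulVec (Pi.single i 1) (star h))) := by
        rw [tensorAct_vecMulVec_single, hsSq_X]
    _ ≤ _ := hsSq_tensorAct_le _ z _
    _ ≤ 1 ^ 2 * ∑ s, ‖h s‖ ^ 2 := by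
        rw [hsSq_vecMulVec_single]
        gcongr

theorem norm_rowBlock_le_one_of_forall_norm_tensorConj_le [Nonempty p] {z : Fin n → Matrix p p ℂ}
    (hz : ∀ x : Fin n → Matrix p p ℂ, ‖tensorConj x z‖ ≤ ‖colBlock x‖) : ‖rowBlock z‖ ≤ 1 := by
  rw [← l2_opNorm_conjTranspose, conjTranspose_rowBlock]
  refine norm_colBlock_le_one_of_forall_norm_tensorConj_le fun x => ?_
  have := hz fun j => (x j)ᴴ
  rwa [← l2_opNorm_conjTranspose, ← tensorConj_conjTranspose, ← conjTranspose_rowBlock,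
    l2_opNorm_conjTranspose, funext fun j => conjTranspose_conjTranspose (x j)] at this

end RowsAndColumns

section Spaces

variable {n N k : ℕ}

theorem le_norm_tensorConj_of_mem_unitaryGroup {p : Type*} [Fintype p] [DecidableEq p] [Nonempty p]
    {u : Fin n → Matrix p p ℂ} (hu : ∀ j, u j ∈ unitaryGroup p ℂ) : n ≤ ‖tensorConj u u‖ := by
  have card_pos : (0 : ℝ) < Fintype.card p := Nat.cast_pos.mpr Fintype.card_pos
  have term_eq (j : Fin n) : hsInner (u j * 1 * (u j)ᴴ) 1 = Fintype.card p := by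
    rw [Matrix.mul_one, mul_conjTranspose_self_of_mem_unitaryGroup (hu j), hsInner_self, hsSq_one,
      Complex.ofReal_natCast]
  have := norm_hsInner_tensorAct_le u u (1 : Matrix p p ℂ) 1
  rw [hsInner_tensorAct, hsSq_one, mul_assoc, Real.mul_self_sqrt card_pos.le,
    Finset.sum_congr rfl fun j _ => term_eq j, Finset.sum_const, Finset.card_univ,
    Fintype.card_fin, nsmul_eq_mul, norm_mul, RCLike.norm_natCast, RCLike.norm_natCast] at this
  exact le_of_mul_le_mul_right this card_pos

theorem map_conj_map_conj {p q : Type*} (A : Matrix p q ℂ) :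
    (A.map (starRingEnd ℂ)).map (starRingEnd ℂ) = A := by
  ext
  simp

theorem norm_tensorConj_conjTuple_le_sq {E : Type*} [AddCommGroup E] [Module ℂ E]
    {S : OperatorSpace E} {e : Fin n → E} {β : ℝ}
    (hS : ∀ x, S.norm N (tupleElement e x) ≤ β * √‖tensorConj x x‖)
    {w : E →ₗ[ℂ] Matrix (Fin N) (Fin N) ℂ}
    (hw : ∀ x, (matrixSpace (Fin N) (Fin N)).norm N (amplify w N x) ≤ S.norm N x) :
    ‖tensorConj (conjTuple e w) (conjTuple e w)‖ ≤ β ^ 2 := by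
  set z := conjTuple e w
  have norm_le : ‖tensorConj z z‖ ≤ β * √‖tensorConj z z‖ := by
    have := (hw (tupleElement e z)).trans (hS z)
    rwa [norm_amplify_tupleElement] at this
  rcases (norm_nonneg (tensorConj z z)).eq_or_lt with norm_eq | norm_pos
  · exact norm_eq.symm.trans_le (sq_nonneg β)
  · have sqrt_le : √‖tensorConj z z‖ ≤ β := by
      refine le_of_mul_le_mul_right ?_ (Real.sqrt_pos.mpr norm_pos)
      rwa [Real.mul_self_sqrt norm_pos.le]
    rw [← Real.sq_sqrt norm_pos.le]
    exact pow_le_pow_left₀ (Real.sqrt_nonneg _) sqrt_le 2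

theorem coeff_tupleElement (x : Fin n → Matrix (Fin N) (Fin N) ℂ) :
    coeff (tupleElement (fun j => EuclideanSpace.single j (1 : ℂ)) x) = x := by
  ext j a b
  simp [coeff, tupleElement, Pi.single_apply]

theorem operatorHilbert_norm_tupleElement (x : Fin n → Matrix (Fin N) (Fin N) ℂ) :
    (operatorHilbert n).norm N (tupleElement (fun j => EuclideanSpace.single j (1 : ℂ)) x) =
      √‖tensorConj x x‖ := by
  change √‖tensorConj (coeff _) (coeff _)‖ = _
  rw [coeff_tupleElement]

theorem normsUnitaries_operatorHilbert [NeZero N] :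
    NormsUnitaries (operatorHilbert n) (fun j => EuclideanSpace.single j (1 : ℂ)) N 1 where
  pos := one_pos
  le_norm u hu := by
    rw [operatorHilbert_norm_tupleElement, mul_one]
    exact Real.sqrt_le_sqrt (le_norm_tensorConj_of_mem_unitaryGroup hu)
  norm_le _ hw := norm_tensorConj_conjTuple_le_sq
    (fun x => by rw [operatorHilbert_norm_tupleElement, one_mul]) hw

section Maximal

variable {E : Type*} [NormedAddCommGroup E] [NormedSpace ℂ E]

theorem le_maximalSpace (w : E →ₗ[ℂ] Matrix (Fin k) (Fin k) ℂ) (hw : ∀ a, ‖w a‖ ≤ ‖a‖) (m : ℕ)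
    (x : Matrix (Fin m) (Fin m) E) :
    (matrixSpace (Fin k) (Fin k)).norm m (amplify w m x) ≤ (maximalSpace E).norm m x := by
  refine le_ciSup (f := fun i : (k : ℕ) ×
      {u : E →ₗ[ℂ] Matrix (Fin k) (Fin k) ℂ // ∀ e, ‖u e‖ ≤ ‖e‖} =>
        ((matrixSpace (Fin i.1) (Fin i.1)).toMatrixSeminorm.pullback i.2.1).norm m x)
    ⟨∑ i, ∑ j, ‖x i j‖, ?_⟩ ⟨k, w, hw⟩
  rintro _ ⟨⟨k, u, hu⟩, rfl⟩
  refine (MatrixSeminorm.norm_le_sum _ m _).trans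
    (Finset.sum_le_sum fun i _ => Finset.sum_le_sum fun j _ => ?_)
  exact (matrixSpace_norm_one _).trans_le (hu (x i j))

theorem maximalSpace_le {m : ℕ} {x : Matrix (Fin m) (Fin m) E} {c : ℝ} (hc : 0 ≤ c)
    (h : ∀ (k : ℕ) (w : E →ₗ[ℂ] Matrix (Fin k) (Fin k) ℂ), (∀ a, ‖w a‖ ≤ ‖a‖) →
      (matrixSpace (Fin k) (Fin k)).norm m (amplify w m x) ≤ c) :
    (maximalSpace E).norm m x ≤ c :=
  Real.iSup_le (fun i : (k : ℕ) ×
      {u : E →ₗ[ℂ] Matrix (Fin k) (Fin k) ℂ // ∀ e, ‖u e‖ ≤ ‖e‖} => h i.1 i.2.1 i.2.2) hc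

end Maximal

/-- The canonical basis of `ℓ₁^n`. -/
def ellOneBasis (n : ℕ) (j : Fin n) : PiLp 1 fun _ : Fin n => ℂ := WithLp.toLp 1 (Pi.single j 1)

theorem norm_ellOneBasis (j : Fin n) : ‖ellOneBasis n j‖ = 1 := by
  simp [ellOneBasis]

theorem maxEllOne_norm_tupleElement_le (x : Fin n → Matrix (Fin N) (Fin N) ℂ) :
    (maxEllOne n).norm N (tupleElement (ellOneBasis n) x) ≤ √n * √‖tensorConj x x‖ := by
  refine maximalSpace_le (by positivity) fun k w hw => ?_
  rw [norm_amplify_tupleElement, mul_comm]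
  refine (norm_tensorConj_le _ _).trans ?_
  gcongr
  exact norm_tensorConj_self_le fun j =>
    (norm_map_conj_le _).trans ((hw _).trans (norm_ellOneBasis j).le)

theorem le_maxEllOne_norm_tupleElement [NeZero N] {u : Fin n → Matrix (Fin N) (Fin N) ℂ}
    (hu : ∀ j, u j ∈ unitaryGroup (Fin N) ℂ) :
    n ≤ (maxEllOne n).norm N (tupleElement (ellOneBasis n) u) := by
  let w : (PiLp 1 fun _ : Fin n => ℂ) →ₗ[ℂ] Matrix (Fin N) (Fin N) ℂ :=
    Fintype.linearCombination ℂ (fun j => (u j).map (starRingEnd ℂ)) ∘ₗ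
      (WithLp.linearEquiv 1 ℂ (Fin n → ℂ)).toLinearMap
  have conjTuple_w : conjTuple (ellOneBasis n) w = u := funext fun j => by
    simp [conjTuple, w, ellOneBasis, -Matrix.map_map, map_conj_map_conj]
  have norm_w_le (a : PiLp 1 fun _ : Fin n => ℂ) : ‖w a‖ ≤ ‖a‖ := by
    have w_apply : w a = ∑ j, a j • (u j).map (starRingEnd ℂ) := rfl
    rw [PiLp.norm_eq_of_L1, w_apply]
    refine (norm_sum_le _ _).trans (Finset.sum_le_sum fun j _ => ?_)
    rw [norm_smul]
    exact mul_le_of_le_one_right (norm_nonneg _)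
      ((norm_map_conj_le _).trans (norm_le_one_of_mem_unitaryGroup (hu j)))
  refine (le_norm_tensorConj_of_mem_unitaryGroup hu).trans ?_
  have := le_maximalSpace w norm_w_le N (tupleElement (ellOneBasis n) u)
  rwa [norm_amplify_tupleElement, conjTuple_w] at this

theorem normsUnitaries_maxEllOne [NeZero n] [NeZero N] :
    NormsUnitaries (maxEllOne n) (ellOneBasis n) N √n where
  pos := Real.sqrt_pos.mpr (Nat.cast_pos.mpr (NeZero.pos n))
  le_norm _ hu := by
    rw [Real.mul_self_sqrt (Nat.cast_nonneg n)]
    exact le_maxEllOne_norm_tupleElement hu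
  norm_le _ hw := norm_tensorConj_conjTuple_le_sq maxEllOne_norm_tupleElement_le hw

section RowPlusColumn

variable {m : ℕ}

theorem le_rowPlusColumn {w : (Fin n → ℂ) →ₗ[ℂ] Matrix (Fin k) (Fin k) ℂ}
    (hr : IsCompleteContraction (rowSpace n) (matrixSpace (Fin k) (Fin k)) w)
    (hc : IsCompleteContraction (columnSpace n) (matrixSpace (Fin k) (Fin k)) w)
    (x : Matrix (Fin m) (Fin m) (Fin n → ℂ)) :
    (matrixSpace (Fin k) (Fin k)).norm m (amplify w m x) ≤ (rowPlusColumn n).norm m x := by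
  have : Nonempty {z : Matrix (Fin m) (Fin m) ((Fin n → ℂ) × (Fin n → ℂ)) //
      amplify (LinearMap.id.coprod LinearMap.id) m z = x} :=
    ⟨x.map fun a => (a, 0), by ext; simp [amplify]⟩
  refine le_ciInf fun z => ?_
  have amplify_eq : amplify w m x = amplify (w.coprod w) m z.1 := by
    conv_lhs => rw [← z.2]
    ext
    simp [amplify]
  rw [amplify_eq]
  exact le_oneSum (rowSpace n) (columnSpace n) _ _ hr hc m z.1

theorem rowPlusColumn_le_oneSum (z : Matrix (Fin m) (Fin m) ((Fin n → ℂ) × (Fin n → ℂ))) :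
    (rowPlusColumn n).norm m (amplify (LinearMap.id.coprod LinearMap.id) m z) ≤
      (oneSum (rowSpace n) (columnSpace n)).norm m z :=
  ciInf_le (f := fun z' : {z' : Matrix (Fin m) (Fin m) ((Fin n → ℂ) × (Fin n → ℂ)) //
      amplify (LinearMap.id.coprod LinearMap.id) m z' =
        amplify (LinearMap.id.coprod LinearMap.id) m z} =>
      (oneSum (rowSpace n) (columnSpace n)).norm m z')
    ⟨0, by rintro _ ⟨z, rfl⟩; exact MatrixSeminorm.norm_nonneg _ _ _⟩ ⟨z, rfl⟩

theorem rowPlusColumn_le_rowSpace (x : Matrix (Fin m) (Fin m) (Fin n → ℂ)) :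
    (rowPlusColumn n).norm m x ≤ (rowSpace n).norm m x := by
  have sum_eq : amplify (LinearMap.id.coprod LinearMap.id) m (x.map fun a => (a, 0)) = x := by
    ext
    simp [amplify]
  have := rowPlusColumn_le_oneSum (x.map fun a => (a, (0 : Fin n → ℂ)))
  rw [sum_eq] at this
  refine this.trans (Real.iSup_le ?_ ((rowSpace n).norm_nonneg m x))
  rintro ⟨k, ⟨u, hu⟩, v, hv⟩
  refine le_of_eq_of_le (congrArg ((matrixSpace (Fin k) (Fin k)).norm m) ?_) (hu m x)
  ext
  simp [amplify]

theorem rowPlusColumn_le_columnSpace (x : Matrix (Fin m) (Fin m) (Fin n → ℂ)) :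
    (rowPlusColumn n).norm m x ≤ (columnSpace n).norm m x := by
  have sum_eq : amplify (LinearMap.id.coprod LinearMap.id) m (x.map fun a => (0, a)) = x := by
    ext
    simp [amplify]
  have := rowPlusColumn_le_oneSum (x.map fun a => ((0 : Fin n → ℂ), a))
  rw [sum_eq] at this
  refine this.trans (Real.iSup_le ?_ ((columnSpace n).norm_nonneg m x))
  rintro ⟨k, ⟨u, hu⟩, v, hv⟩
  refine le_of_eq_of_le (congrArg ((matrixSpace (Fin k) (Fin k)).norm m) ?_) (hv m x)
  ext
  simp [amplify]

/-- The canonical basis of `ℂ^n`, which is that of `R_n` and that of `C_n`. -/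
def rowColumnBasis (n : ℕ) (j : Fin n) : Fin n → ℂ := Pi.single j 1

theorem tupleElement_rowColumnBasis_apply (x : Fin n → Matrix (Fin m) (Fin m) ℂ) (a b : Fin m)
    (j : Fin n) : tupleElement (rowColumnBasis n) x a b j = x j a b := by
  simp [tupleElement, rowColumnBasis, Pi.single_apply]

theorem exists_tupleElement_rowColumnBasis_eq (x : Matrix (Fin m) (Fin m) (Fin n → ℂ)) :
    ∃ y, tupleElement (rowColumnBasis n) y = x :=
  ⟨fun j => x.map (· j), by ext; rw [tupleElement_rowColumnBasis_apply]; rfl⟩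

theorem rowSpace_norm_tupleElement (x : Fin n → Matrix (Fin m) (Fin m) ℂ) :
    (rowSpace n).norm m (tupleElement (rowColumnBasis n) x) = ‖rowBlock x‖ := by
  let A : Matrix (Fin m × Unit) (Fin m × Fin n) ℂ :=
    (rowBlock x).submatrix (Equiv.prodPUnit _) (Equiv.prodComm _ _)
  have comp_eq : (rowSpace n).norm m (tupleElement (rowColumnBasis n) x) = ‖A‖ := by
    refine congrArg norm (Matrix.ext fun c d => ?_)
    exact tupleElement_rowColumnBasis_apply x c.1 d.1 d.2
  have rowBlock_eq : rowBlock x = A.submatrix (Equiv.prodPUnit _).symm (Equiv.prodComm _ _) := rfl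
  rw [comp_eq]
  refine le_antisymm (norm_submatrix_equiv_le _ _ _) ?_
  rw [rowBlock_eq]
  exact norm_submatrix_equiv_le _ _ _

theorem columnSpace_norm_tupleElement (x : Fin n → Matrix (Fin m) (Fin m) ℂ) :
    (columnSpace n).norm m (tupleElement (rowColumnBasis n) x) = ‖colBlock x‖ := by
  let A : Matrix (Fin m × Fin n) (Fin m × Unit) ℂ :=
    (colBlock x).submatrix (Equiv.prodComm _ _) (Equiv.prodPUnit _)
  have comp_eq : (columnSpace n).norm m (tupleElement (rowColumnBasis n) x) = ‖A‖ := by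
    refine congrArg norm (Matrix.ext fun c d => ?_)
    exact tupleElement_rowColumnBasis_apply x c.1 d.1 c.2
  have colBlock_eq : colBlock x = A.submatrix (Equiv.prodComm _ _) (Equiv.prodPUnit _).symm := rfl
  rw [comp_eq]
  refine le_antisymm (norm_submatrix_equiv_le _ _ _) ?_
  rw [colBlock_eq]
  exact norm_submatrix_equiv_le _ _ _

theorem isCompleteContraction_rowSpace {w : (Fin n → ℂ) →ₗ[ℂ] Matrix (Fin k) (Fin k) ℂ}
    (hw : ‖colBlock (conjTuple (rowColumnBasis n) w)‖ ≤ 1) :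
    IsCompleteContraction (rowSpace n) (matrixSpace (Fin k) (Fin k)) w := fun m x => by
  obtain ⟨y, rfl⟩ := exists_tupleElement_rowColumnBasis_eq x
  rw [norm_amplify_tupleElement, rowSpace_norm_tupleElement]
  exact (norm_tensorConj_le_rowBlock_mul_colBlock _ _).trans
    (mul_le_of_le_one_right (norm_nonneg _) hw)

theorem isCompleteContraction_columnSpace {w : (Fin n → ℂ) →ₗ[ℂ] Matrix (Fin k) (Fin k) ℂ}
    (hw : ‖rowBlock (conjTuple (rowColumnBasis n) w)‖ ≤ 1) :
    IsCompleteContraction (columnSpace n) (matrixSpace (Fin k) (Fin k)) w := fun m x => by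
  obtain ⟨y, rfl⟩ := exists_tupleElement_rowColumnBasis_eq x
  rw [norm_amplify_tupleElement, columnSpace_norm_tupleElement]
  exact (norm_tensorConj_le_colBlock_mul_rowBlock _ _).trans
    (mul_le_of_le_one_right (norm_nonneg _) hw)

theorem conjTuple_linearCombination (z : Fin n → Matrix (Fin k) (Fin k) ℂ) :
    conjTuple (rowColumnBasis n)
      (Fintype.linearCombination ℂ fun j => (z j).map (starRingEnd ℂ)) = z :=
  funext fun j => by simp [conjTuple, rowColumnBasis, -Matrix.map_map, map_conj_map_conj]

theorem le_rowPlusColumn_norm_tupleElement [NeZero N] {u : Fin n → Matrix (Fin N) (Fin N) ℂ}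
    (hu : ∀ j, u j ∈ unitaryGroup (Fin N) ℂ) :
    √n ≤ (rowPlusColumn n).norm N (tupleElement (rowColumnBasis n) u) := by
  set z : Fin n → Matrix (Fin N) (Fin N) ℂ := (((√n)⁻¹ : ℝ) : ℂ) • u with hz
  have sqrt_sum_le : √(∑ j, ‖z j‖ ^ 2) ≤ 1 := by
    have norm_sq_le (j : Fin n) : ‖z j‖ ^ 2 ≤ (n : ℝ)⁻¹ := by
      rw [hz, Pi.smul_apply, norm_smul, mul_pow, Complex.norm_real, Real.norm_eq_abs, sq_abs,
        inv_pow, Real.sq_sqrt (Nat.cast_nonneg n)]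
      exact mul_le_of_le_one_right (by positivity)
        (pow_le_one₀ (norm_nonneg _) (norm_le_one_of_mem_unitaryGroup (hu j)))
    refine Real.sqrt_le_one.mpr ((Finset.sum_le_card_nsmul _ _ _ fun j _ => norm_sq_le j).trans ?_)
    rw [Finset.card_univ, Fintype.card_fin, nsmul_eq_mul]
    exact mul_inv_le_one
  have norm_tensorConj_eq : ‖tensorConj u z‖ = (√n)⁻¹ * ‖tensorConj u u‖ := by
    have := tensorConj_smul_smul 1 (√n)⁻¹ u u
    rw [Complex.ofReal_one, one_smul, one_mul] at this
    rw [hz, this, norm_smul, Complex.norm_real, Real.norm_of_nonneg (by positivity)]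
  have le_norm := le_rowPlusColumn
    (isCompleteContraction_rowSpace
      (by rw [conjTuple_linearCombination]; exact (norm_colBlock_le z).trans sqrt_sum_le))
    (isCompleteContraction_columnSpace
      (by rw [conjTuple_linearCombination]; exact (norm_rowBlock_le z).trans sqrt_sum_le))
    (tupleElement (rowColumnBasis n) u)
  rw [norm_amplify_tupleElement, conjTuple_linearCombination, norm_tensorConj_eq] at le_norm
  refine le_trans ?_ le_norm
  calc √n = (√n)⁻¹ * n := by rw [← div_eq_inv_mul, Real.div_sqrt]
    _ ≤ (√n)⁻¹ * ‖tensorConj u u‖ := by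
      gcongr
      exact le_norm_tensorConj_of_mem_unitaryGroup hu

theorem norm_tensorConj_conjTuple_le_one_of_rowPlusColumn [NeZero N]
    {w : (Fin n → ℂ) →ₗ[ℂ] Matrix (Fin N) (Fin N) ℂ}
    (hw : ∀ x, (matrixSpace (Fin N) (Fin N)).norm N (amplify w N x) ≤ (rowPlusColumn n).norm N x) :
    ‖tensorConj (conjTuple (rowColumnBasis n) w) (conjTuple (rowColumnBasis n) w)‖ ≤ 1 := by
  set z := conjTuple (rowColumnBasis n) w
  have norm_colBlock : ‖colBlock z‖ ≤ 1 :=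
    norm_colBlock_le_one_of_forall_norm_tensorConj_le fun x => by
      rw [← norm_amplify_tupleElement, ← rowSpace_norm_tupleElement]
      exact (hw _).trans (rowPlusColumn_le_rowSpace _)
  have norm_rowBlock : ‖rowBlock z‖ ≤ 1 :=
    norm_rowBlock_le_one_of_forall_norm_tensorConj_le fun x => by
      rw [← norm_amplify_tupleElement, ← columnSpace_norm_tupleElement]
      exact (hw _).trans (rowPlusColumn_le_columnSpace _)
  exact (norm_tensorConj_le_rowBlock_mul_colBlock z z).trans
    (mul_le_one₀ norm_rowBlock (norm_nonneg _) norm_colBlock)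

theorem normsUnitaries_rowPlusColumn [NeZero N] :
    NormsUnitaries (rowPlusColumn n) (rowColumnBasis n) N 1 where
  pos := one_pos
  le_norm _ hu := (mul_one _).trans_le (le_rowPlusColumn_norm_tupleElement hu)
  norm_le _ hw :=
    (norm_tensorConj_conjTuple_le_one_of_rowPlusColumn hw).trans_eq (one_pow 2).symm

end RowPlusColumn

end Spaces

end MatricialMultiplicity

end

theorem mainTheorem2 :
    ∃ (C₁ b : ℝ) (n₀ : ℕ), 1 < C₁ ∧ 0 < b ∧ 1 < n₀ ∧
      ∀ n N : ℕ, n₀ ≤ n → 1 ≤ N →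
        ENNReal.ofReal (Real.exp (b * n * N ^ 2)) ≤
            (MatricialMultiplicity.multiplicity (MatricialMultiplicity.operatorHilbert n) N C₁ :
              ENNReal) ∧
        ENNReal.ofReal (Real.exp (b * n * N ^ 2)) ≤
            (MatricialMultiplicity.multiplicity (MatricialMultiplicity.maxEllOne n) N C₁ :
              ENNReal) ∧
        ENNReal.ofReal (Real.exp (b * n * N ^ 2)) ≤
            (MatricialMultiplicity.multiplicity (MatricialMultiplicity.rowPlusColumn n) N C₁ :
              ENNReal) := by
  refine ⟨1 + 1 / 10 ^ 25, 1 / 250, 5, by norm_num, by norm_num, by norm_num, fun n N hn hN => ?_⟩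
  have : NeZero n := ⟨by omega⟩
  have : NeZero N := ⟨by omega⟩
  exact ⟨MatricialMultiplicity.normsUnitaries_operatorHilbert.exp_le_multiplicity hn,
    MatricialMultiplicity.normsUnitaries_maxEllOne.exp_le_multiplicity hn,
    MatricialMultiplicity.normsUnitaries_rowPlusColumn.exp_le_multiplicity hn⟩
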